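/- **Language.** Dimension terms $r$ over a finite set $\Psi$ of dimension names are $0$, $1$ and the names $x\in\Psi$; $\varepsilon$ ranges over $\{0,1\}$. A substitution $\psi:\Psi'\to\Psi$ assigns to each name of $\Psi$ a dimension term over $\Psi'$. The terms are $$a,\ (a{:}A)\to B,\ (a{:}A)\times B,\ \mathsf{Id}_{x.A}(P_0,P_1),\ \mathsf{bool},\ \mathsf{not}_r,\ \mathbb S^1,\ \lambda a.M,\ MN,\ \langle M,N\rangle,\ \mathsf{fst}(M),\ \mathsf{snd}(M),\ \langle x\rangle M,\ M@r,\ \mathsf{true},\ \mathsf{false},\ \mathsf{if}_{a.A}(M;T,F),$$ $$\mathsf{notel}_r(M),\ \mathsf{base},\ \mathsf{loop}_r,\ \mathbb S^1\text{-}\mathsf{elim}_{a.A}(M;P,x.L),\ \mathsf{coe}_{x.A}(r\rightsquigarrow r',M),\ \mathsf{hcom}_A^{r_0,\dots,r_k}(r\rightsquigarrow r',M;\overrightarrow{y.N_i^\varepsilon})\ (k\ge 0);$$ the extended language has in addition $\mathsf{ia}_r(A,B,F,G)$, $\mathsf{iain}_r(M,F)$, $\mathsf{iaout}_r(M,G)$.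 Both are closed under (capture-avoiding) substitution of dimension terms and terms. Abbreviations: $\mathsf{not}(M)=\mathsf{if}_{\_.\mathsf{bool}}(M;\mathsf{false},\mathsf{true})$; $A\to B$ is non-dependent; $\mathsf{com}_{y.A}^{\vec r}(r\rightsquigarrow r',M;\overrightarrow{y.N_i^\varepsilon})=\mathsf{hcom}_{A\langle r'/y\rangle}^{\vec r}(r\rightsquigarrow r',\mathsf{coe}_{y.A}(r\rightsquigarrow r',M);\overrightarrow{y.\mathsf{coe}_{y.A}(y\rightsquigarrow r',N_i^\varepsilon)})$. When two faces are listed in a tube for one extent, the first is the face $\varepsilon=0$. We abbreviate $\mathsf{hcom}_A(s)=\mathsf{hcom}_A^{\vec r}(r\rightsquigarrow s,M;\overrightarrow{y.N_i^\varepsilon})$. **Evaluation** (of terms without free term variables; names $x,w,x_i$ are not $0,1$). The *values* are $(a{:}A)\to B$, $(a{:}A)\times B$, $\mathsf{Id}_{x.A}(P_0,P_1)$, $\mathsf{bool}$, $\mathsf{not}_x$, $\mathbb S^1$, $\lambda a.M$, $\langle M,N\rangle$, $\langle x\rangle M$, $\mathsf{true}$, $\mathsf{false}$, $\mathsf{base}$,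 $\mathsf{loop}_x$, $\mathsf{notel}_x(M)$, $\mathsf{hcom}^{\vec x}_{C}(r\rightsquigarrow r',M;\overrightarrow{y.N_i^\varepsilon})$ for $C\in\{\mathsf{bool},\mathbb S^1\}$ and $r\ne r'$, and $\mathsf{ia}_x(A,B,F,G)$, $\mathsf{iain}_x(M,F)$. One-step evaluation $\longmapsto$ is generated as follows; $M\Downarrow V$ means $M\longmapsto^* V$ with $V$ a value. * The principal argument is evaluated in $\mathsf{coe}_{x.A}$ and $\mathsf{hcom}_A$ (the type $A$), and in $MN$, $\mathsf{fst}(M)$, $\mathsf{snd}(M)$, $M@r$, $\mathsf{if}_{a.A}(M;T,F)$, $\mathbb S^1\text{-}\mathsf{elim}_{a.A}(M;P,x.L)$, $\mathsf{iaout}_x(M,G)$ and $\mathsf{coe}_{x.\mathsf{not}_x}(w\rightsquigarrow r,M)$ (the term $M$). * $(\lambda a.M)N\longmapsto M[N/a]$; $\mathsf{fst}\langle M,N\rangle\longmapsto M$; $\mathsf{snd}\langle M,N\rangle\longmapsto N$; $(\langle x\rangle M)@r\longmapsto M\langle r/x\rangle$; $\mathsf{not}_\varepsilon\longmapsto\mathsf{bool}$;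 $\mathsf{loop}_\varepsilon\longmapsto\mathsf{base}$. * $\mathsf{hcom}_{(a:A)\to B}(r')\longmapsto\lambda a.\mathsf{hcom}_B^{\vec r}(r\rightsquigarrow r',Ma;\overrightarrow{y.N_i^\varepsilon a})$; $\mathsf{coe}_{x.(a:A)\to B}(r\rightsquigarrow r',M)\longmapsto\lambda a.\mathsf{coe}_{x.B[\mathsf{coe}_{x.A}(r'\rightsquigarrow x,a)/a]}(r\rightsquigarrow r',M(\mathsf{coe}_{x.A}(r'\rightsquigarrow r,a)))$. * $\mathsf{hcom}_{(a:A)\times B}(r')\longmapsto\langle H_{r'},\mathsf{com}^{\vec r}_{z.B[H_z/a]}(r\rightsquigarrow r',\mathsf{snd}(M);\overrightarrow{y.\mathsf{snd}(N_i^\varepsilon)})\rangle$ with $H_s=\mathsf{hcom}_A^{\vec r}(r\rightsquigarrow s,\mathsf{fst}(M);\overrightarrow{y.\mathsf{fst}(N_i^\varepsilon)})$; $\mathsf{coe}_{x.(a:A)\times B}(r\rightsquigarrow r',M)\longmapsto\langle\mathsf{coe}_{x.A}(r\rightsquigarrow r',\mathsf{fst}(M)),\mathsf{coe}_{x.B[\mathsf{coe}_{x.A}(r\rightsquigarrow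 x,\mathsf{fst}(M))/a]}(r\rightsquigarrow r',\mathsf{snd}(M))\rangle$. * $\mathsf{hcom}_{\mathsf{Id}_{x.A}(P_0,P_1)}(r')\longmapsto\langle x\rangle\mathsf{hcom}_A^{\vec r,x}(r\rightsquigarrow r',M@x;\overrightarrow{y.N_i^\varepsilon@x},\_.P_0,\_.P_1)$; $\mathsf{coe}_{y.\mathsf{Id}_{x.A}(P_0,P_1)}(r\rightsquigarrow r',M)\longmapsto\langle x\rangle\mathsf{com}^{x}_{y.A}(r\rightsquigarrow r',M@x;y.P_0,y.P_1)$. * For $C\in\{\mathsf{bool},\mathbb S^1\}$: $\mathsf{hcom}_C(r')\longmapsto N_i^\varepsilon\langle r'/y\rangle$ if $r_i=\varepsilon$ and $r_j$ is a name for all $j<i$; $\mathsf{hcom}_C(r')\longmapsto M$ if all $r_i$ are names and $r=r'$; $\mathsf{coe}_{x.C}(r\rightsquigarrow r',M)\longmapsto M$. * $\mathsf{if}_{a.A}(\mathsf{true};T,F)\longmapsto T$; $\mathsf{if}_{a.A}(\mathsf{false};T,F)\longmapsto F$; if all $r_i$ are names and $r\ne r'$, $\mathsf{if}_{a.A}(\mathsf{hcom}_{\mathsf{bool}}(r');T,F)\longmapsto\mathsf{com}^{\vec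 r}_{z.A[\mathsf{hcom}_{\mathsf{bool}}(z)/a]}(r\rightsquigarrow r',\mathsf{if}_{a.A}(M;T,F);\overrightarrow{y.\mathsf{if}_{a.A}(N_i^\varepsilon;T,F)})$. * $\mathbb S^1\text{-}\mathsf{elim}_{a.A}(\mathsf{base};P,x.L)\longmapsto P$; $\mathbb S^1\text{-}\mathsf{elim}_{a.A}(\mathsf{loop}_w;P,x.L)\longmapsto L\langle w/x\rangle$; and on $\mathsf{hcom}_{\mathbb S^1}(r')$ (all $r_i$ names, $r\ne r'$) as for $\mathsf{if}$. * $\mathsf{notel}_0(M)\longmapsto\mathsf{not}(M)$; $\mathsf{notel}_1(M)\longmapsto M$; $\mathsf{coe}_{x.\mathsf{not}_x}(\varepsilon\rightsquigarrow 1-\varepsilon,M)\longmapsto\mathsf{not}(M)$; $\mathsf{coe}_{x.\mathsf{not}_x}(\varepsilon\rightsquigarrow\varepsilon,M)\longmapsto M$; $\mathsf{coe}_{x.\mathsf{not}_x}(0\rightsquigarrow w,M)\longmapsto\mathsf{notel}_w(\mathsf{not}(M))$; $\mathsf{coe}_{x.\mathsf{not}_x}(1\rightsquigarrow w,M)\longmapsto\mathsf{notel}_w(M)$;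 $\mathsf{coe}_{x.\mathsf{not}_x}(w\rightsquigarrow r,\mathsf{notel}_w(M))\longmapsto\mathsf{notel}_r(M)$; $\mathsf{coe}_{x.\mathsf{not}_w}(r\rightsquigarrow r',M)\longmapsto M$ for $w\neq x$; $\mathsf{hcom}_{\mathsf{not}_w}(r')\longmapsto\mathsf{notel}_w(\mathsf{hcom}^{\vec r}_{\mathsf{bool}}(r\rightsquigarrow r',\mathsf{coe}_{x.\mathsf{not}_x}(w\rightsquigarrow1,M);\overrightarrow{y.\mathsf{coe}_{x.\mathsf{not}_x}(w\rightsquigarrow1,N_i^\varepsilon)}))$. * $\mathsf{ia}_0(A,B,F,G)\longmapsto A$; $\mathsf{ia}_1(A,B,F,G)\longmapsto B$; $\mathsf{iain}_0(M,F)\longmapsto M$; $\mathsf{iain}_1(M,F)\longmapsto FM$; $\mathsf{iaout}_0(M,G)\longmapsto M$; $\mathsf{iaout}_1(M,G)\longmapsto GM$; $\mathsf{iaout}_x(\mathsf{iain}_x(M,F),G)\longmapsto M$; $\mathsf{coe}_{x.\mathsf{ia}_x(A,B,F,G)}(r\rightsquigarrow r',M)\longmapsto\mathsf{iain}_{r'}(\mathsf{coe}_{x.A}(r\rightsquigarrow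 r',\mathsf{iaout}_r(M,G\langle r/x\rangle)),F\langle r'/x\rangle)$; for $w\ne x$, $\mathsf{coe}_{x.\mathsf{ia}_w(A,B,F,G)}(r\rightsquigarrow r',M)\longmapsto\mathsf{iain}_w(C,F\langle r'/x\rangle)$ with $C=\mathsf{com}^w_{x.A}(r\rightsquigarrow r',\mathsf{iaout}_w(M,G\langle r/x\rangle);y.\mathsf{coe}_{x.A}(r\rightsquigarrow y,M),y.G\langle y/x\rangle(\mathsf{coe}_{x.B}(r\rightsquigarrow y,M)))$; and $\mathsf{hcom}_{\mathsf{ia}_x(A,B,F,G)}(r')\longmapsto\mathsf{iain}_x(\mathsf{hcom}_A^{\vec r,x}(r\rightsquigarrow r',\mathsf{iaout}_x(M,G);\overrightarrow{y.\mathsf{iaout}_x(N_i^\varepsilon,G)},z.\mathsf{hcom}_A(z),z.G(\mathsf{hcom}_B(z))),F)$. **Orders.** $\mathsf{VPER}$ is the collection of relations $R(\Psi,M,N)$ over values at $\Psi$ (with no free term variables) such that each $R(\Psi,-,-)$ is symmetric and transitive; $R\sqsubseteq S$ means $R\subseteq S$ and $R(\Psi,M,-)=S(\Psi,M,-)$ whenever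 $R(\Psi,M,M)$. A *cubical type system* is a pair $(E,\Phi)$ with $E\in\mathsf{VPER}$ and, for each $A$ with $E(\Psi,A,A)$, a symmetric and transitive relation $\Phi(\Psi,A,-,-)$ over values at $\Psi$, such that $\Phi(\Psi,A,-,-)=\Phi(\Psi,B,-,-)$ whenever $E(\Psi,A,B)$. Let $\mathsf{CTS}$ be their collection; $(E,\Phi)\sqsubseteq(E',\Phi')$ means $E\sqsubseteq E'$ and $\Phi(\Psi,A,-,-)=\Phi'(\Psi,A,-,-)$ whenever $E(\Psi,A,A)$. A *complete partial order* is a partial order with a least element and joins of all (nonempty) directed subsets. **Judgments** relative to $(E,\Phi)$ (each includes its presuppositions). * $A\doteq B\ \mathsf{pretype}\ [\Psi]$: for all $\psi_1:\Psi_1\to\Psi$ and $\psi_2:\Psi_2\to\Psi_1$ one has $A\psi_1\Downarrow A_1$, $A_1\psi_2\Downarrow A_2$, $A\psi_1\psi_2\Downarrow A_{12}$ and likewise $B_1,B_2,B_{12}$ for $B$, and $E(\Psi_2,-,-)$ relates all of $A_2,A_{12},B_2,B_{12}$. * $M\doteq N\in A\ [\Psi]$: $A$ is a pretype and for all $\psi_1,\psi_2$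 as above, with $M_1,M_2,M_{12}$, $N_1,N_2,N_{12}$ defined in the same way, these evaluations exist, $A\psi_1\psi_2\Downarrow A_{12}$, and $\Phi(\Psi_2,A_{12},-,-)$ relates all of $M_2,M_{12},N_2,N_{12}$. * Restricted judgments $\mathcal J\ [\Psi\mid\Xi]$, for a set $\Xi$ of equations between dimension terms: $\mathcal J\psi\ [\Psi']$ for all $\psi:\Psi'\to\Psi$ satisfying $\Xi$. * A pretype $A$ is *cubical* if, whenever $A\psi\Downarrow A_0$ for $\psi:\Psi'\to\Psi$, $\Phi(\Psi',A_0,M,N)$ implies $M\doteq N\in A\psi\ [\Psi']$. * $A,B$ are *equally Kan* if for all $\psi:\Psi'\to\Psi$ the following hold. (1) If $M\doteq O\in A\psi\ [\Psi']$, $N_i^\varepsilon\doteq N_j^{\varepsilon'}\in A\psi\ [\Psi',y\mid r_i=\varepsilon,r_j=\varepsilon']$, $N_i^\varepsilon\doteq P_i^\varepsilon\in A\psi\ [\Psi',y\mid r_i=\varepsilon]$ and $N_i^\varepsilon\langle r/y\rangle\doteq M\in A\psi\ [\Psi'\mid r_i=\varepsilon]$ for all $i,j,\varepsilon,\varepsilon'$,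 then $\mathsf{hcom}_{A\psi}^{\vec r}(r\rightsquigarrow r',M;\overrightarrow{y.N_i^\varepsilon})\doteq\mathsf{hcom}_{B\psi}^{\vec r}(r\rightsquigarrow r',O;\overrightarrow{y.P_i^\varepsilon})\in A\psi\ [\Psi']$. (2) Under these conditions with $O=M$, $P=N$, $\mathsf{hcom}_{A\psi}^{\vec r}(r\rightsquigarrow r',M;\overrightarrow{y.N_i^\varepsilon})\doteq M\in A\psi$ if $r=r'$, and $\doteq N_i^\varepsilon\langle r'/y\rangle\in A\psi$ if $r_i=\varepsilon$. (3) For $\psi:(\Psi',x)\to\Psi$, if $M\doteq N\in A\psi\langle r/x\rangle\ [\Psi']$ then $\mathsf{coe}_{x.A\psi}(r\rightsquigarrow r',M)\doteq\mathsf{coe}_{x.B\psi}(r\rightsquigarrow r',N)\in A\psi\langle r'/x\rangle\ [\Psi']$; and if $M\doteq M\in A\psi\langle r/x\rangle\ [\Psi']$ then $\mathsf{coe}_{x.A\psi}(r\rightsquigarrow r,M)\doteq M\in A\psi\langle r/x\rangle\ [\Psi']$. * $A\doteq B\ \mathsf{type}\ [\Psi]$: $A\doteq B$ are equal pretypes,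 both cubical, and equally Kan. * $a:A\gg B\doteq B'\ \mathsf{pretype}\ [\Psi]$ (resp. $\mathsf{type}$): $A$ is a pretype and, for all $\psi:\Psi'\to\Psi$ and $N\doteq N'\in A\psi\ [\Psi']$, $B\psi[N/a]\doteq B'\psi[N'/a]$ are equal pretypes (resp. types). $a:A\gg M\doteq M'\in B\ [\Psi]$: $a:A\gg B\doteq B\ \mathsf{pretype}$ and $M\psi[N/a]\doteq M'\psi[N'/a]\in B\psi[N/a]\ [\Psi']$ for the same $\psi,N,N'$. **Canonical booleans and circle.** For $R\in\mathsf{VPER}$, $R^\square(\Psi,M,N)$ means that for all $\psi_1,\psi_2$ as above the evaluations $M_1,M_2,M_{12},N_1,N_2,N_{12}$ exist and $R(\Psi_2,-,-)$ relates all of $M_2,M_{12},N_2,N_{12}$; restricted versions are as above. Let $\mathcal H_C(R)$ be the set of all $(\Psi,\mathsf{hcom}_C^{\vec x}(r\rightsquigarrow r',M;\overrightarrow{y.N_i^\varepsilon}),\mathsf{hcom}_C^{\vec x}(r\rightsquigarrow r',O;\overrightarrow{y.P_i^\varepsilon}))$ with all $x_i$ names, $r\ne r'$, and, for all $i,j,\varepsilon,\varepsilon'$,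 $R^\square(\Psi,M,O)$, $R^\square((\Psi,y\mid x_i=\varepsilon,x_j=\varepsilon'),N_i^\varepsilon,N_j^{\varepsilon'})$, $R^\square((\Psi,y\mid x_i=\varepsilon),N_i^\varepsilon,P_i^\varepsilon)$, $R^\square((\Psi\mid x_i=\varepsilon),N_i^\varepsilon\langle r/y\rangle,M)$. Put $F_{\mathbb B}(R)=\{(\Psi,\mathsf{true},\mathsf{true}),(\Psi,\mathsf{false},\mathsf{false})\}\cup\mathcal H_{\mathsf{bool}}(R)$ and $F_{\mathbb C}(R)=\{(\Psi,\mathsf{base},\mathsf{base})\}\cup\{((\Psi,x),\mathsf{loop}_x,\mathsf{loop}_x)\}\cup\mathcal H_{\mathbb S^1}(R)$. Let $\mathbb B$ (resp. $\mathbb C$) be the least $R\in\mathsf{VPER}$ with respect to $\subseteq$ with $F_{\mathbb B}(R)\subseteq R$ (resp. $F_{\mathbb C}(R)\subseteq R$). **The operator** $F(E,\Phi)=(E',\Phi')$ is given by the following clauses, judgments being relative to $(E,\Phi)$ and $\Phi'(\Psi,A,-,-)$ being taken only at those $A$ with $E'(\Psi,A,A)$. * $E'(\Psi,\mathsf{bool},\mathsf{bool})$,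 with $\Phi'(\Psi,\mathsf{bool},-,-)=\mathbb B(\Psi,-,-)$; $E'(\Psi,\mathbb S^1,\mathbb S^1)$, with $\Phi'(\Psi,\mathbb S^1,-,-)=\mathbb C(\Psi,-,-)$. * If $A\doteq A'\ \mathsf{type}\ [\Psi]$ and $a:A\gg B\doteq B'\ \mathsf{type}\ [\Psi]$, then $E'(\Psi,(a{:}A)\to B,(a{:}A')\to B')$ and $E'(\Psi,(a{:}A)\times B,(a{:}A')\times B')$. $\Phi'(\Psi,(a{:}A)\to B,\lambda a.M,\lambda a.M')$ when $a:A\gg M\doteq M'\in B\ [\Psi]$; $\Phi'(\Psi,(a{:}A)\times B,\langle M,N\rangle,\langle M',N'\rangle)$ when $M\doteq M'\in A\ [\Psi]$ and $N\doteq N'\in B[M/a]\ [\Psi]$. * If $A\doteq A'\ \mathsf{type}\ [\Psi,x]$ and $P_\varepsilon\doteq P'_\varepsilon\in A\langle\varepsilon/x\rangle\ [\Psi]$ for $\varepsilon=0,1$, then $E'(\Psi,\mathsf{Id}_{x.A}(P_0,P_1),\mathsf{Id}_{x.A'}(P_0',P_1'))$. $\Phi'(\Psi,\mathsf{Id}_{x.A}(P_0,P_1),\langle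 x\rangle M,\langle x\rangle M')$ when $M\doteq M'\in A\ [\Psi,x]$ and $M\langle\varepsilon/x\rangle\doteq P_\varepsilon\in A\langle\varepsilon/x\rangle\ [\Psi]$ for $\varepsilon=0,1$. * If $\mathsf{bool}$ is a type at $(\Psi,x)$, then $E'((\Psi,x),\mathsf{not}_x,\mathsf{not}_x)$. $\Phi'((\Psi,x),\mathsf{not}_x,\mathsf{notel}_x(M),\mathsf{notel}_x(M'))$ when $M\doteq M'\in\mathsf{bool}\ [\Psi,x]$. The *extended operator* $F^+$, on cubical type systems over the extended language, has in addition the following clauses, for a name $x\in\Psi$. * $E'(\Psi,\mathsf{ia}_x(A,B,F,G),\mathsf{ia}_x(A',B',F',G'))$ when $A\doteq A'\ \mathsf{type}\ [\Psi]$ and, under the restriction $[\Psi\mid x=1]$, $B\doteq B'\ \mathsf{type}$, $A\to B\doteq A'\to B'\ \mathsf{type}$, $B\to A\doteq B'\to A'\ \mathsf{type}$, $F\doteq F'\in A\to B$, $G\doteq G'\in B\to A$, $a:A\gg G(Fa)\doteq a\in A$ and $b:B\gg F(Gb)\doteq b\in B$. * $\Phi'(\Psi,\mathsf{ia}_x(A,B,F,G),\mathsf{iain}_x(M,F'),\mathsf{iain}_x(M',F''))$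 when $M\doteq M'\in A\ [\Psi]$ and $F\doteq F'\in A\to B$, $F\doteq F''\in A\to B$ under $[\Psi\mid x=1]$. **Having types.** $(E,\Phi)$ *has booleans* (resp. *the circle*) if $E(\Psi,\mathsf{bool},\mathsf{bool})$ and $\Phi(\Psi,\mathsf{bool},-,-)=\mathbb B(\Psi,-,-)$ (resp. $E(\Psi,\mathbb S^1,\mathbb S^1)$ and $\Phi(\Psi,\mathbb S^1,-,-)=\mathbb C(\Psi,-,-)$) for all $\Psi$. It *has all dependent function types* if, whenever $A\doteq A'\ \mathsf{type}\ [\Psi]$ and $a:A\gg B\doteq B'\ \mathsf{type}\ [\Psi]$, for all $\psi:\Psi'\to\Psi$ one has $E(\Psi',(a{:}A\psi)\to B\psi,(a{:}A'\psi)\to B'\psi)$ and $\Phi(\Psi',(a{:}A\psi)\to B\psi,-,-)$ is the least relation containing the pairs $(\lambda a.M,\lambda a.M')$ with $a:A\psi\gg M\doteq M'\in B\psi\ [\Psi']$. *All dependent pair types* and *all identification types* are defined in the same way from the corresponding premises and pairs listed above. It *has the $\mathsf{not}_x$ type* if for all $\Psi$ and $x\in\Psi$, $E(\Psi,\mathsf{not}_x,\mathsf{not}_x)$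 and $\Phi(\Psi,\mathsf{not}_x,-,-)$ is the least relation containing the pairs $(\mathsf{notel}_x(M),\mathsf{notel}_x(M'))$ with $M\doteq M'\in\mathsf{bool}\ [\Psi]$. It *has all isomorphism-univalence types* if, whenever $r$ is a dimension term over $\Psi$ with $A\doteq A'\ \mathsf{type}\ [\Psi]$ and, under $[\Psi\mid r=1]$, $B\doteq B'\ \mathsf{type}$, $F\doteq F'\in A\to B$, $G\doteq G'\in B\to A$, $a:A\gg G(Fa)\doteq a\in A$ and $b:B\gg F(Gb)\doteq b\in B$, then for all $\psi:\Psi'\to\Psi$ with $r\psi=x$ a name, $E(\Psi',\mathsf{ia}_x(A\psi,B\psi,F\psi,G\psi),\mathsf{ia}_x(A'\psi,B'\psi,F'\psi,G'\psi))$, and $\Phi(\Psi',\mathsf{ia}_x(A\psi,B\psi,F\psi,G\psi),-,-)$ is the least relation containing the pairs $(\mathsf{iain}_x(M,F''),\mathsf{iain}_x(M',F'''))$ with $M\doteq M'\in A\psi\ [\Psi']$ and $F\psi\doteq F''\in A\psi\to B\psi$, $F\psi\doteq F'''\in A\psi\to B\psi$ under $[\Psi'\mid x=1]$. **Theorem.**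 1. For the basic and for the extended language: $(\mathsf{VPER},\sqsubseteq)$ and $(\mathsf{CTS},\sqsubseteq)$ are complete partial orders; $F_{\mathbb B}$ and $F_{\mathbb C}$ are monotone operators on $(\mathsf{VPER},\sqsubseteq)$ with $\sqsubseteq$-least fixed points $\mathbb B$ and $\mathbb C$; $F$ is an operator on $\mathsf{CTS}$, is monotone for $\sqsubseteq$, and has a least fixed point; and every fixed point of $F$ in $\mathsf{CTS}$ has booleans, the circle, all dependent function types, all dependent pair types, all identification types, and the $\mathsf{not}_x$ type. 2. For the extended language: $F^+(X)$ is a cubical type system for every cubical type system $X$ with $X\sqsubseteq F^+(X)$ (where $\sqsubseteq$ is read as the defining condition on pairs); $F^+$ is monotone, i.e. $F^+(X)\sqsubseteq F^+(Y)$ for all cubical type systems $X\sqsubseteq Y$; there is a cubical type system that is the least fixed point of $F^+$ in $\mathsf{CTS}$; and every fixed point of $F^+$ in $\mathsf{CTS}$ has booleans, the circle, all dependent function, dependent pair and identification types, the $\mathsf{not}_x$ type, and all isomorphism-univalence types. -/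

import Mathlib

namespace CubicalTT

/-! ## Terms

Dimension contexts are taken up to renaming: a context with `d` dimension names is the number `d`,
and its names are the elements of `Fin d`.  All binders are de Bruijn binders; a dimension binder
adds the name `0` in front of the context and a term binder adds the variable `0`. -/

/-- Dimension terms over `d` dimension names: the constants `0` (`false`) and `1` (`true`), and the
names. -/
inductive Dim (d : ℕ) : Type
  | const (ε : Bool) : Dim d
  | name (x : Fin d) : Dim d

/-- `r` is a dimension name, i.e. not a constant. -/
def Dim.IsName {d : ℕ} (r : Dim d) : Prop := ∃ x, r = Dim.name x

/-- A total dimension substitution `ψ : Ψ' → Ψ` assigns to each of the `d` names of `Ψ` a dimension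
term over the `d'` names of `Ψ'`. -/
abbrev DSub (d d' : ℕ) : Type := Fin d → Dim d'

/-- The action `rψ` of a dimension substitution on dimension terms. -/
def Dim.dsub {d d' : ℕ} : Dim d → DSub d d' → Dim d'
  | .const ε, _ => .const ε
  | .name x, ψ => ψ x

/-- The inclusion of `Ψ` into `(Ψ, x)`. -/
def DSub.wk (d : ℕ) : DSub d (d + 1) := fun x => .name x.succ

/-- Weakening of a dimension term from `Ψ` to `(Ψ, x)`. -/
def Dim.wk {d : ℕ} (r : Dim d) : Dim (d + 1) := r.dsub (DSub.wk d)

/-- A dimension substitution, extended by the identity under a dimension binder. -/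
def DSub.lift {d d' : ℕ} (ψ : DSub d d') : DSub (d + 1) (d' + 1) :=
  Fin.cases (.name 0) (fun x => (ψ x).wk)

/-- The substitution `⟨r/x⟩` for the innermost dimension name. -/
def DSub.inst {d : ℕ} (r : Dim d) : DSub (d + 1) d := Fin.cases r Dim.name

/-- The substitution that exchanges the two innermost dimension names. -/
def DSub.swap (d : ℕ) : DSub (d + 2) (d + 2) :=
  Fin.cases (.name 1) (Fin.cases (.name 0) (fun x => .name x.succ.succ))

/-- Terms with free dimension names among `d` and free term variables among `n`.  The terms that are
well-formed at a context `Ψ` of `d` names are those of `Tm u d 0`.  The parameter `u` says whether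
the language has the constructs for isomorphism-univalence (`u = true`) or not (`u = false`). -/
inductive Tm (u : Bool) : ℕ → ℕ → Type
  | var {d n : ℕ} (a : Fin n) : Tm u d n
  /- `(a : A) → B`, `(a : A) × B`, `Id_{x.A}(P₀, P₁)`, `bool`, `not_r`, `S¹` -/
  | pi {d n : ℕ} (A : Tm u d n) (B : Tm u d (n + 1)) : Tm u d n
  | sigma {d n : ℕ} (A : Tm u d n) (B : Tm u d (n + 1)) : Tm u d n
  | ident {d n : ℕ} (A : Tm u (d + 1) n) (P₀ P₁ : Tm u d n) : Tm u d n
  | bool {d n : ℕ} : Tm u d n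
  | notb {d n : ℕ} (r : Dim d) : Tm u d n
  | circle {d n : ℕ} : Tm u d n
  /- functions, pairs, dimension abstraction `⟨x⟩M` and application `M @ r` -/
  | lam {d n : ℕ} (M : Tm u d (n + 1)) : Tm u d n
  | app {d n : ℕ} (M N : Tm u d n) : Tm u d n
  | pair {d n : ℕ} (M N : Tm u d n) : Tm u d n
  | fst {d n : ℕ} (M : Tm u d n) : Tm u d n
  | snd {d n : ℕ} (M : Tm u d n) : Tm u d n
  | dlam {d n : ℕ} (M : Tm u (d + 1) n) : Tm u d n
  | dapp {d n : ℕ} (M : Tm u d n) (r : Dim d) : Tm u d n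
  /- `true`, `false`, `if_{a.A}(M; T, F)`, and the introduction form `notel_r(M)` of `not_r` -/
  | tt {d n : ℕ} : Tm u d n
  | ff {d n : ℕ} : Tm u d n
  | ifb {d n : ℕ} (A : Tm u d (n + 1)) (M T F : Tm u d n) : Tm u d n
  | notel {d n : ℕ} (r : Dim d) (M : Tm u d n) : Tm u d n
  /- `base`, `loop_r`, `S¹-elim_{a.A}(M; P, x.L)` -/
  | base {d n : ℕ} : Tm u d n
  | loop {d n : ℕ} (r : Dim d) : Tm u d n
  | celim {d n : ℕ} (A : Tm u d (n + 1)) (M P : Tm u d n) (L : Tm u (d + 1) n) : Tm u d n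
  /- `coe_{x.A}(r ⇝ r', M)` -/
  | coe {d n : ℕ} (A : Tm u (d + 1) n) (r r' : Dim d) (M : Tm u d n) : Tm u d n
  /- `hcom^{r₀,…,r_k}_A(r ⇝ r', M; y.N_i^ε)`, with at least one extent `r_i` -/
  | hcom {d n : ℕ} (k : ℕ) (rs : Fin (k + 1) → Dim d) (A : Tm u d n) (r r' : Dim d) (M : Tm u d n)
      (N : Fin (k + 1) → Bool → Tm u (d + 1) n) : Tm u d n
  /- `ia_r(A, B, F, G)`, `iain_r(M, F)`, `iaout_r(M, G)` -/
  | ia {d n : ℕ} (h : u = true) (r : Dim d) (A B F G : Tm u d n) : Tm u d n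
  | iain {d n : ℕ} (h : u = true) (r : Dim d) (M F : Tm u d n) : Tm u d n
  | iaout {d n : ℕ} (h : u = true) (r : Dim d) (M G : Tm u d n) : Tm u d n

namespace Tm

/-- The (capture-avoiding) action `Mψ` of a dimension substitution. -/
def dsub {u : Bool} : {d n : ℕ} → Tm u d n → {d' : ℕ} → DSub d d' → Tm u d' n
  | _, _, var a, _, _ => var a
  | _, _, pi A B, _, ψ => pi (A.dsub ψ) (B.dsub ψ)
  | _, _, sigma A B, _, ψ => sigma (A.dsub ψ) (B.dsub ψ)
  | _, _, ident A P₀ P₁, _, ψ => ident (A.dsub ψ.lift) (P₀.dsub ψ) (P₁.dsub ψ)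
  | _, _, bool, _, _ => bool
  | _, _, notb r, _, ψ => notb (r.dsub ψ)
  | _, _, circle, _, _ => circle
  | _, _, lam M, _, ψ => lam (M.dsub ψ)
  | _, _, app M N, _, ψ => app (M.dsub ψ) (N.dsub ψ)
  | _, _, pair M N, _, ψ => pair (M.dsub ψ) (N.dsub ψ)
  | _, _, fst M, _, ψ => fst (M.dsub ψ)
  | _, _, snd M, _, ψ => snd (M.dsub ψ)
  | _, _, dlam M, _, ψ => dlam (M.dsub ψ.lift)
  | _, _, dapp M r, _, ψ => dapp (M.dsub ψ) (r.dsub ψ)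
  | _, _, tt, _, _ => tt
  | _, _, ff, _, _ => ff
  | _, _, ifb A M T F, _, ψ => ifb (A.dsub ψ) (M.dsub ψ) (T.dsub ψ) (F.dsub ψ)
  | _, _, notel r M, _, ψ => notel (r.dsub ψ) (M.dsub ψ)
  | _, _, base, _, _ => base
  | _, _, loop r, _, ψ => loop (r.dsub ψ)
  | _, _, celim A M P L, _, ψ => celim (A.dsub ψ) (M.dsub ψ) (P.dsub ψ) (L.dsub ψ.lift)
  | _, _, coe A r r' M, _, ψ => coe (A.dsub ψ.lift) (r.dsub ψ) (r'.dsub ψ) (M.dsub ψ)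
  | _, _, hcom k rs A r r' M N, _, ψ =>
      hcom k (fun i => (rs i).dsub ψ) (A.dsub ψ) (r.dsub ψ) (r'.dsub ψ) (M.dsub ψ)
        (fun i ε => (N i ε).dsub ψ.lift)
  | _, _, ia h r A B F G, _, ψ =>
      ia h (r.dsub ψ) (A.dsub ψ) (B.dsub ψ) (F.dsub ψ) (G.dsub ψ)
  | _, _, iain h r M F, _, ψ => iain h (r.dsub ψ) (M.dsub ψ) (F.dsub ψ)
  | _, _, iaout h r M G, _, ψ => iaout h (r.dsub ψ) (M.dsub ψ) (G.dsub ψ)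

/-- Weakening from `Ψ` to `(Ψ, x)`. -/
def dwk {u : Bool} {d n : ℕ} (M : Tm u d n) : Tm u (d + 1) n := M.dsub (DSub.wk d)

/-- Weakening of the body of a dimension binder: from `(Ψ, y)` to `(Ψ, x, y)`. -/
def dwkUnder {u : Bool} {d n : ℕ} (M : Tm u (d + 1) n) : Tm u (d + 2) n := M.dsub (DSub.wk d).lift

/-- Substitution `M⟨r/x⟩` for the innermost dimension name. -/
def inst {u : Bool} {d n : ℕ} (M : Tm u (d + 1) n) (r : Dim d) : Tm u d n := M.dsub (DSub.inst r)

end Tm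

/-- A renaming of term variables, extended by the identity under a term binder. -/
def renLift {n n' : ℕ} (ρ : Fin n → Fin n') : Fin (n + 1) → Fin (n' + 1) :=
  Fin.cases 0 (fun a => (ρ a).succ)

namespace Tm

/-- Renaming of term variables. -/
def ren {u : Bool} : {d n : ℕ} → Tm u d n → {n' : ℕ} → (Fin n → Fin n') → Tm u d n'
  | _, _, var a, _, ρ => var (ρ a)
  | _, _, pi A B, _, ρ => pi (A.ren ρ) (B.ren (renLift ρ))
  | _, _, sigma A B, _, ρ => sigma (A.ren ρ) (B.ren (renLift ρ))
  | _, _, ident A P₀ P₁, _, ρ => ident (A.ren ρ) (P₀.ren ρ) (P₁.ren ρ)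
  | _, _, bool, _, _ => bool
  | _, _, notb r, _, _ => notb r
  | _, _, circle, _, _ => circle
  | _, _, lam M, _, ρ => lam (M.ren (renLift ρ))
  | _, _, app M N, _, ρ => app (M.ren ρ) (N.ren ρ)
  | _, _, pair M N, _, ρ => pair (M.ren ρ) (N.ren ρ)
  | _, _, fst M, _, ρ => fst (M.ren ρ)
  | _, _, snd M, _, ρ => snd (M.ren ρ)
  | _, _, dlam M, _, ρ => dlam (M.ren ρ)
  | _, _, dapp M r, _, ρ => dapp (M.ren ρ) r
  | _, _, tt, _, _ => tt
  | _, _, ff, _, _ => ff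
  | _, _, ifb A M T F, _, ρ => ifb (A.ren (renLift ρ)) (M.ren ρ) (T.ren ρ) (F.ren ρ)
  | _, _, notel r M, _, ρ => notel r (M.ren ρ)
  | _, _, base, _, _ => base
  | _, _, loop r, _, _ => loop r
  | _, _, celim A M P L, _, ρ => celim (A.ren (renLift ρ)) (M.ren ρ) (P.ren ρ) (L.ren ρ)
  | _, _, coe A r r' M, _, ρ => coe (A.ren ρ) r r' (M.ren ρ)
  | _, _, hcom k rs A r r' M N, _, ρ =>
      hcom k rs (A.ren ρ) r r' (M.ren ρ) (fun i ε => (N i ε).ren ρ)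
  | _, _, ia h r A B F G, _, ρ => ia h r (A.ren ρ) (B.ren ρ) (F.ren ρ) (G.ren ρ)
  | _, _, iain h r M F, _, ρ => iain h r (M.ren ρ) (F.ren ρ)
  | _, _, iaout h r M G, _, ρ => iaout h r (M.ren ρ) (G.ren ρ)

/-- Weakening by one term variable. -/
def twk {u : Bool} {d n : ℕ} (M : Tm u d n) : Tm u d (n + 1) := M.ren Fin.succ

end Tm

/-- A term substitution, extended by the identity under a term binder. -/
def subLift {u : Bool} {d n n' : ℕ} (σ : Fin n → Tm u d n') : Fin (n + 1) → Tm u d (n' + 1) :=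
  Fin.cases (Tm.var 0) (fun a => (σ a).twk)

/-- A term substitution, weakened under a dimension binder. -/
def subDLift {u : Bool} {d n n' : ℕ} (σ : Fin n → Tm u d n') : Fin n → Tm u (d + 1) n' :=
  fun a => (σ a).dwk

namespace Tm

/-- Simultaneous (capture-avoiding) substitution for term variables. -/
def tsub {u : Bool} : {d n : ℕ} → Tm u d n → {n' : ℕ} → (Fin n → Tm u d n') → Tm u d n'
  | _, _, var a, _, σ => σ a
  | _, _, pi A B, _, σ => pi (A.tsub σ) (B.tsub (subLift σ))
  | _, _, sigma A B, _, σ => sigma (A.tsub σ) (B.tsub (subLift σ))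
  | _, _, ident A P₀ P₁, _, σ => ident (A.tsub (subDLift σ)) (P₀.tsub σ) (P₁.tsub σ)
  | _, _, bool, _, _ => bool
  | _, _, notb r, _, _ => notb r
  | _, _, circle, _, _ => circle
  | _, _, lam M, _, σ => lam (M.tsub (subLift σ))
  | _, _, app M N, _, σ => app (M.tsub σ) (N.tsub σ)
  | _, _, pair M N, _, σ => pair (M.tsub σ) (N.tsub σ)
  | _, _, fst M, _, σ => fst (M.tsub σ)
  | _, _, snd M, _, σ => snd (M.tsub σ)
  | _, _, dlam M, _, σ => dlam (M.tsub (subDLift σ))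
  | _, _, dapp M r, _, σ => dapp (M.tsub σ) r
  | _, _, tt, _, _ => tt
  | _, _, ff, _, _ => ff
  | _, _, ifb A M T F, _, σ => ifb (A.tsub (subLift σ)) (M.tsub σ) (T.tsub σ) (F.tsub σ)
  | _, _, notel r M, _, σ => notel r (M.tsub σ)
  | _, _, base, _, _ => base
  | _, _, loop r, _, _ => loop r
  | _, _, celim A M P L, _, σ =>
      celim (A.tsub (subLift σ)) (M.tsub σ) (P.tsub σ) (L.tsub (subDLift σ))
  | _, _, coe A r r' M, _, σ => coe (A.tsub (subDLift σ)) r r' (M.tsub σ)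
  | _, _, hcom k rs A r r' M N, _, σ =>
      hcom k rs (A.tsub σ) r r' (M.tsub σ) (fun i ε => (N i ε).tsub (subDLift σ))
  | _, _, ia h r A B F G, _, σ => ia h r (A.tsub σ) (B.tsub σ) (F.tsub σ) (G.tsub σ)
  | _, _, iain h r M F, _, σ => iain h r (M.tsub σ) (F.tsub σ)
  | _, _, iaout h r M G, _, σ => iaout h r (M.tsub σ) (G.tsub σ)

/-- Substitution `M[N/a]` for the innermost term variable. -/
def subst {u : Bool} {d n : ℕ} (M : Tm u d (n + 1)) (N : Tm u d n) : Tm u d n :=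
  M.tsub (Fin.cases N var)

/-- Negation of a boolean: `if_{_.bool}(M; false, true)`. -/
def notf {u : Bool} {d n : ℕ} (M : Tm u d n) : Tm u d n := ifb bool M ff tt

/-- Heterogeneous composition
`com^{rs}_{y.A}(r ⇝ r', M; y.N_i^ε) :=
  hcom^{rs}_{A⟨r'/y⟩}(r ⇝ r', coe_{y.A}(r ⇝ r', M); y.coe_{y.A}(y ⇝ r', N_i^ε))`. -/
def com {u : Bool} {d n : ℕ} (k : ℕ) (rs : Fin (k + 1) → Dim d) (A : Tm u (d + 1) n) (r r' : Dim d)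
    (M : Tm u d n) (N : Fin (k + 1) → Bool → Tm u (d + 1) n) : Tm u d n :=
  hcom k rs (A.inst r') r r' (coe A r r' M)
    (fun i ε => coe A.dwkUnder (.name 0) r'.wk (N i ε))

/-- The filler `hcom^{rs}_A(r ⇝ z, M; y.N_i^ε)` of a composition problem over `Ψ`, a term over
`(Ψ, z)`. -/
def hfill {u : Bool} {d n : ℕ} (k : ℕ) (rs : Fin (k + 1) → Dim d) (A : Tm u d n) (r : Dim d)
    (M : Tm u d n) (N : Fin (k + 1) → Bool → Tm u (d + 1) n) : Tm u (d + 1) n :=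
  hcom k (fun i => (rs i).wk) A.dwk r.wk (.name 0) M.dwk (fun i ε => (N i ε).dwkUnder)

/-- The line `coe_{x.A}(r ⇝ z, M)`, a term over `(Ψ, z)`. -/
def coeFill {u : Bool} {d n : ℕ} (A : Tm u (d + 1) n) (r : Dim d) (M : Tm u d n) :
    Tm u (d + 1) n :=
  coe A.dwkUnder r.wk (.name 0) M.dwk

/-- The non-dependent function type `A → B`. -/
def arr {u : Bool} {d n : ℕ} (A B : Tm u d n) : Tm u d n := pi A B.twk

end Tm

/-- A list of extents, extended by one more extent at the end. -/
def extSnoc {d k : ℕ} (rs : Fin (k + 1) → Dim d) (r : Dim d) : Fin (k + 2) → Dim d :=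
  Fin.snoc (α := fun _ => Dim d) rs r

/-- A list of pairs of tube faces, extended by one more pair `T₀, T₁` at the end. -/
def tubeSnoc {u : Bool} {d n k : ℕ} (N : Fin (k + 1) → Bool → Tm u d n) (T₀ T₁ : Tm u d n) :
    Fin (k + 2) → Bool → Tm u d n :=
  Fin.snoc (α := fun _ => Bool → Tm u d n) N (fun ε => bif ε then T₁ else T₀)

/-- The single pair of tube faces `T₀, T₁`. -/
def tubeOne {u : Bool} {d n : ℕ} (T₀ T₁ : Tm u d n) : Fin (0 + 1) → Bool → Tm u d n :=
  fun _ ε => bif ε then T₁ else T₀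

/-! ## Operational semantics (of terms without free term variables) -/

/-- The values (canonical forms). -/
inductive IsVal {u : Bool} : {d : ℕ} → Tm u d 0 → Prop
  | pi {d : ℕ} (A : Tm u d 0) (B : Tm u d 1) : IsVal (.pi A B)
  | sigma {d : ℕ} (A : Tm u d 0) (B : Tm u d 1) : IsVal (.sigma A B)
  | ident {d : ℕ} (A : Tm u (d + 1) 0) (P₀ P₁ : Tm u d 0) : IsVal (.ident A P₀ P₁)
  | bool {d : ℕ} : IsVal (.bool : Tm u d 0)
  | notb {d : ℕ} (x : Fin d) : IsVal (.notb (.name x))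
  | circle {d : ℕ} : IsVal (.circle : Tm u d 0)
  | lam {d : ℕ} (M : Tm u d 1) : IsVal (.lam M)
  | pair {d : ℕ} (M N : Tm u d 0) : IsVal (.pair M N)
  | dlam {d : ℕ} (M : Tm u (d + 1) 0) : IsVal (.dlam M)
  | tt {d : ℕ} : IsVal (.tt : Tm u d 0)
  | ff {d : ℕ} : IsVal (.ff : Tm u d 0)
  | hcom_bool {d k : ℕ} {rs : Fin (k + 1) → Dim d} {r r' : Dim d} (M : Tm u d 0)
      (N : Fin (k + 1) → Bool → Tm u (d + 1) 0) (hrs : ∀ i, (rs i).IsName) (hr : r ≠ r') :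
      IsVal (.hcom k rs .bool r r' M N)
  | base {d : ℕ} : IsVal (.base : Tm u d 0)
  | loop {d : ℕ} (x : Fin d) : IsVal (.loop (.name x))
  | hcom_circle {d k : ℕ} {rs : Fin (k + 1) → Dim d} {r r' : Dim d} (M : Tm u d 0)
      (N : Fin (k + 1) → Bool → Tm u (d + 1) 0) (hrs : ∀ i, (rs i).IsName) (hr : r ≠ r') :
      IsVal (.hcom k rs .circle r r' M N)
  | notel {d : ℕ} (x : Fin d) (M : Tm u d 0) : IsVal (.notel (.name x) M)
  | ia {d : ℕ} (h : u = true) (x : Fin d) (A B F G : Tm u d 0) : IsVal (.ia h (.name x) A B F G)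
  | iain {d : ℕ} (h : u = true) (x : Fin d) (M F : Tm u d 0) : IsVal (.iain h (.name x) M F)

/-- One step of (deterministic, weak head) evaluation. -/
inductive Step {u : Bool} : {d : ℕ} → Tm u d 0 → Tm u d 0 → Prop
  /- types -/
  | notb_const {d : ℕ} (ε : Bool) : Step (.notb (.const ε) : Tm u d 0) .bool
  /- the type argument of `coe` and `hcom` is principal -/
  | coe_type {d : ℕ} {A A' : Tm u (d + 1) 0} (r r' : Dim d) (M : Tm u d 0) (h : Step A A') :
      Step (.coe A r r' M) (.coe A' r r' M)
  | hcom_type {d k : ℕ} (rs : Fin (k + 1) → Dim d) {A A' : Tm u d 0} (r r' : Dim d) (M : Tm u d 0)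
      (N : Fin (k + 1) → Bool → Tm u (d + 1) 0) (h : Step A A') :
      Step (.hcom k rs A r r' M N) (.hcom k rs A' r r' M N)
  /- dependent functions -/
  | app_fun {d : ℕ} {M M' : Tm u d 0} (N : Tm u d 0) (h : Step M M') :
      Step (.app M N) (.app M' N)
  | app_lam {d : ℕ} (M : Tm u d 1) (N : Tm u d 0) : Step (.app (.lam M) N) (M.subst N)
  | hcom_pi {d k : ℕ} (rs : Fin (k + 1) → Dim d) (A : Tm u d 0) (B : Tm u d 1) (r r' : Dim d)
      (M : Tm u d 0) (N : Fin (k + 1) → Bool → Tm u (d + 1) 0) :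
      Step (.hcom k rs (.pi A B) r r' M N)
        (.lam (.hcom k rs B r r' (.app M.twk (.var 0)) (fun i ε => .app (N i ε).twk (.var 0))))
  | coe_pi {d : ℕ} (A : Tm u (d + 1) 0) (B : Tm u (d + 1) 1) (r r' : Dim d) (M : Tm u d 0) :
      Step (.coe (.pi A B) r r' M)
        (.lam (.coe (B.tsub (fun _ => Tm.coeFill A.twk r' (.var 0))) r r'
          (.app M.twk (.coe A.twk r' r (.var 0)))))
  /- dependent pairs -/
  | fst_arg {d : ℕ} {M M' : Tm u d 0} (h : Step M M') : Step (.fst M) (.fst M')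
  | snd_arg {d : ℕ} {M M' : Tm u d 0} (h : Step M M') : Step (.snd M) (.snd M')
  | fst_pair {d : ℕ} (M N : Tm u d 0) : Step (.fst (.pair M N)) M
  | snd_pair {d : ℕ} (M N : Tm u d 0) : Step (.snd (.pair M N)) N
  | hcom_sigma {d k : ℕ} (rs : Fin (k + 1) → Dim d) (A : Tm u d 0) (B : Tm u d 1) (r r' : Dim d)
      (M : Tm u d 0) (N : Fin (k + 1) → Bool → Tm u (d + 1) 0) :
      Step (.hcom k rs (.sigma A B) r r' M N)
        (.pair (.hcom k rs A r r' (.fst M) (fun i ε => .fst (N i ε)))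
          (.com k rs (B.dwk.subst (.hfill k rs A r (.fst M) (fun i ε => .fst (N i ε)))) r r'
            (.snd M) (fun i ε => .snd (N i ε))))
  | coe_sigma {d : ℕ} (A : Tm u (d + 1) 0) (B : Tm u (d + 1) 1) (r r' : Dim d) (M : Tm u d 0) :
      Step (.coe (.sigma A B) r r' M)
        (.pair (.coe A r r' (.fst M)) (.coe (B.subst (.coeFill A r (.fst M))) r r' (.snd M)))
  /- identifications -/
  | dapp_fun {d : ℕ} {M M' : Tm u d 0} (r : Dim d) (h : Step M M') :
      Step (.dapp M r) (.dapp M' r)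
  | dapp_dlam {d : ℕ} (M : Tm u (d + 1) 0) (r : Dim d) : Step (.dapp (.dlam M) r) (M.inst r)
  | hcom_ident {d k : ℕ} (rs : Fin (k + 1) → Dim d) (A : Tm u (d + 1) 0) (P₀ P₁ : Tm u d 0)
      (r r' : Dim d) (M : Tm u d 0) (N : Fin (k + 1) → Bool → Tm u (d + 1) 0) :
      Step (.hcom k rs (.ident A P₀ P₁) r r' M N)
        (.dlam (.hcom (k + 1) (extSnoc (fun i => (rs i).wk) (.name 0)) A r.wk r'.wk
          (.dapp M.dwk (.name 0))
          (tubeSnoc (fun i ε => .dapp (N i ε).dwkUnder (.name 1)) P₀.dwk.dwk P₁.dwk.dwk)))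
  | coe_ident {d : ℕ} (A : Tm u (d + 2) 0) (P₀ P₁ : Tm u (d + 1) 0) (r r' : Dim d) (M : Tm u d 0) :
      Step (.coe (.ident A P₀ P₁) r r' M)
        (.dlam (.com 0 (fun _ => .name 0) (A.dsub (DSub.swap d)) r.wk r'.wk
          (.dapp M.dwk (.name 0)) (tubeOne P₀.dwkUnder P₁.dwkUnder)))
  /- booleans -/
  | hcom_bool_tube {d k : ℕ} (rs : Fin (k + 1) → Dim d) (r r' : Dim d) (M : Tm u d 0)
      (N : Fin (k + 1) → Bool → Tm u (d + 1) 0) (i : Fin (k + 1)) (ε : Bool)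
      (hi : rs i = .const ε) (hlt : ∀ j < i, (rs j).IsName) :
      Step (.hcom k rs .bool r r' M N) ((N i ε).inst r')
  | hcom_bool_cap {d k : ℕ} (rs : Fin (k + 1) → Dim d) (r r' : Dim d) (M : Tm u d 0)
      (N : Fin (k + 1) → Bool → Tm u (d + 1) 0) (hrs : ∀ i, (rs i).IsName) (hr : r = r') :
      Step (.hcom k rs .bool r r' M N) M
  | ifb_arg {d : ℕ} (A : Tm u d 1) {M M' : Tm u d 0} (T F : Tm u d 0) (h : Step M M') :
      Step (.ifb A M T F) (.ifb A M' T F)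
  | ifb_tt {d : ℕ} (A : Tm u d 1) (T F : Tm u d 0) : Step (.ifb A .tt T F) T
  | ifb_ff {d : ℕ} (A : Tm u d 1) (T F : Tm u d 0) : Step (.ifb A .ff T F) F
  | ifb_hcom {d k : ℕ} (A : Tm u d 1) (rs : Fin (k + 1) → Dim d) (r r' : Dim d) (M : Tm u d 0)
      (N : Fin (k + 1) → Bool → Tm u (d + 1) 0) (T F : Tm u d 0)
      (hrs : ∀ i, (rs i).IsName) (hr : r ≠ r') :
      Step (.ifb A (.hcom k rs .bool r r' M N) T F)
        (.com k rs (A.dwk.subst (.hfill k rs .bool r M N)) r r' (.ifb A M T F)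
          (fun i ε => .ifb A.dwk (N i ε) T.dwk F.dwk))
  | coe_bool {d : ℕ} (r r' : Dim d) (M : Tm u d 0) : Step (.coe .bool r r' M) M
  /- the circle -/
  | hcom_circle_tube {d k : ℕ} (rs : Fin (k + 1) → Dim d) (r r' : Dim d) (M : Tm u d 0)
      (N : Fin (k + 1) → Bool → Tm u (d + 1) 0) (i : Fin (k + 1)) (ε : Bool)
      (hi : rs i = .const ε) (hlt : ∀ j < i, (rs j).IsName) :
      Step (.hcom k rs .circle r r' M N) ((N i ε).inst r')
  | hcom_circle_cap {d k : ℕ} (rs : Fin (k + 1) → Dim d) (r r' : Dim d) (M : Tm u d 0)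
      (N : Fin (k + 1) → Bool → Tm u (d + 1) 0) (hrs : ∀ i, (rs i).IsName) (hr : r = r') :
      Step (.hcom k rs .circle r r' M N) M
  | loop_const {d : ℕ} (ε : Bool) : Step (.loop (.const ε) : Tm u d 0) .base
  | celim_arg {d : ℕ} (A : Tm u d 1) {M M' : Tm u d 0} (P : Tm u d 0) (L : Tm u (d + 1) 0)
      (h : Step M M') : Step (.celim A M P L) (.celim A M' P L)
  | celim_base {d : ℕ} (A : Tm u d 1) (P : Tm u d 0) (L : Tm u (d + 1) 0) :
      Step (.celim A .base P L) P
  | celim_loop {d : ℕ} (A : Tm u d 1) (x : Fin d) (P : Tm u d 0) (L : Tm u (d + 1) 0) :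
      Step (.celim A (.loop (.name x)) P L) (L.inst (.name x))
  | celim_hcom {d k : ℕ} (A : Tm u d 1) (rs : Fin (k + 1) → Dim d) (r r' : Dim d) (M : Tm u d 0)
      (N : Fin (k + 1) → Bool → Tm u (d + 1) 0) (P : Tm u d 0) (L : Tm u (d + 1) 0)
      (hrs : ∀ i, (rs i).IsName) (hr : r ≠ r') :
      Step (.celim A (.hcom k rs .circle r r' M N) P L)
        (.com k rs (A.dwk.subst (.hfill k rs .circle r M N)) r r' (.celim A M P L)
          (fun i ε => .celim A.dwk (N i ε) P.dwk L.dwkUnder))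
  | coe_circle {d : ℕ} (r r' : Dim d) (M : Tm u d 0) : Step (.coe .circle r r' M) M
  /- `not_r`; in `coe_{x.not_x}` the subscript is the bound name `0`, and in `coe_{x.not_y}` with
  `y ≠ x` it is a name `y.succ` -/
  | notel_zero {d : ℕ} (M : Tm u d 0) : Step (.notel (.const false) M) M.notf
  | notel_one {d : ℕ} (M : Tm u d 0) : Step (.notel (.const true) M) M
  | coe_not_opp {d : ℕ} (ε : Bool) (M : Tm u d 0) :
      Step (.coe (.notb (.name 0)) (.const ε) (.const (!ε)) M) M.notf
  | coe_not_same {d : ℕ} (ε : Bool) (M : Tm u d 0) :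
      Step (.coe (.notb (.name 0)) (.const ε) (.const ε) M) M
  | coe_not_zero_name {d : ℕ} (x : Fin d) (M : Tm u d 0) :
      Step (.coe (.notb (.name 0)) (.const false) (.name x) M) (.notel (.name x) M.notf)
  | coe_not_one_name {d : ℕ} (x : Fin d) (M : Tm u d 0) :
      Step (.coe (.notb (.name 0)) (.const true) (.name x) M) (.notel (.name x) M)
  | coe_not_arg {d : ℕ} (x : Fin d) (r : Dim d) {M M' : Tm u d 0} (h : Step M M') :
      Step (.coe (.notb (.name 0)) (.name x) r M) (.coe (.notb (.name 0)) (.name x) r M')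
  | coe_not_notel {d : ℕ} (x : Fin d) (r : Dim d) (M : Tm u d 0) :
      Step (.coe (.notb (.name 0)) (.name x) r (.notel (.name x) M)) (.notel r M)
  | coe_not_ne {d : ℕ} (y : Fin d) (r r' : Dim d) (M : Tm u d 0) :
      Step (.coe (.notb (.name y.succ)) r r' M) M
  | hcom_not {d k : ℕ} (rs : Fin (k + 1) → Dim d) (x : Fin d) (r r' : Dim d) (M : Tm u d 0)
      (N : Fin (k + 1) → Bool → Tm u (d + 1) 0) :
      Step (.hcom k rs (.notb (.name x)) r r' M N)
        (.notel (.name x) (.hcom k rs .bool r r'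
          (.coe (.notb (.name 0)) (.name x) (.const true) M)
          (fun i ε => .coe (.notb (.name 0)) (.name x.succ) (.const true) (N i ε))))
  /- isomorphism-univalence -/
  | ia_zero {d : ℕ} (h : u = true) (A B F G : Tm u d 0) : Step (.ia h (.const false) A B F G) A
  | ia_one {d : ℕ} (h : u = true) (A B F G : Tm u d 0) : Step (.ia h (.const true) A B F G) B
  | iain_zero {d : ℕ} (h : u = true) (M F : Tm u d 0) : Step (.iain h (.const false) M F) M
  | iain_one {d : ℕ} (h : u = true) (M F : Tm u d 0) :
      Step (.iain h (.const true) M F) (.app F M)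
  | iaout_zero {d : ℕ} (h : u = true) (M G : Tm u d 0) : Step (.iaout h (.const false) M G) M
  | iaout_one {d : ℕ} (h : u = true) (M G : Tm u d 0) :
      Step (.iaout h (.const true) M G) (.app G M)
  | iaout_arg {d : ℕ} (h : u = true) (x : Fin d) {M M' : Tm u d 0} (G : Tm u d 0)
      (hM : Step M M') : Step (.iaout h (.name x) M G) (.iaout h (.name x) M' G)
  | iaout_iain {d : ℕ} (h : u = true) (x : Fin d) (M F G : Tm u d 0) :
      Step (.iaout h (.name x) (.iain h (.name x) M F) G) M
  | coe_ia_bound {d : ℕ} (h : u = true) (A B F G : Tm u (d + 1) 0) (r r' : Dim d) (M : Tm u d 0) :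
      Step (.coe (.ia h (.name 0) A B F G) r r' M)
        (.iain h r' (.coe A r r' (.iaout h r M (G.inst r))) (F.inst r'))
  | coe_ia_ne {d : ℕ} (h : u = true) (w : Fin d) (A B F G : Tm u (d + 1) 0) (r r' : Dim d)
      (M : Tm u d 0) :
      Step (.coe (.ia h (.name w.succ) A B F G) r r' M)
        (.iain h (.name w)
          (.com 0 (fun _ => .name w) A r r' (.iaout h (.name w) M (G.inst r))
            (tubeOne (.coeFill A r M) (.app G (.coeFill B r M))))
          (F.inst r'))
  | hcom_ia {d k : ℕ} (h : u = true) (rs : Fin (k + 1) → Dim d) (x : Fin d) (A B F G : Tm u d 0)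
      (r r' : Dim d) (M : Tm u d 0) (N : Fin (k + 1) → Bool → Tm u (d + 1) 0) :
      Step (.hcom k rs (.ia h (.name x) A B F G) r r' M N)
        (.iain h (.name x)
          (.hcom (k + 1) (extSnoc rs (.name x)) A r r' (.iaout h (.name x) M G)
            (tubeSnoc (fun i ε => .iaout h (.name x.succ) (N i ε) G.dwk)
              (.hfill k rs A r M N) (.app G.dwk (.hfill k rs B r M N))))
          F)

/-- `M ⇓ V`: `M` evaluates to the value `V`. -/
def Eval {u : Bool} {d : ℕ} (M V : Tm u d 0) : Prop := Relation.ReflTransGen Step M V ∧ IsVal V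

/-! ## Value-PERs and cubical type systems -/

/-- Ternary relations `R(Ψ, M, N)` over closed terms `M, N` at `Ψ`. -/
abbrev TmRel (u : Bool) : Type := ∀ d : ℕ, Tm u d 0 → Tm u d 0 → Prop

/-- `R(Ψ, -, -)` is a symmetric and transitive relation over values, for all `Ψ`. -/
structure IsVPER {u : Bool} (R : TmRel u) : Prop where
  val : ∀ {d : ℕ} {M N : Tm u d 0}, R d M N → IsVal M ∧ IsVal N
  symm : ∀ {d : ℕ} {M N : Tm u d 0}, R d M N → R d N M
  trans : ∀ {d : ℕ} {M N O : Tm u d 0}, R d M N → R d N O → R d M O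

/-- The collection `VPER`. -/
def VPER (u : Bool) : Type := {R : TmRel u // IsVPER R}

/-- The approximation ordering `R ⊑ S`: `R ⊆ S`, and `R(Ψ, M, -) = S(Ψ, M, -)` if `R(Ψ, M, M)`. -/
def TmRel.Approx {u : Bool} (R S : TmRel u) : Prop :=
  (∀ d M N, R d M N → S d M N) ∧ ∀ d M, R d M M → ∀ N, R d M N ↔ S d M N

/-- The approximation ordering on `VPER`. -/
def VPER.Approx {u : Bool} (R S : VPER u) : Prop := TmRel.Approx R.1 S.1

/-- A pair `(E, Φ)` of relations, not yet required to be a cubical type system. -/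
@[ext]
structure PreCTS (u : Bool) where
  /-- `E(Ψ, A, B)`: equality of canonical types. -/
  E : TmRel u
  /-- `Φ(Ψ, A, M, N)`: equality of canonical elements of the canonical type `A`. -/
  Φ : ∀ d : ℕ, Tm u d 0 → Tm u d 0 → Tm u d 0 → Prop

/-- `(E, Φ)` is a cubical type system.  The relation `Φ(Ψ, A, -, -)` is only defined for `A` with
`E(Ψ, A, A)`; this is expressed by letting it be empty for all other `A`. -/
structure IsCTS {u : Bool} (X : PreCTS u) : Prop where
  E_vper : IsVPER X.E
  dom : ∀ {d : ℕ} {A M N : Tm u d 0}, X.Φ d A M N → X.E d A A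
  val : ∀ {d : ℕ} {A M N : Tm u d 0}, X.Φ d A M N → IsVal M ∧ IsVal N
  symm : ∀ {d : ℕ} {A M N : Tm u d 0}, X.Φ d A M N → X.Φ d A N M
  trans : ∀ {d : ℕ} {A M N O : Tm u d 0}, X.Φ d A M N → X.Φ d A N O → X.Φ d A M O
  resp : ∀ {d : ℕ} {A B : Tm u d 0}, X.E d A B → ∀ M N, X.Φ d A M N ↔ X.Φ d B M N

/-- The collection `CTS`. -/
def CTS (u : Bool) : Type := {X : PreCTS u // IsCTS X}

/-- The approximation ordering `(E, Φ) ⊑ (E', Φ')`. -/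
def PreCTS.Approx {u : Bool} (X Y : PreCTS u) : Prop :=
  TmRel.Approx X.E Y.E ∧ ∀ d A, X.E d A A → ∀ M N, X.Φ d A M N ↔ Y.Φ d A M N

/-- The approximation ordering on `CTS`. -/
def CTS.Approx {u : Bool} (X Y : CTS u) : Prop := PreCTS.Approx X.1 Y.1

/-- Complete partial orders: partial orders with a least element and joins of all directed
(in particular nonempty) subsets. -/
def IsCPO {α : Type} (le : α → α → Prop) : Prop :=
  IsPartialOrder α le ∧ (∃ b, ∀ a, le b a) ∧
    ∀ S : Set α, S.Nonempty → DirectedOn le S →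
      ∃ l, (∀ s ∈ S, le s l) ∧ ∀ b, (∀ s ∈ S, le s b) → le l b

/-! ## Context restrictions, and the relations derived from a relation on values -/

/-- A set of equations `Ξ` between dimension terms over `d` names. -/
abbrev Eqns (d : ℕ) : Type := List (Dim d × Dim d)

/-- `ψ` satisfies `Ξ`. -/
def Sat {d d' : ℕ} (Ξ : Eqns d) (ψ : DSub d d') : Prop := ∀ e ∈ Ξ, e.1.dsub ψ = e.2.dsub ψ

/-- `R` relates all of `a, b, c, e` (for symmetric and transitive `R`). -/
def Rel4 {α : Type} (R : α → α → Prop) (a b c e : α) : Prop := R a b ∧ R b c ∧ R c e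

/-- The derived relation `R^□(Ψ, M, N)`: all aspects of `M` and `N` are related. -/
def Cube {u : Bool} (R : TmRel u) {d : ℕ} (M N : Tm u d 0) : Prop :=
  ∀ (d₁ : ℕ) (ψ₁ : DSub d d₁) (d₂ : ℕ) (ψ₂ : DSub d₁ d₂),
    ∃ M₁ M₂ M₁₂ N₁ N₂ N₁₂,
      Eval (M.dsub ψ₁) M₁ ∧ Eval (M₁.dsub ψ₂) M₂ ∧ Eval ((M.dsub ψ₁).dsub ψ₂) M₁₂ ∧
      Eval (N.dsub ψ₁) N₁ ∧ Eval (N₁.dsub ψ₂) N₂ ∧ Eval ((N.dsub ψ₁).dsub ψ₂) N₁₂ ∧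
      Rel4 (R d₂) M₂ M₁₂ N₂ N₁₂

/-- The derived relation `R^□(Ψ ∣ Ξ, M, N)`. -/
def CubeRes {u : Bool} (R : TmRel u) {d : ℕ} (Ξ : Eqns d) (M N : Tm u d 0) : Prop :=
  ∀ (d' : ℕ) (ψ : DSub d d'), Sat Ξ ψ → Cube R (M.dsub ψ) (N.dsub ψ)

/-- The conditions under which `hcom^{x_i}(r ⇝ r', M; y.N_i^ε)` and
`hcom^{x_i}(r ⇝ r', O; y.P_i^ε)` are equal canonical elements of a higher inductive type with
canonical elements `R`. -/
structure HcomPremises {u : Bool} (R : TmRel u) {d k : ℕ} (xs : Fin (k + 1) → Dim d) (r r' : Dim d)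
    (M O : Tm u d 0) (N P : Fin (k + 1) → Bool → Tm u (d + 1) 0) : Prop where
  names : ∀ i, (xs i).IsName
  ne : r ≠ r'
  cap : Cube R M O
  adj : ∀ i j ε ε', CubeRes R [((xs i).wk, .const ε), ((xs j).wk, .const ε')] (N i ε) (N j ε')
  tube : ∀ i ε, CubeRes R [((xs i).wk, .const ε)] (N i ε) (P i ε)
  start : ∀ i ε, CubeRes R [(xs i, .const ε)] ((N i ε).inst r) M

/-- The operator on `VPER`s whose least fixed point gives the canonical booleans. -/
inductive BoolOp {u : Bool} (R : TmRel u) : ∀ d : ℕ, Tm u d 0 → Tm u d 0 → Prop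
  | tt {d : ℕ} : BoolOp R d .tt .tt
  | ff {d : ℕ} : BoolOp R d .ff .ff
  | hcom {d k : ℕ} {xs : Fin (k + 1) → Dim d} {r r' : Dim d} {M O : Tm u d 0}
      {N P : Fin (k + 1) → Bool → Tm u (d + 1) 0} (h : HcomPremises R xs r r' M O N P) :
      BoolOp R d (.hcom k xs .bool r r' M N) (.hcom k xs .bool r r' O P)

/-- The operator on `VPER`s whose least fixed point gives the canonical elements of the circle. -/
inductive CircleOp {u : Bool} (R : TmRel u) : ∀ d : ℕ, Tm u d 0 → Tm u d 0 → Prop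
  | base {d : ℕ} : CircleOp R d .base .base
  | loop {d : ℕ} (x : Fin d) : CircleOp R d (.loop (.name x)) (.loop (.name x))
  | hcom {d k : ℕ} {xs : Fin (k + 1) → Dim d} {r r' : Dim d} {M O : Tm u d 0}
      {N P : Fin (k + 1) → Bool → Tm u (d + 1) 0} (h : HcomPremises R xs r r' M O N P) :
      CircleOp R d (.hcom k xs .circle r r' M N) (.hcom k xs .circle r r' O P)

/-- The `VPER`s that are closed under an operator. -/
def ClosedVPERs {u : Bool} (op : TmRel u → TmRel u) : Set (TmRel u) := {R | IsVPER R ∧ op R ≤ R}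

/-- `𝔹`: the intersection of all `VPER`s closed under `BoolOp`. -/
def BoolRel (u : Bool) : TmRel u := fun d M N => ∀ R ∈ ClosedVPERs (BoolOp (u := u)), R d M N

/-- `ℂ`: the intersection of all `VPER`s closed under `CircleOp`. -/
def CircleRel (u : Bool) : TmRel u := fun d M N => ∀ R ∈ ClosedVPERs (CircleOp (u := u)), R d M N

/-! ## Judgments relative to `X = (E, Φ)`

The presuppositions of a judgment are part of it. -/

/-- `A ≐ B pretype [Ψ]`. -/
def PreTyEq {u : Bool} (X : PreCTS u) {d : ℕ} (A B : Tm u d 0) : Prop :=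
  ∀ (d₁ : ℕ) (ψ₁ : DSub d d₁) (d₂ : ℕ) (ψ₂ : DSub d₁ d₂),
    ∃ A₁ A₂ A₁₂ B₁ B₂ B₁₂,
      Eval (A.dsub ψ₁) A₁ ∧ Eval (A₁.dsub ψ₂) A₂ ∧ Eval ((A.dsub ψ₁).dsub ψ₂) A₁₂ ∧
      Eval (B.dsub ψ₁) B₁ ∧ Eval (B₁.dsub ψ₂) B₂ ∧ Eval ((B.dsub ψ₁).dsub ψ₂) B₁₂ ∧
      Rel4 (X.E d₂) A₂ A₁₂ B₂ B₁₂

/-- `M ≐ N ∈ A [Ψ]`. -/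
def TmEq {u : Bool} (X : PreCTS u) {d : ℕ} (M N A : Tm u d 0) : Prop :=
  PreTyEq X A A ∧
  ∀ (d₁ : ℕ) (ψ₁ : DSub d d₁) (d₂ : ℕ) (ψ₂ : DSub d₁ d₂),
    ∃ M₁ M₂ M₁₂ N₁ N₂ N₁₂ A₁₂,
      Eval (M.dsub ψ₁) M₁ ∧ Eval (M₁.dsub ψ₂) M₂ ∧ Eval ((M.dsub ψ₁).dsub ψ₂) M₁₂ ∧
      Eval (N.dsub ψ₁) N₁ ∧ Eval (N₁.dsub ψ₂) N₂ ∧ Eval ((N.dsub ψ₁).dsub ψ₂) N₁₂ ∧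
      Eval ((A.dsub ψ₁).dsub ψ₂) A₁₂ ∧
      Rel4 (X.Φ d₂ A₁₂) M₂ M₁₂ N₂ N₁₂

/-- `M ≐ N ∈ A [Ψ ∣ Ξ]`. -/
def TmEqRes {u : Bool} (X : PreCTS u) {d : ℕ} (Ξ : Eqns d) (M N A : Tm u d 0) : Prop :=
  ∀ (d' : ℕ) (ψ : DSub d d'), Sat Ξ ψ → TmEq X (M.dsub ψ) (N.dsub ψ) (A.dsub ψ)

/-- The pretype `A` is cubical. -/
def Cubical {u : Bool} (X : PreCTS u) {d : ℕ} (A : Tm u d 0) : Prop :=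
  ∀ (d' : ℕ) (ψ : DSub d d') (A₀ : Tm u d' 0), Eval (A.dsub ψ) A₀ →
    ∀ M N, X.Φ d' A₀ M N → TmEq X M N (A.dsub ψ)

/-- `N_i^ε ≐ N_j^ε' ∈ A [Ψ, y ∣ r_i = ε, r_j = ε']` for all `i, j, ε, ε'`. -/
def TubeAdj {u : Bool} (X : PreCTS u) {d k : ℕ} (rs : Fin (k + 1) → Dim d)
    (N : Fin (k + 1) → Bool → Tm u (d + 1) 0) (A : Tm u d 0) : Prop :=
  ∀ i j ε ε',
    TmEqRes X [((rs i).wk, .const ε), ((rs j).wk, .const ε')] (N i ε) (N j ε') A.dwk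

/-- `N_i^ε ≐ P_i^ε ∈ A [Ψ, y ∣ r_i = ε]` for all `i, ε`. -/
def TubeEq {u : Bool} (X : PreCTS u) {d k : ℕ} (rs : Fin (k + 1) → Dim d)
    (N P : Fin (k + 1) → Bool → Tm u (d + 1) 0) (A : Tm u d 0) : Prop :=
  ∀ i ε, TmEqRes X [((rs i).wk, .const ε)] (N i ε) (P i ε) A.dwk

/-- `N_i^ε⟨r/y⟩ ≐ M ∈ A [Ψ ∣ r_i = ε]` for all `i, ε`. -/
def TubeStart {u : Bool} (X : PreCTS u) {d k : ℕ} (rs : Fin (k + 1) → Dim d) (r : Dim d)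
    (N : Fin (k + 1) → Bool → Tm u (d + 1) 0) (M A : Tm u d 0) : Prop :=
  ∀ i ε, TmEqRes X [(rs i, .const ε)] ((N i ε).inst r) M A

/-- `A, B` are equally Kan (presupposing that they are equal pretypes). -/
structure EquallyKan {u : Bool} (X : PreCTS u) {d : ℕ} (A B : Tm u d 0) : Prop where
  hcom_eq : ∀ (d' : ℕ) (ψ : DSub d d') (k : ℕ) (rs : Fin (k + 1) → Dim d') (r r' : Dim d')
    (M O : Tm u d' 0) (N P : Fin (k + 1) → Bool → Tm u (d' + 1) 0),
    TmEq X M O (A.dsub ψ) → TubeAdj X rs N (A.dsub ψ) → TubeEq X rs N P (A.dsub ψ) →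
    TubeStart X rs r N M (A.dsub ψ) →
    TmEq X (.hcom k rs (A.dsub ψ) r r' M N) (.hcom k rs (B.dsub ψ) r r' O P) (A.dsub ψ)
  hcom_cap : ∀ (d' : ℕ) (ψ : DSub d d') (k : ℕ) (rs : Fin (k + 1) → Dim d') (r : Dim d')
    (M : Tm u d' 0) (N : Fin (k + 1) → Bool → Tm u (d' + 1) 0),
    TmEq X M M (A.dsub ψ) → TubeAdj X rs N (A.dsub ψ) → TubeStart X rs r N M (A.dsub ψ) →
    TmEq X (.hcom k rs (A.dsub ψ) r r M N) M (A.dsub ψ)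
  hcom_tube : ∀ (d' : ℕ) (ψ : DSub d d') (k : ℕ) (rs : Fin (k + 1) → Dim d') (r r' : Dim d')
    (M : Tm u d' 0) (N : Fin (k + 1) → Bool → Tm u (d' + 1) 0),
    TmEq X M M (A.dsub ψ) → TubeAdj X rs N (A.dsub ψ) → TubeStart X rs r N M (A.dsub ψ) →
    ∀ i ε, rs i = .const ε →
    TmEq X (.hcom k rs (A.dsub ψ) r r' M N) ((N i ε).inst r') (A.dsub ψ)
  coe_eq : ∀ (d' : ℕ) (ψ : DSub d (d' + 1)) (r r' : Dim d') (M N : Tm u d' 0),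
    TmEq X M N ((A.dsub ψ).inst r) →
    TmEq X (.coe (A.dsub ψ) r r' M) (.coe (B.dsub ψ) r r' N) ((A.dsub ψ).inst r')
  coe_same : ∀ (d' : ℕ) (ψ : DSub d (d' + 1)) (r : Dim d') (M : Tm u d' 0),
    TmEq X M M ((A.dsub ψ).inst r) →
    TmEq X (.coe (A.dsub ψ) r r M) M ((A.dsub ψ).inst r)

/-- `A ≐ B type [Ψ]`. -/
def TyEq {u : Bool} (X : PreCTS u) {d : ℕ} (A B : Tm u d 0) : Prop :=
  PreTyEq X A B ∧ Cubical X A ∧ Cubical X B ∧ EquallyKan X A B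

/-- `A ≐ B type [Ψ ∣ Ξ]`. -/
def TyEqRes {u : Bool} (X : PreCTS u) {d : ℕ} (Ξ : Eqns d) (A B : Tm u d 0) : Prop :=
  ∀ (d' : ℕ) (ψ : DSub d d'), Sat Ξ ψ → TyEq X (A.dsub ψ) (B.dsub ψ)

/-! The open judgments, for contexts `a : A` with one variable. -/

/-- `a : A ≫ B ≐ B' pretype [Ψ]`. -/
def OpenPreTyEq {u : Bool} (X : PreCTS u) {d : ℕ} (A : Tm u d 0) (B B' : Tm u d 1) : Prop :=
  PreTyEq X A A ∧
  ∀ (d' : ℕ) (ψ : DSub d d') (N N' : Tm u d' 0), TmEq X N N' (A.dsub ψ) →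
    PreTyEq X ((B.dsub ψ).subst N) ((B'.dsub ψ).subst N')

/-- `a : A ≫ M ≐ M' ∈ B [Ψ]`. -/
def OpenTmEq {u : Bool} (X : PreCTS u) {d : ℕ} (A : Tm u d 0) (M M' B : Tm u d 1) : Prop :=
  OpenPreTyEq X A B B ∧
  ∀ (d' : ℕ) (ψ : DSub d d') (N N' : Tm u d' 0), TmEq X N N' (A.dsub ψ) →
    TmEq X ((M.dsub ψ).subst N) ((M'.dsub ψ).subst N') ((B.dsub ψ).subst N)

/-- `a : A ≫ M ≐ M' ∈ B [Ψ ∣ Ξ]`. -/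
def OpenTmEqRes {u : Bool} (X : PreCTS u) {d : ℕ} (Ξ : Eqns d) (A : Tm u d 0) (M M' B : Tm u d 1) :
    Prop :=
  ∀ (d' : ℕ) (ψ : DSub d d'), Sat Ξ ψ →
    OpenTmEq X (A.dsub ψ) (M.dsub ψ) (M'.dsub ψ) (B.dsub ψ)

/-- `a : A ≫ B ≐ B' type [Ψ]`. -/
def OpenTyEq {u : Bool} (X : PreCTS u) {d : ℕ} (A : Tm u d 0) (B B' : Tm u d 1) : Prop :=
  OpenPreTyEq X A B B' ∧
  ∀ (d' : ℕ) (ψ : DSub d d') (N N' : Tm u d' 0), TmEq X N N' (A.dsub ψ) →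
    TyEq X ((B.dsub ψ).subst N) ((B'.dsub ψ).subst N')

/-! ## What it means for `X = (E, Φ)` to have a type -/

/-- `X` has booleans. -/
def HasBooleans {u : Bool} (X : PreCTS u) : Prop :=
  (∀ d, X.E d .bool .bool) ∧
  IsLeast (ClosedVPERs BoolOp) (fun d V V' => X.Φ d .bool V V')

/-- `X` has the circle. -/
def HasCircle {u : Bool} (X : PreCTS u) : Prop :=
  (∀ d, X.E d .circle .circle) ∧
  IsLeast (ClosedVPERs CircleOp) (fun d V V' => X.Φ d .circle V V')

/-- `X` has all dependent function types. -/
def HasPi {u : Bool} (X : PreCTS u) : Prop :=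
  ∀ (d : ℕ) (A A' : Tm u d 0) (B B' : Tm u d 1), TyEq X A A' → OpenTyEq X A B B' →
    ∀ (d' : ℕ) (ψ : DSub d d'),
      X.E d' (.pi (A.dsub ψ) (B.dsub ψ)) (.pi (A'.dsub ψ) (B'.dsub ψ)) ∧
      IsLeast {R : Tm u d' 0 → Tm u d' 0 → Prop |
          ∀ M M', OpenTmEq X (A.dsub ψ) M M' (B.dsub ψ) → R (.lam M) (.lam M')}
        (X.Φ d' (.pi (A.dsub ψ) (B.dsub ψ)))

/-- `X` has all dependent pair types. -/
def HasSigma {u : Bool} (X : PreCTS u) : Prop :=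
  ∀ (d : ℕ) (A A' : Tm u d 0) (B B' : Tm u d 1), TyEq X A A' → OpenTyEq X A B B' →
    ∀ (d' : ℕ) (ψ : DSub d d'),
      X.E d' (.sigma (A.dsub ψ) (B.dsub ψ)) (.sigma (A'.dsub ψ) (B'.dsub ψ)) ∧
      IsLeast {R : Tm u d' 0 → Tm u d' 0 → Prop |
          ∀ M M' N N', TmEq X M M' (A.dsub ψ) → TmEq X N N' ((B.dsub ψ).subst M) →
            R (.pair M N) (.pair M' N')}
        (X.Φ d' (.sigma (A.dsub ψ) (B.dsub ψ)))

/-- `X` has all identification types. -/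
def HasIdent {u : Bool} (X : PreCTS u) : Prop :=
  ∀ (d : ℕ) (A A' : Tm u (d + 1) 0) (P₀ P₀' P₁ P₁' : Tm u d 0), TyEq X A A' →
    TmEq X P₀ P₀' (A.inst (.const false)) → TmEq X P₁ P₁' (A.inst (.const true)) →
    ∀ (d' : ℕ) (ψ : DSub d d'),
      X.E d' (.ident (A.dsub ψ.lift) (P₀.dsub ψ) (P₁.dsub ψ))
        (.ident (A'.dsub ψ.lift) (P₀'.dsub ψ) (P₁'.dsub ψ)) ∧
      IsLeast {R : Tm u d' 0 → Tm u d' 0 → Prop |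
          ∀ M M', TmEq X M M' (A.dsub ψ.lift) →
            TmEq X (M.inst (.const false)) (P₀.dsub ψ) ((A.dsub ψ.lift).inst (.const false)) →
            TmEq X (M.inst (.const true)) (P₁.dsub ψ) ((A.dsub ψ.lift).inst (.const true)) →
            R (.dlam M) (.dlam M')}
        (X.Φ d' (.ident (A.dsub ψ.lift) (P₀.dsub ψ) (P₁.dsub ψ)))

/-- `X` has the `not_x` type. -/
def HasNot {u : Bool} (X : PreCTS u) : Prop :=
  ∀ (d : ℕ) (x : Fin d),
    X.E d (.notb (.name x)) (.notb (.name x)) ∧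
    IsLeast {R : Tm u d 0 → Tm u d 0 → Prop |
        ∀ M M', TmEq X M M' .bool → R (.notel (.name x) M) (.notel (.name x) M')}
      (X.Φ d (.notb (.name x)))

/-- `a : A ≫ G (F a) ≐ a ∈ A [Ψ ∣ Ξ]`. -/
def LeftInv {u : Bool} (X : PreCTS u) {d : ℕ} (Ξ : Eqns d) (A F G : Tm u d 0) : Prop :=
  OpenTmEqRes X Ξ A (.app G.twk (.app F.twk (.var 0))) (.var 0) A.twk

/-- The six premises of the isomorphism-univalence type of `(A, B, F, G)` and `(A', B', F', G')`
at `r`. -/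
structure IsoEq {u : Bool} (X : PreCTS u) {d : ℕ} (r : Dim d) (A B F G A' B' F' G' : Tm u d 0) :
    Prop where
  dom : TyEq X A A'
  cod : TyEqRes X [(r, .const true)] B B'
  fwd : TmEqRes X [(r, .const true)] F F' (.arr A B)
  bwd : TmEqRes X [(r, .const true)] G G' (.arr B A)
  left_inv : LeftInv X [(r, .const true)] A F G
  right_inv : LeftInv X [(r, .const true)] B G F

/-- `X` has all isomorphism-univalence types. -/
def HasIso {u : Bool} (X : PreCTS u) : Prop :=
  ∀ (h : u = true) (d : ℕ) (r : Dim d) (A B F G A' B' F' G' : Tm u d 0),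
    IsoEq X r A B F G A' B' F' G' →
    ∀ (d' : ℕ) (ψ : DSub d d') (x : Fin d'), r.dsub ψ = .name x →
      X.E d' (.ia h (.name x) (A.dsub ψ) (B.dsub ψ) (F.dsub ψ) (G.dsub ψ))
        (.ia h (.name x) (A'.dsub ψ) (B'.dsub ψ) (F'.dsub ψ) (G'.dsub ψ)) ∧
      IsLeast {R : Tm u d' 0 → Tm u d' 0 → Prop |
          ∀ M M' F₁ F₂, TmEq X M M' (A.dsub ψ) →
            TmEqRes X [(.name x, .const true)] (F.dsub ψ) F₁ (.arr (A.dsub ψ) (B.dsub ψ)) →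
            TmEqRes X [(.name x, .const true)] (F.dsub ψ) F₂ (.arr (A.dsub ψ) (B.dsub ψ)) →
            R (.iain h (.name x) M F₁) (.iain h (.name x) M' F₂)}
        (X.Φ d' (.ia h (.name x) (A.dsub ψ) (B.dsub ψ) (F.dsub ψ) (G.dsub ψ)))

/-- `X` has booleans, the circle, all dependent function, dependent pair and identification types,
and the `not_x` type. -/
structure HasTypes {u : Bool} (X : PreCTS u) : Prop where
  booleans : HasBooleans X
  circle : HasCircle X
  pi : HasPi X
  sigma : HasSigma X
  ident : HasIdent X
  not : HasNot X

/-! ## The operators -/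

/-- The type part `E'` of `F(E, Φ)`. -/
inductive FE {u : Bool} (X : PreCTS u) : ∀ d : ℕ, Tm u d 0 → Tm u d 0 → Prop
  | bool {d : ℕ} : FE X d .bool .bool
  | circle {d : ℕ} : FE X d .circle .circle
  | pi {d : ℕ} {A A' : Tm u d 0} {B B' : Tm u d 1} (hA : TyEq X A A') (hB : OpenTyEq X A B B') :
      FE X d (.pi A B) (.pi A' B')
  | sigma {d : ℕ} {A A' : Tm u d 0} {B B' : Tm u d 1} (hA : TyEq X A A')
      (hB : OpenTyEq X A B B') : FE X d (.sigma A B) (.sigma A' B')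
  | ident {d : ℕ} {A A' : Tm u (d + 1) 0} {P₀ P₁ P₀' P₁' : Tm u d 0} (hA : TyEq X A A')
      (h₀ : TmEq X P₀ P₀' (A.inst (.const false))) (h₁ : TmEq X P₁ P₁' (A.inst (.const true))) :
      FE X d (.ident A P₀ P₁) (.ident A' P₀' P₁')
  | notb {d : ℕ} (x : Fin d) (h : TyEq X (.bool : Tm u d 0) .bool) :
      FE X d (.notb (.name x)) (.notb (.name x))

/-- The element part `Φ'` of `F(E, Φ)`. -/
inductive FΦ {u : Bool} (X : PreCTS u) : ∀ d : ℕ, Tm u d 0 → Tm u d 0 → Tm u d 0 → Prop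
  | bool {d : ℕ} {V V' : Tm u d 0} (h : BoolRel u d V V') : FΦ X d .bool V V'
  | circle {d : ℕ} {V V' : Tm u d 0} (h : CircleRel u d V V') : FΦ X d .circle V V'
  | pi {d : ℕ} {A : Tm u d 0} {B M M' : Tm u d 1} (h : OpenTmEq X A M M' B) :
      FΦ X d (.pi A B) (.lam M) (.lam M')
  | sigma {d : ℕ} {A : Tm u d 0} {B : Tm u d 1} {M M' N N' : Tm u d 0} (hM : TmEq X M M' A)
      (hN : TmEq X N N' (B.subst M)) : FΦ X d (.sigma A B) (.pair M N) (.pair M' N')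
  | ident {d : ℕ} {A : Tm u (d + 1) 0} {P₀ P₁ : Tm u d 0} {M M' : Tm u (d + 1) 0}
      (hM : TmEq X M M' A)
      (h₀ : TmEq X (M.inst (.const false)) P₀ (A.inst (.const false)))
      (h₁ : TmEq X (M.inst (.const true)) P₁ (A.inst (.const true))) :
      FΦ X d (.ident A P₀ P₁) (.dlam M) (.dlam M')
  | notb {d : ℕ} (x : Fin d) {M M' : Tm u d 0} (h : TmEq X M M' .bool) :
      FΦ X d (.notb (.name x)) (.notel (.name x) M) (.notel (.name x) M')

/-- The additional clause of `E'` for isomorphism-univalence types. -/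
inductive IsoE {u : Bool} (X : PreCTS u) : ∀ d : ℕ, Tm u d 0 → Tm u d 0 → Prop
  | ia {d : ℕ} (h : u = true) (x : Fin d) {A B F G A' B' F' G' : Tm u d 0}
      (hA : TyEq X A A')
      (hB : TyEqRes X [(.name x, .const true)] B B')
      (hAB : TyEqRes X [(.name x, .const true)] (.arr A B) (.arr A' B'))
      (hBA : TyEqRes X [(.name x, .const true)] (.arr B A) (.arr B' A'))
      (hF : TmEqRes X [(.name x, .const true)] F F' (.arr A B))
      (hG : TmEqRes X [(.name x, .const true)] G G' (.arr B A))
      (hGF : LeftInv X [(.name x, .const true)] A F G)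
      (hFG : LeftInv X [(.name x, .const true)] B G F) :
      IsoE X d (.ia h (.name x) A B F G) (.ia h (.name x) A' B' F' G')

/-- The additional clause of `Φ'` for isomorphism-univalence types. -/
inductive IsoΦ {u : Bool} (X : PreCTS u) : ∀ d : ℕ, Tm u d 0 → Tm u d 0 → Tm u d 0 → Prop
  | ia {d : ℕ} (h : u = true) (x : Fin d) {A B F G M M' F₁ F₂ : Tm u d 0}
      (hM : TmEq X M M' A)
      (h₁ : TmEqRes X [(.name x, .const true)] F F₁ (.arr A B))
      (h₂ : TmEqRes X [(.name x, .const true)] F F₂ (.arr A B)) :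
      IsoΦ X d (.ia h (.name x) A B F G) (.iain h (.name x) M F₁) (.iain h (.name x) M' F₂)

/-- The operator `F(E, Φ) = (E', Φ')`; as in every cubical type system, `Φ'(Ψ, A, -, -)` is only
defined for `A` with `E'(Ψ, A, A)`. -/
def Fop {u : Bool} (X : PreCTS u) : PreCTS u where
  E := FE X
  Φ := fun d A V V' => FE X d A A ∧ FΦ X d A V V'

/-- The operator `F`, extended by the clauses for isomorphism-univalence types. -/
def FopIso {u : Bool} (X : PreCTS u) : PreCTS u where
  E := fun d A B => FE X d A B ∨ IsoE X d A B
  Φ := fun d A V V' => (FE X d A A ∨ IsoE X d A A) ∧ (FΦ X d A V V' ∨ IsoΦ X d A V V')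

/-- `R` is the least fixed point in `(VPER, ⊑)` of `op`, which is a monotone operator there. -/
structure IsVPERLfp {u : Bool} (op : TmRel u → TmRel u) (R : TmRel u) : Prop where
  maps : ∀ S, IsVPER S → IsVPER (op S)
  mono : ∀ S T, IsVPER S → IsVPER T → S.Approx T → (op S).Approx (op T)
  vper : IsVPER R
  fixed : op R = R
  least : ∀ S, IsVPER S → op S = S → R.Approx S

/-- `op` is monotone with respect to the approximation ordering of cubical type systems. -/
def MonoOnCTS {u : Bool} (op : PreCTS u → PreCTS u) : Prop :=
  ∀ X Y, IsCTS X → IsCTS Y → X.Approx Y → (op X).Approx (op Y)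

/-- `X` is the least among the cubical type systems that are fixed points of `op`. -/
structure IsCTSLfp {u : Bool} (op : PreCTS u → PreCTS u) (X : PreCTS u) : Prop where
  cts : IsCTS X
  fixed : op X = X
  least : ∀ Y, IsCTS Y → op Y = Y → X.Approx Y

end CubicalTT

/-! The argument rests on the asymmetry of `⊑`. If `X ⊑ Y` and `A` is already a pretype of `X`, then
every value reached from `A` lies in the type relation of `X`, where the two element relations
agree, so `X` and `Y` have the same equal elements of `A` (`PreTyEq.tmEq_iff`). Hypotheses about
elements of `A` therefore move from `Y` back to `X`, which makes the judgments with negative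
occurrences (open equality, the Kan conditions) monotone. Conversely an equality of `Y` whose left
side is already a pretype of `X` holds in `X` (`TyEq.of_approx`). Applied to each clause, these two
facts give monotonicity of `Fop` and `FopIso`.

That the operators yield symmetric and transitive relations is a matter of conversion between equal
types. The judgments quantify over two successive substitutions. `GCube` splits them into coherence
of each term separately and relatedness of values at one substitution, so the PER laws become
immediate and `GCube.expand` gives equality by head expansion.

Least fixed points in the cubical type systems come from Zorn's lemma on the post-fixed points that
lie below every fixed point (`exists_isCTSLfp`). This needs the operator to preserve cubical type
systems only at post-fixed points. For the booleans and the circle the least closed relation is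
taken for inclusion, and `isVPERLfp_of_mono` shows that it is also least for `⊑`.

The extended operator needs more. Symmetry of its clause asks that the inverse laws for `F`, `G`
pass to `F'`, `G'`, hence that application respects equality. This holds once canonical elements of
function types are known to be lambdas, and `X ⊑ FopIso X` supplies that
(`ArrInv.of_approx_fopIso`).

At a fixed point the types and elements are those of the clauses, so possession of the types is
mostly inversion. Two premises of clauses are not among the assumptions and have to be proved: that
`bool` is a Kan type (`tyEq_bool`), and that `A → B` is a type when `A` and `B` are (`tyEq_arr`).
The latter reduces the Kan equations to those of `A` and `B` by extensionality. -/

namespace CubicalTT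

/-! ## Substitution lemmas -/

/-- Composition of dimension substitutions, in diagrammatic order. -/
def DSub.comp {d d' d'' : ℕ} (ψ : DSub d d') (ψ' : DSub d' d'') : DSub d d'' :=
  fun x => (ψ x).dsub ψ'

/-- The identity dimension substitution. -/
def DSub.id (d : ℕ) : DSub d d := Dim.name

theorem Dim.dsub_dsub {d d' d'' : ℕ} (r : Dim d) (ψ : DSub d d') (ψ' : DSub d' d'') :
    (r.dsub ψ).dsub ψ' = r.dsub (ψ.comp ψ') := by cases r <;> rfl

theorem Dim.dsub_id {d : ℕ} (r : Dim d) : r.dsub (DSub.id d) = r := by cases r <;> rfl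

theorem DSub.comp_assoc {d d' d'' d₃ : ℕ} (ψ : DSub d d') (ψ' : DSub d' d'') (φ : DSub d'' d₃) :
    (ψ.comp ψ').comp φ = ψ.comp (ψ'.comp φ) :=
  funext fun x => Dim.dsub_dsub (ψ x) ψ' φ

@[simp] theorem DSub.id_comp {d d' : ℕ} (ψ : DSub d d') : (DSub.id d).comp ψ = ψ := rfl

@[simp] theorem DSub.comp_id {d d' : ℕ} (ψ : DSub d d') : ψ.comp (DSub.id d') = ψ :=
  funext fun x => Dim.dsub_id (ψ x)

@[simp] theorem DSub.wk_comp_lift {d d' : ℕ} (ψ : DSub d d') :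
    (DSub.wk d).comp ψ.lift = ψ.comp (DSub.wk d') := rfl

@[simp] theorem DSub.wk_comp_inst {d : ℕ} (r : Dim d) :
    (DSub.wk d).comp (DSub.inst r) = DSub.id d := rfl

theorem DSub.lift_comp {d d' d'' : ℕ} (ψ : DSub d d') (ψ' : DSub d' d'') :
    (ψ.comp ψ').lift = ψ.lift.comp ψ'.lift := by
  funext x
  refine Fin.cases rfl (fun x => ?_) x
  change ((ψ x).dsub ψ').dsub (DSub.wk _) = ((ψ x).dsub (DSub.wk _)).dsub ψ'.lift
  rw [Dim.dsub_dsub, Dim.dsub_dsub, DSub.wk_comp_lift]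

@[simp] theorem DSub.lift_id (d : ℕ) : (DSub.id d).lift = DSub.id (d + 1) := by
  funext x
  exact Fin.cases rfl (fun _ => rfl) x

theorem DSub.inst_comp {d d' : ℕ} (r : Dim d) (ψ : DSub d d') :
    (DSub.inst r).comp ψ = ψ.lift.comp (DSub.inst (r.dsub ψ)) := by
  funext x
  refine Fin.cases rfl (fun x => ?_) x
  change ψ x = ((ψ x).dsub (DSub.wk _)).dsub (DSub.inst _)
  rw [Dim.dsub_dsub, DSub.wk_comp_inst, Dim.dsub_id]

theorem Dim.wk_dsub_lift {d d' : ℕ} (r : Dim d) (ψ : DSub d d') :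
    r.wk.dsub ψ.lift = (r.dsub ψ).wk := by
  rw [Dim.wk, Dim.wk, Dim.dsub_dsub, Dim.dsub_dsub, DSub.wk_comp_lift]

theorem Dim.wk_dsub_inst {d : ℕ} (r s : Dim d) : r.wk.dsub (DSub.inst s) = r := by
  rw [Dim.wk, Dim.dsub_dsub, DSub.wk_comp_inst, Dim.dsub_id]

namespace Tm

variable {u : Bool}

theorem dsub_dsub {d n : ℕ} (M : Tm u d n) {d' d'' : ℕ} (ψ : DSub d d') (ψ' : DSub d' d'') :
    (M.dsub ψ).dsub ψ' = M.dsub (ψ.comp ψ') := by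
  induction M generalizing d' d'' <;> simp only [dsub, Dim.dsub_dsub, DSub.lift_comp, *]

@[simp] theorem dsub_id {d n : ℕ} (M : Tm u d n) : M.dsub (DSub.id d) = M := by
  induction M <;> simp only [dsub, Dim.dsub_id, DSub.lift_id, *]

theorem inst_dsub {d n d' : ℕ} (M : Tm u (d + 1) n) (r : Dim d) (ψ : DSub d d') :
    (M.inst r).dsub ψ = (M.dsub ψ.lift).inst (r.dsub ψ) := by
  rw [inst, inst, dsub_dsub, dsub_dsub, DSub.inst_comp]

theorem dwk_dsub_lift {d n d' : ℕ} (M : Tm u d n) (ψ : DSub d d') :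
    M.dwk.dsub ψ.lift = (M.dsub ψ).dwk := by
  rw [dwk, dwk, dsub_dsub, dsub_dsub, DSub.wk_comp_lift]

theorem dwk_inst {d n : ℕ} (M : Tm u d n) (r : Dim d) : M.dwk.inst r = M := by
  rw [dwk, inst, dsub_dsub, DSub.wk_comp_inst, dsub_id]

theorem ren_dsub {d n : ℕ} (M : Tm u d n) {n' d' : ℕ} (ρ : Fin n → Fin n') (ψ : DSub d d') :
    (M.ren ρ).dsub ψ = (M.dsub ψ).ren ρ := by
  induction M generalizing n' d' <;> simp only [dsub, ren, *]

theorem twk_dsub {d n d' : ℕ} (M : Tm u d n) (ψ : DSub d d') :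
    M.twk.dsub ψ = (M.dsub ψ).twk := ren_dsub M _ ψ

theorem subLift_dsub {d n n' d' : ℕ} (σ : Fin n → Tm u d n') (ψ : DSub d d') :
    (fun a => (subLift σ a).dsub ψ) = subLift (fun a => (σ a).dsub ψ) := by
  funext a
  exact Fin.cases rfl (fun a => twk_dsub (σ a) ψ) a

theorem subDLift_dsub {d n n' d' : ℕ} (σ : Fin n → Tm u d n') (ψ : DSub d d') :
    (fun a => (subDLift σ a).dsub ψ.lift) = subDLift (fun a => (σ a).dsub ψ) :=
  funext fun a => dwk_dsub_lift (σ a) ψ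

/-- The substituted terms carry dimension names of their own, so the dimension substitution has to
act on them too. -/
theorem tsub_dsub {d n : ℕ} (M : Tm u d n) {n' d' : ℕ} (σ : Fin n → Tm u d n') (ψ : DSub d d') :
    (M.tsub σ).dsub ψ = (M.dsub ψ).tsub (fun a => (σ a).dsub ψ) := by
  induction M generalizing n' d' <;> simp only [dsub, tsub, subLift_dsub, subDLift_dsub, *]

theorem subst_dsub {d d' n : ℕ} (M : Tm u d (n + 1)) (N : Tm u d n) (ψ : DSub d d') :
    (M.subst N).dsub ψ = (M.dsub ψ).subst (N.dsub ψ) := by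
  rw [subst, subst, tsub_dsub]
  congr 1
  funext a
  exact Fin.cases rfl (fun _ => rfl) a

theorem subLift_renLift {d n n' n'' : ℕ} (ρ : Fin n → Fin n') (σ : Fin n' → Tm u d n'') :
    (fun a => subLift σ (renLift ρ a)) = subLift (fun a => σ (ρ a)) := by
  funext a
  exact Fin.cases rfl (fun _ => rfl) a

theorem subDLift_ren {d n n' n'' : ℕ} (ρ : Fin n → Fin n') (σ : Fin n' → Tm u d n'') :
    (fun a => subDLift σ (ρ a)) = subDLift (fun a => σ (ρ a)) := rfl

theorem ren_tsub {d n : ℕ} (M : Tm u d n) {n' n'' : ℕ} (ρ : Fin n → Fin n')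
    (σ : Fin n' → Tm u d n'') : (M.ren ρ).tsub σ = M.tsub (fun a => σ (ρ a)) := by
  induction M generalizing n' n'' <;> simp only [ren, tsub, subLift_renLift, subDLift_ren, *]

theorem subLift_var {d n : ℕ} : subLift (var : Fin n → Tm u d n) = var := by
  funext a
  exact Fin.cases rfl (fun _ => rfl) a

theorem subDLift_var {d n : ℕ} : subDLift (var : Fin n → Tm u d n) = var := rfl

theorem tsub_var {d n : ℕ} (M : Tm u d n) : M.tsub var = M := by
  induction M <;> simp only [tsub, subLift_var, subDLift_var, *]

theorem twk_tsub {d n : ℕ} (M : Tm u d n) (σ : Fin (n + 1) → Tm u d n)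
    (h : ∀ a : Fin n, σ a.succ = var a) : M.twk.tsub σ = M := by
  rw [twk, ren_tsub, funext h, tsub_var]

@[simp] theorem twk_subst {d n : ℕ} (M : Tm u d n) (N : Tm u d n) : M.twk.subst N = M :=
  twk_tsub M _ fun _ => rfl

theorem twk_tsub_cases {d n : ℕ} (M : Tm u d n) (N : Tm u d n) :
    M.twk.tsub (Fin.cases N var) = M := twk_subst M N

@[simp] theorem twk_tsub_subDLift {d n : ℕ} (M : Tm u (d + 1) n) (N : Tm u d n) :
    M.twk.tsub (subDLift (Fin.cases N var)) = M :=
  twk_tsub M _ fun _ => rfl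

/-- A closed term has no variable to replace, so all substitutions agree on its weakening. This
removes the dependency from the coercion rule for `pi` when the function type is non-dependent. -/
theorem twk_tsub_closed {d : ℕ} (M : Tm u d 0) (σ : Fin 1 → Tm u d 1) :
    M.twk.tsub σ = M.twk := by
  rw [twk, ren_tsub, ← tsub_var (M.ren _), ren_tsub]
  congr 1
  funext a
  exact a.elim0

@[simp] theorem arr_dsub {d n d' : ℕ} (A B : Tm u d n) (ψ : DSub d d') :
    (arr A B).dsub ψ = arr (A.dsub ψ) (B.dsub ψ) := by
  simp [arr, dsub, twk_dsub]

end Tm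

end CubicalTT

namespace CubicalTT

/-! ## Evaluation is deterministic -/

variable {u : Bool}

theorem Dim.IsName.ne_const {d : ℕ} {r : Dim d} (h : r.IsName) (ε : Bool) : r ≠ .const ε := by
  obtain ⟨x, rfl⟩ := h
  exact nofun

/-- Only the `hcom` values share their head with a contraction rule. Their side conditions (all
extents names, `r ≠ r'`) exclude exactly the tube and cap rules. -/
theorem IsVal.not_step {d : ℕ} {M N : Tm u d 0} (hM : IsVal M) : ¬ Step M N := by
  intro h
  cases hM with
  | hcom_bool _ _ hrs hr =>
    cases h with
    | hcom_type _ _ _ _ _ h => cases h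
    | hcom_bool_tube _ _ _ _ _ _ _ hi _ => exact (hrs _).ne_const _ hi
    | hcom_bool_cap _ _ _ _ _ _ hr' => exact hr hr'
  | hcom_circle _ _ hrs hr =>
    cases h with
    | hcom_type _ _ _ _ _ h => cases h
    | hcom_circle_tube _ _ _ _ _ _ _ hi _ => exact (hrs _).ne_const _ hi
    | hcom_circle_cap _ _ _ _ _ _ hr' => exact hr hr'
  | _ => cases h

theorem tube_unique {d k : ℕ} {rs : Fin (k + 1) → Dim d} {i j : Fin (k + 1)} {ε ε' : Bool}
    (hi : rs i = .const ε) (hlt : ∀ l < i, (rs l).IsName) (hj : rs j = .const ε')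
    (hlt' : ∀ l < j, (rs l).IsName) : i = j ∧ ε = ε' := by
  obtain h | rfl | h := lt_trichotomy i j
  · exact absurd hi ((hlt' i h).ne_const ε)
  · exact ⟨rfl, by simpa [hi] using hj⟩
  · exact absurd hj ((hlt j h).ne_const ε')

/-- A congruence rule and a contraction rule never apply to the same term, because contraction
requires the principal argument to be a value and values do not step. Among contractions, only tube
and cap need their side conditions compared. -/
theorem Step.det {d : ℕ} {M N N' : Tm u d 0} (h : Step M N) (h' : Step M N') : N = N' := by
  induction h with
  | coe_not_ne | coe_not_opp | coe_not_same =>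
    -- The indices of these rules contain `!ε`, a repeated `ε` or a successor name. The term is
    -- replaced by a variable, and the resulting equation is solved or refuted by hand.
    generalize hX : Tm.coe _ _ _ _ = X at h'
    cases h' <;> simp_all
    all_goals first
      | exact absurd hX.1.symm (Fin.succ_ne_zero _)
      | obtain ⟨rfl, h, _⟩ := hX; simp at h
      | obtain ⟨rfl, _⟩ := hX; casesm Step _ _
  | coe_ia_ne =>
    generalize hX : Tm.coe _ _ _ _ = X at h'
    cases h' <;> simp_all
    obtain ⟨rfl, _⟩ := hX
    casesm Step _ _
  | hcom_bool_tube _ _ _ _ _ _ _ hi hlt =>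
    cases h' with
    | hcom_type _ _ _ _ _ h => cases h
    | hcom_bool_tube _ _ _ _ _ _ _ hj hlt' => obtain ⟨rfl, rfl⟩ := tube_unique hi hlt hj hlt'; rfl
    | hcom_bool_cap _ _ _ _ _ hrs _ => exact absurd hi ((hrs _).ne_const _)
  | hcom_circle_tube _ _ _ _ _ _ _ hi hlt =>
    cases h' with
    | hcom_type _ _ _ _ _ h => cases h
    | hcom_circle_tube _ _ _ _ _ _ _ hj hlt' =>
      obtain ⟨rfl, rfl⟩ := tube_unique hi hlt hj hlt'; rfl
    | hcom_circle_cap _ _ _ _ _ hrs _ => exact absurd hi ((hrs _).ne_const _)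
  | hcom_bool_cap _ _ _ _ _ hrs =>
    cases h' with
    | hcom_type _ _ _ _ _ h => cases h
    | hcom_bool_tube _ _ _ _ _ _ _ hj _ => exact absurd hj ((hrs _).ne_const _)
    | hcom_bool_cap => rfl
  | hcom_circle_cap _ _ _ _ _ hrs =>
    cases h' with
    | hcom_type _ _ _ _ _ h => cases h
    | hcom_circle_tube _ _ _ _ _ _ _ hj _ => exact absurd hj ((hrs _).ne_const _)
    | hcom_circle_cap => rfl
  | ifb_hcom _ _ _ _ _ _ _ _ hrs hr =>
    cases h' with
    | ifb_arg _ _ _ h => exact absurd h (IsVal.hcom_bool _ _ hrs hr).not_step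
    | ifb_hcom => rfl
  | celim_hcom _ _ _ _ _ _ _ _ hrs hr =>
    cases h' with
    | celim_arg _ _ _ h => exact absurd h (IsVal.hcom_circle _ _ hrs hr).not_step
    | celim_hcom => rfl
  | ifb_arg _ _ _ _ ih =>
    cases h' with
    | ifb_arg _ _ _ h => rw [ih h]
    | ifb_hcom _ _ _ _ _ _ _ _ hrs hr =>
      exact absurd ‹Step _ _› (IsVal.hcom_bool _ _ hrs hr).not_step
    | _ => casesm Step _ _
  | celim_arg _ _ _ _ ih =>
    cases h' with
    | celim_arg _ _ _ h => rw [ih h]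
    | celim_hcom _ _ _ _ _ _ _ _ hrs hr =>
      exact absurd ‹Step _ _› (IsVal.hcom_circle _ _ hrs hr).not_step
    | _ => casesm Step _ _
  | hcom_type _ _ _ _ _ _ ih =>
    cases h' with
    | hcom_type _ _ _ _ _ h => rw [ih h]
    | _ => casesm Step _ _
  | coe_type _ _ _ _ ih =>
    cases h' with
    | coe_type _ _ _ h => rw [ih h]
    | coe_not_arg => casesm Step (Tm.notb _) _
    | _ => casesm Step _ _
  | coe_not_arg _ _ _ ih =>
    cases h' with
    | coe_type _ _ _ h => cases h
    | coe_not_arg _ _ h => rw [ih h]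
    | coe_not_notel => casesm Step (Tm.notel _ _) _
  | app_fun _ _ ih =>
    cases h' with
    | app_fun _ h => rw [ih h]
    | app_lam => casesm Step (Tm.lam _) _
  | fst_arg _ ih =>
    cases h' with
    | fst_arg h => rw [ih h]
    | fst_pair => casesm Step _ _
  | snd_arg _ ih =>
    cases h' with
    | snd_arg h => rw [ih h]
    | snd_pair => casesm Step _ _
  | dapp_fun _ _ ih =>
    cases h' with
    | dapp_fun _ h => rw [ih h]
    | dapp_dlam => casesm Step _ _
  | iaout_arg _ _ _ _ ih =>
    cases h' with
    | iaout_arg _ _ _ h => rw [ih h]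
    | iaout_iain => casesm Step _ _
  | _ =>
    cases h' <;> first
      | rfl
      | casesm Step (Tm.pi _ _) _, Step (Tm.sigma _ _) _, Step (Tm.ident _ _ _) _, Step Tm.bool _,
          Step Tm.circle _, Step (Tm.notb _) _, Step (Tm.ia _ _ _ _ _ _) _, Step (Tm.lam _) _,
          Step (Tm.pair _ _) _, Step (Tm.dlam _) _, Step Tm.tt _, Step Tm.ff _, Step Tm.base _,
          Step (Tm.loop _) _, Step (Tm.notel _ _) _, Step (Tm.iain _ _ _ _) _

theorem Eval.det {d : ℕ} {M V V' : Tm u d 0} (h : Eval M V) (h' : Eval M V') : V = V' := by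
  obtain ⟨h, hV⟩ := h
  obtain ⟨h', hV'⟩ := h'
  induction h using Relation.ReflTransGen.head_induction_on with
  | refl =>
    obtain rfl | ⟨_, h, _⟩ := h'.cases_head
    · rfl
    · exact absurd h hV.not_step
  | head h _ ih =>
    obtain rfl | ⟨_, h₁, h₂⟩ := h'.cases_head
    · exact absurd h hV'.not_step
    · exact ih (h.det h₁ ▸ h₂)

theorem IsVal.eval {d : ℕ} {V : Tm u d 0} (hV : IsVal V) : Eval V V := ⟨.refl, hV⟩

theorem IsVal.eq_of_eval {d : ℕ} {V W : Tm u d 0} (hV : IsVal V) (h : Eval V W) : W = V :=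
  h.det hV.eval

/-- Evaluation in any number of steps, not necessarily to a value. -/
abbrev Steps {d : ℕ} (M N : Tm u d 0) : Prop := Relation.ReflTransGen Step M N

theorem Steps.eval {d : ℕ} {M N V : Tm u d 0} (h : Steps M N) (hV : Eval N V) : Eval M V :=
  ⟨h.trans hV.1, hV.2⟩

theorem Steps.app {d : ℕ} {M M' : Tm u d 0} (h : Steps M M') (N : Tm u d 0) :
    Steps (.app M N) (.app M' N) :=
  by
  induction h with
  | refl => exact .refl
  | tail _ h ih => exact ih.tail (.app_fun N h)

end CubicalTT

namespace CubicalTT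

variable {u : Bool}

/-! ## Families of relations, and coherent evaluation

The derived relation `R^□`, equality of pretypes and equality of elements are instances of one
notion, relative to a family of relations indexed by the substitutions into a context. -/

/-- A family of relations on closed terms, indexed by the substitutions into a context. -/
abbrev Fam (u : Bool) (d : ℕ) : Type :=
  ∀ d' : ℕ, DSub d d' → Tm u d' 0 → Tm u d' 0 → Prop

/-- Restriction of a family along a substitution. -/
def Fam.res {d d' : ℕ} (Q : Fam u d) (ψ : DSub d d') : Fam u d' := fun d'' ψ' => Q d'' (ψ.comp ψ')

/-- A family of symmetric and transitive relations. -/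
structure Fam.IsPER {d : ℕ} (Q : Fam u d) : Prop where
  symm : ∀ {d' : ℕ} {ψ : DSub d d'} {M N : Tm u d' 0}, Q d' ψ M N → Q d' ψ N M
  trans : ∀ {d' : ℕ} {ψ : DSub d d'} {M N O : Tm u d' 0}, Q d' ψ M N → Q d' ψ N O → Q d' ψ M O

/-- `M` and `N` evaluate to values related by `R`. -/
def EvR {d : ℕ} (R : Tm u d 0 → Tm u d 0 → Prop) (M N : Tm u d 0) : Prop :=
  ∃ V W, Eval M V ∧ Eval N W ∧ R V W

theorem EvR.symm {d : ℕ} {R : Tm u d 0 → Tm u d 0 → Prop} (hR : ∀ {V W}, R V W → R W V)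
    {M N : Tm u d 0} : EvR R M N → EvR R N M :=
  fun ⟨V, W, hV, hW, h⟩ => ⟨W, V, hW, hV, hR h⟩

/-- By determinism the two values of the middle term coincide. -/
theorem EvR.trans {d : ℕ} {R : Tm u d 0 → Tm u d 0 → Prop}
    (hR : ∀ {U V W}, R U V → R V W → R U W) {M N O : Tm u d 0} (h : EvR R M N) (h' : EvR R N O) :
    EvR R M O := by
  obtain ⟨V, W, hV, hW, h⟩ := h
  obtain ⟨W', U, hW', hU, h'⟩ := h'
  obtain rfl := hW.det hW'
  exact ⟨V, U, hV, hU, hR h h'⟩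

theorem EvR.steps_left {d : ℕ} {R : Tm u d 0 → Tm u d 0 → Prop} {M M' N : Tm u d 0}
    (hM : Steps M M') : EvR R M' N → EvR R M N :=
  fun ⟨V, W, hV, hW, h⟩ => ⟨V, W, hM.eval hV, hW, h⟩

theorem EvR.of_val {d : ℕ} {R : Tm u d 0 → Tm u d 0 → Prop} {V W : Tm u d 0} (hV : IsVal V)
    (hW : IsVal W) (h : R V W) : EvR R V W := ⟨V, W, hV.eval, hW.eval, h⟩

theorem EvR.rel {d : ℕ} {R : Tm u d 0 → Tm u d 0 → Prop} {M N V W : Tm u d 0} (h : EvR R M N)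
    (hV : Eval M V) (hW : Eval N W) : R V W := by
  obtain ⟨V', W', hV', hW', h⟩ := h
  rwa [hV.det hV', hW.det hW']

/-- Evaluation of `M` commutes with substitution, up to `Q`. -/
def Coh {d : ℕ} (Q : Fam u d) (M : Tm u d 0) : Prop :=
  ∀ (d₁ : ℕ) (ψ₁ : DSub d d₁), ∃ M₁, Eval (M.dsub ψ₁) M₁ ∧
    ∀ (d₂ : ℕ) (ψ₂ : DSub d₁ d₂),
      EvR (Q d₂ (ψ₁.comp ψ₂)) (M₁.dsub ψ₂) ((M.dsub ψ₁).dsub ψ₂)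

/-- All aspects of `M` and `N` are related by `Q`. -/
structure GCube {d : ℕ} (Q : Fam u d) (M N : Tm u d 0) : Prop where
  left : Coh Q M
  right : Coh Q N
  rel : ∀ {d₁ : ℕ} (ψ₁ : DSub d d₁), EvR (Q d₁ ψ₁) (M.dsub ψ₁) (N.dsub ψ₁)

theorem Coh.res {d d' : ℕ} {Q : Fam u d} {M : Tm u d 0} (h : Coh Q M) (ψ : DSub d d') :
    Coh (Q.res ψ) (M.dsub ψ) := by
  intro d₁ ψ₁
  obtain ⟨M₁, hM₁, h⟩ := h _ (ψ.comp ψ₁)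
  refine ⟨M₁, by rwa [Tm.dsub_dsub], fun d₂ ψ₂ => ?_⟩
  rw [Tm.dsub_dsub M, Fam.res, ← DSub.comp_assoc]
  exact h _ ψ₂

theorem Coh.of_val {d : ℕ} {Q : Fam u d} {M : Tm u d 0} (hM : ∀ {d'} (ψ : DSub d d'),
    IsVal (M.dsub ψ)) (h : ∀ {d'} (ψ : DSub d d'), Q d' ψ (M.dsub ψ) (M.dsub ψ)) : Coh Q M := by
  intro d₁ ψ₁
  refine ⟨_, (hM ψ₁).eval, fun d₂ ψ₂ => ?_⟩
  rw [Tm.dsub_dsub]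
  exact .of_val (hM _) (hM _) (h _)

namespace GCube

variable {d : ℕ} {Q : Fam u d} {M N O : Tm u d 0}

theorem symm (hQ : Q.IsPER) (h : GCube Q M N) : GCube Q N M :=
  ⟨h.right, h.left, fun ψ => (h.rel ψ).symm hQ.symm⟩

theorem trans (hQ : Q.IsPER) (h : GCube Q M N) (h' : GCube Q N O) : GCube Q M O :=
  ⟨h.left, h'.right, fun ψ => (h.rel ψ).trans hQ.trans (h'.rel ψ)⟩

theorem res {d' : ℕ} (h : GCube Q M N) (ψ : DSub d d') : GCube (Q.res ψ) (M.dsub ψ) (N.dsub ψ) :=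
  ⟨h.left.res ψ, h.right.res ψ, fun ψ' => by
    rw [Tm.dsub_dsub, Tm.dsub_dsub]
    exact h.rel _⟩

theorem rel_id (h : GCube Q M N) : EvR (Q d (DSub.id d)) M N := by
  simpa using h.rel (DSub.id d)

theorem of_val (hQ : Q.IsPER) (hM : ∀ {d'} (ψ : DSub d d'), IsVal (M.dsub ψ))
    (hN : ∀ {d'} (ψ : DSub d d'), IsVal (N.dsub ψ))
    (h : ∀ {d'} (ψ : DSub d d'), Q d' ψ (M.dsub ψ) (N.dsub ψ)) : GCube Q M N :=
  ⟨.of_val hM fun ψ => hQ.trans (h ψ) (hQ.symm (h ψ)),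
    .of_val hN fun ψ => hQ.trans (hQ.symm (h ψ)) (h ψ), fun ψ => .of_val (hM ψ) (hN ψ) (h ψ)⟩

/-- Coherent head expansion. -/
theorem expand (hQ : Q.IsPER) (hN : Coh Q N) (h : ∀ {d₁} (ψ₁ : DSub d d₁), ∃ m,
    Steps (M.dsub ψ₁) m ∧ GCube (Q.res ψ₁) m (N.dsub ψ₁)) : GCube Q M N := by
  have hrel : ∀ {d₁ : ℕ} (ψ₁ : DSub d d₁), EvR (Q d₁ ψ₁) (M.dsub ψ₁) (N.dsub ψ₁) := by
    intro d₁ ψ₁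
    obtain ⟨m, hm, h⟩ := h ψ₁
    have := h.rel_id
    simp only [Fam.res, DSub.comp_id] at this
    exact this.steps_left hm
  refine ⟨fun d₁ ψ₁ => ?_, hN, hrel⟩
  obtain ⟨m, hm, h⟩ := h ψ₁
  obtain ⟨M₁, hM₁, hcoh⟩ := h.left _ (DSub.id d₁)
  rw [Tm.dsub_id] at hM₁ hcoh
  -- The chain is `M₁ψ₂ ~ mψ₂ ~ Nψ₁ψ₂ ~ Mψ₁ψ₂`: coherence of `m`, the hypothesis at `ψ₁`, and
  -- relatedness at the composite substitution.
  refine ⟨M₁, hm.eval hM₁, fun d₂ ψ₂ => ?_⟩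
  refine (hcoh d₂ ψ₂).trans hQ.trans (((h.rel ψ₂)).trans hQ.trans ?_)
  rw [Tm.dsub_dsub, Tm.dsub_dsub]
  exact (hrel _).symm hQ.symm

/-- Head expansion for evaluation steps that are stable under substitution. -/
theorem of_stable (hQ : Q.IsPER) (hN : GCube Q N N)
    (h : ∀ {d₁} (ψ₁ : DSub d d₁), Steps (M.dsub ψ₁) (N.dsub ψ₁)) : GCube Q M N :=
  expand hQ hN.left fun ψ₁ => ⟨_, h ψ₁, hN.res ψ₁⟩

/-- Bridges the four-term condition of the judgments and `GCube`, in which only the last clause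
mentions both terms, and only one substitution. -/
theorem iff_rel4 (hQ : Q.IsPER) : GCube Q M N ↔
    ∀ (d₁ : ℕ) (ψ₁ : DSub d d₁) (d₂ : ℕ) (ψ₂ : DSub d₁ d₂), ∃ M₁ M₂ M₁₂ N₁ N₂ N₁₂,
      Eval (M.dsub ψ₁) M₁ ∧ Eval (M₁.dsub ψ₂) M₂ ∧ Eval ((M.dsub ψ₁).dsub ψ₂) M₁₂ ∧
      Eval (N.dsub ψ₁) N₁ ∧ Eval (N₁.dsub ψ₂) N₂ ∧ Eval ((N.dsub ψ₁).dsub ψ₂) N₁₂ ∧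
      Rel4 (Q d₂ (ψ₁.comp ψ₂)) M₂ M₁₂ N₂ N₁₂ := by
  constructor
  · intro h d₁ ψ₁ d₂ ψ₂
    obtain ⟨M₁, hM₁, hM⟩ := h.left d₁ ψ₁
    obtain ⟨N₁, hN₁, hN⟩ := h.right d₁ ψ₁
    obtain ⟨M₂, M₁₂, hM₂, hM₁₂, hMM⟩ := hM d₂ ψ₂
    obtain ⟨N₂, N₁₂, hN₂, hN₁₂, hNN⟩ := hN d₂ ψ₂
    have hMN := (h.rel (ψ₁.comp ψ₂)).rel (by rwa [Tm.dsub_dsub] at hM₁₂)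
      (by rwa [Tm.dsub_dsub] at hN₁₂)
    exact ⟨M₁, M₂, M₁₂, N₁, N₂, N₁₂, hM₁, hM₂, hM₁₂, hN₁, hN₂, hN₁₂, hMM,
      hQ.trans hMN (hQ.symm hNN), hNN⟩
  · intro h
    refine ⟨fun d₁ ψ₁ => ?_, fun d₁ ψ₁ => ?_, fun {d₁} ψ₁ => ?_⟩
    -- The condition lets `M₁` depend on `ψ₂`. Taking `ψ₂` to be the identity fixes one `M₁`, and
    -- determinism identifies it with all the others.
    · obtain ⟨M₁, _, _, _, _, _, hM₁, _⟩ := h d₁ ψ₁ d₁ (DSub.id d₁)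
      refine ⟨M₁, hM₁, fun d₂ ψ₂ => ?_⟩
      obtain ⟨M₁', M₂, M₁₂, _, _, _, hM₁', hM₂, hM₁₂, _, _, _, hR⟩ := h d₁ ψ₁ d₂ ψ₂
      obtain rfl := hM₁.det hM₁'
      exact ⟨M₂, M₁₂, hM₂, hM₁₂, hR.1⟩
    · obtain ⟨_, _, _, N₁, _, _, _, _, _, hN₁, _⟩ := h d₁ ψ₁ d₁ (DSub.id d₁)
      refine ⟨N₁, hN₁, fun d₂ ψ₂ => ?_⟩
      obtain ⟨_, _, _, N₁', N₂, N₁₂, _, _, _, hN₁', hN₂, hN₁₂, hR⟩ := h d₁ ψ₁ d₂ ψ₂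
      obtain rfl := hN₁.det hN₁'
      exact ⟨N₂, N₁₂, hN₂, hN₁₂, hR.2.2⟩
    · obtain ⟨_, _, M₁₂, _, _, N₁₂, _, _, hM, _, _, hN, hR⟩ := h d₁ ψ₁ d₁ (DSub.id d₁)
      rw [Tm.dsub_id] at hM hN
      rw [DSub.comp_id] at hR
      exact ⟨M₁₂, N₁₂, hM, hN, hQ.trans hR.2.1 hR.2.2⟩

end GCube

/-- The constant family on a ternary relation. -/
def TmRel.fam (R : TmRel u) (d : ℕ) : Fam u d := fun d' _ => R d'

theorem IsVPER.fam {R : TmRel u} (hR : IsVPER R) (d : ℕ) : (R.fam d).IsPER := ⟨hR.symm, hR.trans⟩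

theorem cube_iff {R : TmRel u} (hR : IsVPER R) {d : ℕ} {M N : Tm u d 0} :
    Cube R M N ↔ GCube (R.fam d) M N := (GCube.iff_rel4 (hR.fam d)).symm

namespace Cube

variable {R S : TmRel u} {d : ℕ} {M N O : Tm u d 0}

theorem symm (hR : IsVPER R) (h : Cube R M N) : Cube R N M :=
  (cube_iff hR).2 (((cube_iff hR).1 h).symm (hR.fam d))

theorem trans (hR : IsVPER R) (h : Cube R M N) (h' : Cube R N O) : Cube R M O :=
  (cube_iff hR).2 (((cube_iff hR).1 h).trans (hR.fam d) ((cube_iff hR).1 h'))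

theorem dsub (h : Cube R M N) {d' : ℕ} (ψ : DSub d d') : Cube R (M.dsub ψ) (N.dsub ψ) := by
  intro d₁ ψ₁ d₂ ψ₂
  rw [Tm.dsub_dsub M, Tm.dsub_dsub N]
  exact h _ _ _ _

theorem mono (hRS : ∀ d M N, R d M N → S d M N) (h : Cube R M N) : Cube S M N := by
  intro d₁ ψ₁ d₂ ψ₂
  obtain ⟨M₁, M₂, M₁₂, N₁, N₂, N₁₂, h₁, h₂, h₃, h₄, h₅, h₆, h₇, h₈, h₉⟩ := h d₁ ψ₁ d₂ ψ₂
  exact ⟨M₁, M₂, M₁₂, N₁, N₂, N₁₂, h₁, h₂, h₃, h₄, h₅, h₆, hRS _ _ _ h₇, hRS _ _ _ h₈,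
    hRS _ _ _ h₉⟩

/-- Relatedness in a larger relation of an element of a smaller one holds in the smaller one. -/
theorem of_approx (hR : IsVPER R) (hRS : R.Approx S) (hM : Cube R M M)
    (h : Cube S M N) : Cube R M N := by
  intro d₁ ψ₁ d₂ ψ₂
  obtain ⟨M₁, M₂, M₁₂, _, _, _, h₁, h₂, h₃, _, _, _, h₇, _, _⟩ := hM d₁ ψ₁ d₂ ψ₂
  obtain ⟨M₁', M₂', M₁₂', N₁, N₂, N₁₂, h₁', h₂', h₃', h₄, h₅, h₆, _, h₈, h₉⟩ := h d₁ ψ₁ d₂ ψ₂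
  obtain rfl := h₁.det h₁'
  obtain rfl := h₂.det h₂'
  obtain rfl := h₃.det h₃'
  -- The chain is pulled back link by link: `M₁₂` is in the field of `R`, so its `S`-link to `N₂` is
  -- an `R`-link, which puts `N₂` in the field in turn.
  have h₈' := (hRS.2 _ _ (hR.trans (hR.symm h₇) h₇) _).2 h₈
  exact ⟨M₁, M₂, M₁₂, N₁, N₂, N₁₂, h₁, h₂, h₃, h₄, h₅, h₆, h₇, h₈',
    (hRS.2 _ _ (hR.trans (hR.symm h₈') h₈') _).2 h₉⟩

end Cube

/-! ## Equality of elements -/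

/-- The canonical elements of a pretype. -/
def tyFam (X : PreCTS u) {d : ℕ} (A : Tm u d 0) : Fam u d :=
  fun d' ψ V W => ∃ A₀, Eval (A.dsub ψ) A₀ ∧ X.Φ d' A₀ V W

theorem tyFam_res (X : PreCTS u) {d d' : ℕ} (A : Tm u d 0) (ψ : DSub d d') :
    (tyFam X A).res ψ = tyFam X (A.dsub ψ) := by
  funext _ φ V W
  simp only [Fam.res, tyFam, Tm.dsub_dsub]

theorem IsCTS.tyFam {X : PreCTS u} (hX : IsCTS X) {d : ℕ} (A : Tm u d 0) :
    (tyFam X A).IsPER where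
  symm := fun ⟨A₀, hA, h⟩ => ⟨A₀, hA, hX.symm h⟩
  trans := fun ⟨A₀, hA, h⟩ ⟨_, hA₁, h₁⟩ =>
    ⟨A₀, hA, hX.trans h (hA.det hA₁ ▸ h₁)⟩

variable {X Y : PreCTS u}

/-- The value of the type is unique, so one choice for all three links is the same as a separate
choice for each, as `tyFam` makes it. -/
theorem tmEq_iff (hX : IsCTS X) {d : ℕ} {M N A : Tm u d 0} :
    TmEq X M N A ↔ PreTyEq X A A ∧ GCube (tyFam X A) M N := by
  rw [GCube.iff_rel4 (hX.tyFam A)]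
  refine and_congr_right fun _ => forall_congr' fun d₁ => forall_congr' fun ψ₁ =>
    forall_congr' fun d₂ => forall_congr' fun ψ₂ => ⟨?_, ?_⟩
  · rintro ⟨M₁, M₂, M₁₂, N₁, N₂, N₁₂, A₁₂, h₁, h₂, h₃, h₄, h₅, h₆, h₀, h₇, h₈, h₉⟩
    rw [Tm.dsub_dsub A] at h₀
    exact ⟨M₁, M₂, M₁₂, N₁, N₂, N₁₂, h₁, h₂, h₃, h₄, h₅, h₆, ⟨_, h₀, h₇⟩, ⟨_, h₀, h₈⟩,
      ⟨_, h₀, h₉⟩⟩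
  · rintro ⟨M₁, M₂, M₁₂, N₁, N₂, N₁₂, h₁, h₂, h₃, h₄, h₅, h₆, ⟨A₀, h₀, h₇⟩, ⟨A₁, hA₁, h₈⟩,
      ⟨A₂, hA₂, h₉⟩⟩
    rw [← Tm.dsub_dsub A] at h₀ hA₁ hA₂
    obtain rfl := h₀.det hA₁
    obtain rfl := h₀.det hA₂
    exact ⟨M₁, M₂, M₁₂, N₁, N₂, N₁₂, A₀, h₁, h₂, h₃, h₄, h₅, h₆, h₀, h₇, h₈, h₉⟩

namespace PreTyEq

variable {d : ℕ} {A B C : Tm u d 0}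

theorem symm (hX : IsCTS X) (h : PreTyEq X A B) : PreTyEq X B A := Cube.symm hX.E_vper h

theorem trans (hX : IsCTS X) (h : PreTyEq X A B) (h' : PreTyEq X B C) : PreTyEq X A C :=
  Cube.trans hX.E_vper h h'

theorem left (hX : IsCTS X) (h : PreTyEq X A B) : PreTyEq X A A := h.trans hX (h.symm hX)

theorem right (hX : IsCTS X) (h : PreTyEq X A B) : PreTyEq X B B := (h.symm hX).left hX

theorem dsub (h : PreTyEq X A B) {d' : ℕ} (ψ : DSub d d') : PreTyEq X (A.dsub ψ) (B.dsub ψ) :=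
  Cube.dsub h ψ

theorem gcube (hX : IsCTS X) (h : PreTyEq X A B) : GCube (X.E.fam d) A B :=
  (cube_iff hX.E_vper).1 h

/-- At each substitution the two types evaluate to related canonical types, and these carry the same
elements by `IsCTS.resp`. This is the source of all conversions. -/
theorem tyFam_eq (hX : IsCTS X) (h : PreTyEq X A B) : tyFam X A = tyFam X B := by
  funext d' ψ V W
  obtain ⟨A₀, B₀, hA, hB, hE⟩ := (h.gcube hX).rel ψ
  exact propext ⟨fun ⟨A₁, hA₁, h₁⟩ => ⟨B₀, hB, (hX.resp hE V W).1 (hA₁.det hA ▸ h₁)⟩,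
    fun ⟨B₁, hB₁, h₁⟩ => ⟨A₀, hA, (hX.resp hE V W).2 (hB₁.det hB ▸ h₁)⟩⟩

end PreTyEq

namespace TmEq

variable {d : ℕ} {A B M N O : Tm u d 0}

theorem gcube (hX : IsCTS X) (h : TmEq X M N A) : GCube (tyFam X A) M N := ((tmEq_iff hX).1 h).2

theorem symm (hX : IsCTS X) (h : TmEq X M N A) : TmEq X N M A :=
  (tmEq_iff hX).2 ⟨h.1, (h.gcube hX).symm (hX.tyFam A)⟩

theorem trans (hX : IsCTS X) (h : TmEq X M N A) (h' : TmEq X N O A) : TmEq X M O A :=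
  (tmEq_iff hX).2 ⟨h.1, (h.gcube hX).trans (hX.tyFam A) (h'.gcube hX)⟩

theorem left (hX : IsCTS X) (h : TmEq X M N A) : TmEq X M M A := h.trans hX (h.symm hX)

theorem right (hX : IsCTS X) (h : TmEq X M N A) : TmEq X N N A := (h.symm hX).left hX

theorem dsub (h : TmEq X M N A) {d' : ℕ} (ψ : DSub d d') :
    TmEq X (M.dsub ψ) (N.dsub ψ) (A.dsub ψ) := by
  refine ⟨h.1.dsub ψ, fun d₁ ψ₁ d₂ ψ₂ => ?_⟩
  rw [Tm.dsub_dsub M, Tm.dsub_dsub N, Tm.dsub_dsub A]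
  exact h.2 _ _ _ _

theorem conv (hX : IsCTS X) (hAB : PreTyEq X A B) (h : TmEq X M N A) : TmEq X M N B :=
  (tmEq_iff hX).2 ⟨hAB.right hX, hAB.tyFam_eq hX ▸ h.gcube hX⟩

/-- Head expansion for evaluation steps that are stable under substitution. -/
theorem of_stable (hX : IsCTS X) (hN : TmEq X N N A)
    (h : ∀ {d₁} (ψ₁ : DSub d d₁), Steps (M.dsub ψ₁) (N.dsub ψ₁)) : TmEq X M N A :=
  (tmEq_iff hX).2 ⟨hN.1, .of_stable (hX.tyFam A) (hN.gcube hX) h⟩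

theorem expand (hX : IsCTS X) (hN : TmEq X N N A) (h : ∀ {d₁} (ψ₁ : DSub d d₁), ∃ m,
    Steps (M.dsub ψ₁) m ∧ TmEq X m (N.dsub ψ₁) (A.dsub ψ₁)) : TmEq X M N A := by
  refine (tmEq_iff hX).2 ⟨hN.1, .expand (hX.tyFam A) (hN.gcube hX).left fun ψ₁ => ?_⟩
  obtain ⟨m, hm, h⟩ := h ψ₁
  exact ⟨m, hm, tyFam_res X A ψ₁ ▸ h.gcube hX⟩

end TmEq

end CubicalTT

namespace CubicalTT

variable {u : Bool} {X Y : PreCTS u}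

/-! ## Composition problems -/

/-- A family of relations that is closed under substitution. -/
def Fam.Stable {d : ℕ} (J : Fam u d) : Prop :=
  ∀ ⦃d' d'' : ℕ⦄ ⦃ψ : DSub d d'⦄ ⦃M N : Tm u d' 0⦄ (ψ' : DSub d' d''), J d' ψ M N →
    J d'' (ψ.comp ψ') (M.dsub ψ') (N.dsub ψ')

/-- Equality of elements of the instances of a pretype. -/
def tmFam (X : PreCTS u) {d : ℕ} (A : Tm u d 0) : Fam u d := fun _ ψ M N => TmEq X M N (A.dsub ψ)

theorem tmFam_isPER (hX : IsCTS X) {d : ℕ} (A : Tm u d 0) : (tmFam X A).IsPER :=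
  ⟨TmEq.symm hX, TmEq.trans hX⟩

theorem tmFam_stable {d : ℕ} (A : Tm u d 0) : (tmFam X A).Stable := by
  intro d' d'' ψ M N ψ' h
  have := h.dsub ψ'
  rwa [Tm.dsub_dsub A] at this

theorem tmFam_res {d d' : ℕ} (A : Tm u d 0) (ψ : DSub d d') :
    (tmFam X A).res ψ = tmFam X (A.dsub ψ) := by
  funext _ φ V W
  simp only [Fam.res, tmFam, Tm.dsub_dsub]

/-- The relations `R^□`, as a family. -/
def cubeFam (R : TmRel u) (d : ℕ) : Fam u d := fun _ _ M N => Cube R M N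

theorem cubeFam_isPER {R : TmRel u} (hR : IsVPER R) (d : ℕ) : (cubeFam R d).IsPER :=
  ⟨Cube.symm hR, Cube.trans hR⟩

theorem cubeFam_stable {R : TmRel u} (d : ℕ) : (cubeFam R d).Stable :=
  fun _ _ _ _ _ ψ' h => h.dsub ψ'

/-- Two equal composition problems with respect to the family `J`. -/
structure KanPrem {d k : ℕ} (J : Fam u d) (rs : Fin (k + 1) → Dim d) (r : Dim d)
    (M O : Tm u d 0) (N P : Fin (k + 1) → Bool → Tm u (d + 1) 0) : Prop where
  cap : J d (DSub.id d) M O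
  adj : ∀ i j ε ε' (d' : ℕ) (ψ : DSub (d + 1) d'),
    Sat [((rs i).wk, .const ε), ((rs j).wk, .const ε')] ψ →
    J d' ((DSub.wk d).comp ψ) ((N i ε).dsub ψ) ((N j ε').dsub ψ)
  tube : ∀ i ε (d' : ℕ) (ψ : DSub (d + 1) d'), Sat [((rs i).wk, .const ε)] ψ →
    J d' ((DSub.wk d).comp ψ) ((N i ε).dsub ψ) ((P i ε).dsub ψ)
  start : ∀ i ε (d' : ℕ) (ψ : DSub d d'), Sat [(rs i, .const ε)] ψ →
    J d' ψ (((N i ε).inst r).dsub ψ) (M.dsub ψ)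

theorem sat_singleton {d d' : ℕ} {r : Dim d} {ε : Bool} {ψ : DSub d d'} :
    Sat [(r, .const ε)] ψ ↔ r.dsub ψ = .const ε := by simp [Sat, Dim.dsub]

theorem sat_pair {d d' : ℕ} {r s : Dim d} {ε ε' : Bool} {ψ : DSub d d'} :
    Sat [(r, .const ε), (s, .const ε')] ψ ↔ r.dsub ψ = .const ε ∧ s.dsub ψ = .const ε' := by
  simp [Sat, Dim.dsub]

namespace KanPrem

variable {d k : ℕ} {J : Fam u d} {rs : Fin (k + 1) → Dim d} {r : Dim d} {M O Q : Tm u d 0}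
  {N P S : Fin (k + 1) → Bool → Tm u (d + 1) 0}

/-- The instance of a tube at an endpoint. -/
theorem tube_inst (h : KanPrem J rs r M O N P) (s : Dim d) (i ε) {d' : ℕ} (ψ : DSub d d')
    (hi : (rs i).dsub ψ = .const ε) :
    J d' ψ (((N i ε).inst s).dsub ψ) (((P i ε).inst s).dsub ψ) := by
  have := h.tube i ε d' ((DSub.inst s).comp ψ) (by
    rw [sat_singleton, ← Dim.dsub_dsub, Dim.wk_dsub_inst, hi])
  rwa [← DSub.comp_assoc, DSub.wk_comp_inst, DSub.id_comp, ← Tm.dsub_dsub, ← Tm.dsub_dsub] at this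

theorem adj_inst (h : KanPrem J rs r M O N P) (s : Dim d) (i j ε ε') {d' : ℕ} (ψ : DSub d d')
    (hi : (rs i).dsub ψ = .const ε) (hj : (rs j).dsub ψ = .const ε') :
    J d' ψ (((N i ε).inst s).dsub ψ) (((N j ε').inst s).dsub ψ) := by
  have := h.adj i j ε ε' d' ((DSub.inst s).comp ψ) (by
    rw [sat_pair, ← Dim.dsub_dsub, Dim.wk_dsub_inst, hi, ← Dim.dsub_dsub, Dim.wk_dsub_inst, hj]
    exact ⟨rfl, rfl⟩)
  rwa [← DSub.comp_assoc, DSub.wk_comp_inst, DSub.id_comp, ← Tm.dsub_dsub, ← Tm.dsub_dsub] at this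

/-- The adjacency and start conditions are required of `M`, `N` only. For `O`, `P` they follow along
the equalities of tubes and caps. -/
theorem symm (hJ : J.IsPER) (hJ' : J.Stable) (h : KanPrem J rs r M O N P) :
    KanPrem J rs r O M P N where
  cap := hJ.symm h.cap
  adj i j ε ε' d' ψ hψ := by
    have hψ' := sat_pair.1 hψ
    exact hJ.trans (hJ.symm (h.tube i ε d' ψ (sat_singleton.2 hψ'.1)))
      (hJ.trans (h.adj i j ε ε' d' ψ hψ) (h.tube j ε' d' ψ (sat_singleton.2 hψ'.2)))
  tube i ε d' ψ hψ := hJ.symm (h.tube i ε d' ψ hψ)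
  start i ε d' ψ hψ := hJ.trans (hJ.symm (h.tube_inst r i ε ψ (sat_singleton.1 hψ)))
    (hJ.trans (h.start i ε d' ψ hψ) (hJ' ψ h.cap))

theorem trans (hJ : J.IsPER) (h : KanPrem J rs r M O N P) (h' : KanPrem J rs r O Q P S) :
    KanPrem J rs r M Q N S where
  cap := hJ.trans h.cap h'.cap
  adj := h.adj
  tube i ε d' ψ hψ := hJ.trans (h.tube i ε d' ψ hψ) (h'.tube i ε d' ψ hψ)
  start := h.start

theorem left (hJ : J.IsPER) (hJ' : J.Stable) (h : KanPrem J rs r M O N P) :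
    KanPrem J rs r M M N N := h.trans hJ (h.symm hJ hJ')

theorem mono {J' : Fam u d} (h : KanPrem J rs r M O N P)
    (hJ : ∀ (d' : ℕ) (ψ : DSub d d') (M N : Tm u d' 0), J d' ψ M N → J' d' ψ M N) :
    KanPrem J' rs r M O N P where
  cap := hJ _ _ _ _ h.cap
  adj i j ε ε' d' ψ hψ := hJ _ _ _ _ (h.adj i j ε ε' d' ψ hψ)
  tube i ε d' ψ hψ := hJ _ _ _ _ (h.tube i ε d' ψ hψ)
  start i ε d' ψ hψ := hJ _ _ _ _ (h.start i ε d' ψ hψ)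

/-- The tube equality `N_i^ε ≐ N_i^ε` is the diagonal case of adjacency. -/
theorem of_start (hcap : J d (DSub.id d) M M)
    (adj : ∀ i j ε ε' (d' : ℕ) (ψ : DSub (d + 1) d'),
      Sat [((rs i).wk, .const ε), ((rs j).wk, .const ε')] ψ →
      J d' ((DSub.wk d).comp ψ) ((N i ε).dsub ψ) ((N j ε').dsub ψ))
    (start : ∀ i ε (d' : ℕ) (ψ : DSub d d'), Sat [(rs i, .const ε)] ψ →
      J d' ψ (((N i ε).inst r).dsub ψ) (M.dsub ψ)) : KanPrem J rs r M M N N where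
  cap := hcap
  adj := adj
  tube i ε d' ψ hψ := adj i i ε ε d' ψ (sat_pair.2 ⟨sat_singleton.1 hψ, sat_singleton.1 hψ⟩)
  start := start

/-- Stability of `J` serves only the cap; the tube conditions already quantify over all
substitutions. -/
theorem dsub (hJ' : J.Stable) (h : KanPrem J rs r M O N P) {d₁ : ℕ} (ψ : DSub d d₁) :
    KanPrem (J.res ψ) (fun i => (rs i).dsub ψ) (r.dsub ψ) (M.dsub ψ) (O.dsub ψ)
      (fun i ε => (N i ε).dsub ψ.lift) (fun i ε => (P i ε).dsub ψ.lift) where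
  cap := by
    have := hJ' ψ h.cap
    rw [DSub.id_comp] at this
    simpa only [Fam.res, DSub.comp_id] using this
  adj i j ε ε' d' φ hφ := by
    have := h.adj i j ε ε' d' (ψ.lift.comp φ) (by
      simpa only [sat_pair, ← Dim.dsub_dsub, Dim.wk_dsub_lift] using sat_pair.1 hφ)
    rwa [← DSub.comp_assoc, DSub.wk_comp_lift, DSub.comp_assoc, ← Tm.dsub_dsub,
      ← Tm.dsub_dsub] at this
  tube i ε d' φ hφ := by
    have := h.tube i ε d' (ψ.lift.comp φ) (by
      simpa only [sat_singleton, ← Dim.dsub_dsub, Dim.wk_dsub_lift] using sat_singleton.1 hφ)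
    rwa [← DSub.comp_assoc, DSub.wk_comp_lift, DSub.comp_assoc, ← Tm.dsub_dsub,
      ← Tm.dsub_dsub] at this
  start i ε d' φ hφ := by
    have := h.start i ε d' (ψ.comp φ) (by
      simpa only [sat_singleton, ← Dim.dsub_dsub] using sat_singleton.1 hφ)
    rwa [← Tm.dsub_dsub, ← Tm.dsub_dsub, Tm.inst_dsub] at this

end KanPrem

/-- Tubes live over `(Ψ, y)` in the weakening of `A`, whose instance at `ψ` is the instance of `A`
at the composite with weakening. -/
theorem tmEqRes_dwk_iff {d : ℕ} {A : Tm u d 0} {M N : Tm u (d + 1) 0} {Ξ : Eqns (d + 1)} :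
    TmEqRes X Ξ M N A.dwk ↔ ∀ (d' : ℕ) (ψ : DSub (d + 1) d'), Sat Ξ ψ →
      tmFam X A d' ((DSub.wk d).comp ψ) (M.dsub ψ) (N.dsub ψ) := by
  simp only [TmEqRes, tmFam, Tm.dwk, Tm.dsub_dsub]

theorem kanPrem_iff {d k : ℕ} {A : Tm u d 0} {rs : Fin (k + 1) → Dim d} {r : Dim d}
    {M O : Tm u d 0} {N P : Fin (k + 1) → Bool → Tm u (d + 1) 0} :
    KanPrem (tmFam X A) rs r M O N P ↔
      TmEq X M O A ∧ TubeAdj X rs N A ∧ TubeEq X rs N P A ∧ TubeStart X rs r N M A := by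
  constructor
  · intro h
    refine ⟨by simpa [tmFam] using h.cap, fun i j ε ε' => tmEqRes_dwk_iff.2 (h.adj i j ε ε'),
      fun i ε => tmEqRes_dwk_iff.2 (h.tube i ε), h.start⟩
  · rintro ⟨h₁, h₂, h₃, h₄⟩
    exact ⟨by simpa [tmFam] using h₁, fun i j ε ε' => tmEqRes_dwk_iff.1 (h₂ i j ε ε'),
      fun i ε => tmEqRes_dwk_iff.1 (h₃ i ε), h₄⟩

theorem hcomPremises_iff {R : TmRel u} {d k : ℕ} {rs : Fin (k + 1) → Dim d} {r r' : Dim d}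
    {M O : Tm u d 0} {N P : Fin (k + 1) → Bool → Tm u (d + 1) 0} :
    HcomPremises R rs r r' M O N P ↔
      (∀ i, (rs i).IsName) ∧ r ≠ r' ∧ KanPrem (cubeFam R d) rs r M O N P :=
  ⟨fun h => ⟨h.names, h.ne, h.cap, h.adj, h.tube, h.start⟩,
    fun ⟨h₁, h₂, h⟩ => ⟨h₁, h₂, h.cap, h.adj, h.tube, h.start⟩⟩

/-! ## Kan types -/

namespace EquallyKan

variable {d : ℕ} {A B C : Tm u d 0}

theorem hcom (h : EquallyKan X A B) {d' k : ℕ} (ψ : DSub d d') {rs : Fin (k + 1) → Dim d'}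
    {r : Dim d'} (r' : Dim d') {M O : Tm u d' 0} {N P : Fin (k + 1) → Bool → Tm u (d' + 1) 0}
    (hp : KanPrem (tmFam X (A.dsub ψ)) rs r M O N P) :
    TmEq X (.hcom k rs (A.dsub ψ) r r' M N) (.hcom k rs (B.dsub ψ) r r' O P) (A.dsub ψ) :=
  have hp := kanPrem_iff.1 hp
  h.hcom_eq _ ψ k rs r r' M O N P hp.1 hp.2.1 hp.2.2.1 hp.2.2.2

theorem cap (h : EquallyKan X A B) {d' k : ℕ} (ψ : DSub d d') {rs : Fin (k + 1) → Dim d'}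
    {r : Dim d'} {M : Tm u d' 0} {N : Fin (k + 1) → Bool → Tm u (d' + 1) 0}
    (hp : KanPrem (tmFam X (A.dsub ψ)) rs r M M N N) :
    TmEq X (.hcom k rs (A.dsub ψ) r r M N) M (A.dsub ψ) :=
  have hp := kanPrem_iff.1 hp
  h.hcom_cap _ ψ k rs r M N hp.1 hp.2.1 hp.2.2.2

theorem tube (h : EquallyKan X A B) {d' k : ℕ} (ψ : DSub d d') {rs : Fin (k + 1) → Dim d'}
    {r : Dim d'} (r' : Dim d') {M : Tm u d' 0} {N : Fin (k + 1) → Bool → Tm u (d' + 1) 0}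
    (hp : KanPrem (tmFam X (A.dsub ψ)) rs r M M N N) {i ε} (hi : rs i = .const ε) :
    TmEq X (.hcom k rs (A.dsub ψ) r r' M N) ((N i ε).inst r') (A.dsub ψ) :=
  have hp := kanPrem_iff.1 hp
  h.hcom_tube _ ψ k rs r r' M N hp.1 hp.2.1 hp.2.2.2 i ε hi

/-- Allows all three composition conditions to be checked against a single notion of composition
problem, reflexive ones for the cap and the tubes. -/
theorem mk'
    (hcom : ∀ (d' : ℕ) (ψ : DSub d d') (k : ℕ) (rs : Fin (k + 1) → Dim d') (r r' : Dim d')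
      (M O : Tm u d' 0) (N P : Fin (k + 1) → Bool → Tm u (d' + 1) 0),
      KanPrem (tmFam X (A.dsub ψ)) rs r M O N P →
      TmEq X (.hcom k rs (A.dsub ψ) r r' M N) (.hcom k rs (B.dsub ψ) r r' O P) (A.dsub ψ))
    (cap : ∀ (d' : ℕ) (ψ : DSub d d') (k : ℕ) (rs : Fin (k + 1) → Dim d') (r : Dim d')
      (M : Tm u d' 0) (N : Fin (k + 1) → Bool → Tm u (d' + 1) 0),
      KanPrem (tmFam X (A.dsub ψ)) rs r M M N N →
      TmEq X (.hcom k rs (A.dsub ψ) r r M N) M (A.dsub ψ))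
    (tube : ∀ (d' : ℕ) (ψ : DSub d d') (k : ℕ) (rs : Fin (k + 1) → Dim d') (r r' : Dim d')
      (M : Tm u d' 0) (N : Fin (k + 1) → Bool → Tm u (d' + 1) 0),
      KanPrem (tmFam X (A.dsub ψ)) rs r M M N N → ∀ i ε, rs i = .const ε →
      TmEq X (.hcom k rs (A.dsub ψ) r r' M N) ((N i ε).inst r') (A.dsub ψ))
    (coe : ∀ (d' : ℕ) (ψ : DSub d (d' + 1)) (r r' : Dim d') (M N : Tm u d' 0),
      TmEq X M N ((A.dsub ψ).inst r) →
      TmEq X (.coe (A.dsub ψ) r r' M) (.coe (B.dsub ψ) r r' N) ((A.dsub ψ).inst r'))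
    (coe_same : ∀ (d' : ℕ) (ψ : DSub d (d' + 1)) (r : Dim d') (M : Tm u d' 0),
      TmEq X M M ((A.dsub ψ).inst r) →
      TmEq X (.coe (A.dsub ψ) r r M) M ((A.dsub ψ).inst r)) : EquallyKan X A B := by
  have key : ∀ {d' k : ℕ} {ψ : DSub d d'} {rs : Fin (k + 1) → Dim d'} {r : Dim d'}
      {M : Tm u d' 0} {N : Fin (k + 1) → Bool → Tm u (d' + 1) 0}, TmEq X M M (A.dsub ψ) →
      TubeAdj X rs N (A.dsub ψ) → TubeStart X rs r N M (A.dsub ψ) →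
      KanPrem (tmFam X (A.dsub ψ)) rs r M M N N := fun h₁ h₂ h₃ =>
    .of_start (by simpa [tmFam] using h₁) (fun i j ε ε' => tmEqRes_dwk_iff.1 (h₂ i j ε ε')) h₃
  exact
    { hcom_eq := fun d' ψ k rs r r' M O N P h₁ h₂ h₃ h₄ =>
        hcom d' ψ k rs r r' M O N P (kanPrem_iff.2 ⟨h₁, h₂, h₃, h₄⟩)
      hcom_cap := fun d' ψ k rs r M N h₁ h₂ h₃ => cap d' ψ k rs r M N (key h₁ h₂ h₃)
      hcom_tube := fun d' ψ k rs r r' M N h₁ h₂ h₃ =>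
        tube d' ψ k rs r r' M N (key h₁ h₂ h₃)
      coe_eq := coe
      coe_same := coe_same }

theorem dsub (h : EquallyKan X A B) {d' : ℕ} (ψ : DSub d d') :
    EquallyKan X (A.dsub ψ) (B.dsub ψ) := by
  constructor <;> simp only [Tm.dsub_dsub A, Tm.dsub_dsub B]
  · exact fun _ _ => h.hcom_eq _ _
  · exact fun _ _ => h.hcom_cap _ _
  · exact fun _ _ => h.hcom_tube _ _
  · exact fun _ _ => h.coe_eq _ _
  · exact fun _ _ => h.coe_same _ _

theorem symm (hX : IsCTS X) (hAB : PreTyEq X A B) (h : EquallyKan X A B) : EquallyKan X B A := by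
  have hfam : ∀ {d'} (ψ : DSub d d'), tmFam X (B.dsub ψ) = tmFam X (A.dsub ψ) := by
    intro d' ψ
    funext d'' φ M N
    exact propext ⟨TmEq.conv hX (((hAB.dsub ψ).dsub φ).symm hX),
      TmEq.conv hX ((hAB.dsub ψ).dsub φ)⟩
  have hinst : ∀ {d'} (ψ : DSub d (d' + 1)) (r : Dim d'),
      PreTyEq X ((B.dsub ψ).inst r) ((A.dsub ψ).inst r) :=
    fun ψ r => ((hAB.dsub ψ).dsub _).symm hX
  -- Compositions in `A` and in `B` agree on a reflexive problem, so the cap and tube equations of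
  -- `A` carry over to `B`.
  have hflip : ∀ {d' k : ℕ} (ψ : DSub d d') {rs : Fin (k + 1) → Dim d'} {r : Dim d'} (r' : Dim d')
      {M : Tm u d' 0} {N : Fin (k + 1) → Bool → Tm u (d' + 1) 0},
      KanPrem (tmFam X (A.dsub ψ)) rs r M M N N →
      TmEq X (.hcom k rs (B.dsub ψ) r r' M N) (.hcom k rs (A.dsub ψ) r r' M N) (A.dsub ψ) :=
    fun ψ _ _ r' _ _ hp => (h.hcom ψ r' hp).symm hX
  refine mk' ?_ ?_ ?_ ?_ ?_
  · intro d' ψ k rs r r' M O N P hp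
    rw [hfam] at hp
    exact ((h.hcom ψ r' (hp.symm (tmFam_isPER hX _) (tmFam_stable _))).symm hX).conv hX (hAB.dsub ψ)
  · intro d' ψ k rs r M N hp
    rw [hfam] at hp
    exact ((hflip ψ r hp).trans hX (h.cap ψ hp)).conv hX (hAB.dsub ψ)
  · intro d' ψ k rs r r' M N hp i ε hi
    rw [hfam] at hp
    exact ((hflip ψ r' hp).trans hX (h.tube ψ r' hp hi)).conv hX (hAB.dsub ψ)
  · intro d' ψ r r' M N hM
    exact ((h.coe_eq d' ψ r r' N M ((hM.conv hX (hinst ψ r)).symm hX)).symm hX).conv hX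
      ((hinst ψ r').symm hX)
  · intro d' ψ r M hM
    have hM := hM.conv hX (hinst ψ r)
    exact (((h.coe_eq d' ψ r r M M hM).symm hX).trans hX (h.coe_same d' ψ r M hM)).conv hX
      ((hinst ψ r).symm hX)

/-- The cap, tube and trivial coercion conditions mention the first type alone and come from `h`.
The other two are chained through `B`. -/
theorem trans (hX : IsCTS X) (hAB : PreTyEq X A B) (h : EquallyKan X A B)
    (h' : EquallyKan X B C) : EquallyKan X A C := by
  have hfam : ∀ {d'} (ψ : DSub d d'), tmFam X (A.dsub ψ) = tmFam X (B.dsub ψ) := by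
    intro d' ψ
    funext d'' φ M N
    exact propext ⟨TmEq.conv hX ((hAB.dsub ψ).dsub φ),
      TmEq.conv hX (((hAB.dsub ψ).dsub φ).symm hX)⟩
  refine mk' ?_ (fun d' ψ k rs r M N hp => h.cap ψ hp)
    (fun d' ψ k rs r r' M N hp i ε hi => h.tube ψ r' hp hi) ?_ h.coe_same
  · intro d' ψ k rs r r' M O N P hp
    have hp' := (hp.symm (tmFam_isPER hX _) (tmFam_stable _)).left (tmFam_isPER hX _)
      (tmFam_stable _)
    refine (h.hcom ψ r' hp).trans hX ((h'.hcom ψ r' ?_).conv hX ((hAB.dsub ψ).symm hX))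
    rwa [← hfam]
  · intro d' ψ r r' M N hM
    exact (h.coe_eq d' ψ r r' M N hM).trans hX ((h'.coe_eq d' ψ r r' N N
      ((hM.right hX).conv hX ((hAB.dsub ψ).dsub _))).conv hX (((hAB.dsub ψ).dsub _).symm hX))

/-- Being equally Kan depends only on equality of elements of the instances of the first type. -/
theorem congr (h : EquallyKan X A B) (hXY : ∀ {d' : ℕ} (ψ : DSub d d') (M N : Tm u d' 0),
    TmEq X M N (A.dsub ψ) ↔ TmEq Y M N (A.dsub ψ)) : EquallyKan Y A B := by
  have hfam : ∀ {d'} (ψ : DSub d d'), tmFam Y (A.dsub ψ) = tmFam X (A.dsub ψ) := by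
    intro d' ψ
    funext d'' φ M N
    simp only [tmFam, Tm.dsub_dsub, hXY]
  refine mk' ?_ ?_ ?_ ?_ ?_
  · intro d' ψ k rs r r' M O N P hp
    exact (hXY _ _ _).1 (h.hcom ψ r' (hfam ψ ▸ hp))
  · intro d' ψ k rs r M N hp
    exact (hXY _ _ _).1 (h.cap ψ (hfam ψ ▸ hp))
  · intro d' ψ k rs r r' M N hp i ε hi
    exact (hXY _ _ _).1 (h.tube ψ r' (hfam ψ ▸ hp) hi)
  · intro d' ψ r r' M N
    have := h.coe_eq d' ψ r r' M N
    simpa only [Tm.inst, Tm.dsub_dsub A, hXY] using this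
  · intro d' ψ r M
    have := h.coe_same d' ψ r M
    simpa only [Tm.inst, Tm.dsub_dsub A, hXY] using this

end EquallyKan

namespace TyEq

variable {d : ℕ} {A B C : Tm u d 0}

theorem symm (hX : IsCTS X) (h : TyEq X A B) : TyEq X B A :=
  ⟨h.1.symm hX, h.2.2.1, h.2.1, h.2.2.2.symm hX h.1⟩

theorem trans (hX : IsCTS X) (h : TyEq X A B) (h' : TyEq X B C) : TyEq X A C :=
  ⟨h.1.trans hX h'.1, h.2.1, h'.2.2.1, h.2.2.2.trans hX h.1 h'.2.2.2⟩

theorem left (hX : IsCTS X) (h : TyEq X A B) : TyEq X A A := h.trans hX (h.symm hX)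

theorem right (hX : IsCTS X) (h : TyEq X A B) : TyEq X B B := (h.symm hX).left hX

end TyEq

theorem Cubical.dsub {d : ℕ} {A : Tm u d 0} (h : Cubical X A) {d' : ℕ} (ψ : DSub d d') :
    Cubical X (A.dsub ψ) := by
  intro d'' φ
  rw [Tm.dsub_dsub]
  exact h _ _

theorem TyEq.dsub {d : ℕ} {A B : Tm u d 0} (h : TyEq X A B) {d' : ℕ} (ψ : DSub d d') :
    TyEq X (A.dsub ψ) (B.dsub ψ) :=
  ⟨h.1.dsub ψ, h.2.1.dsub ψ, h.2.2.1.dsub ψ, h.2.2.2.dsub ψ⟩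

/-! ## Open judgments -/

theorem OpenPreTyEq.dsub {d : ℕ} {A : Tm u d 0} {B B' : Tm u d 1} (h : OpenPreTyEq X A B B')
    {d' : ℕ} (ψ : DSub d d') : OpenPreTyEq X (A.dsub ψ) (B.dsub ψ) (B'.dsub ψ) := by
  refine ⟨h.1.dsub ψ, fun d'' φ N N' hN => ?_⟩
  rw [Tm.dsub_dsub] at hN ⊢
  rw [Tm.dsub_dsub]
  exact h.2 _ _ _ _ hN

theorem OpenTyEq.dsub {d : ℕ} {A : Tm u d 0} {B B' : Tm u d 1} (h : OpenTyEq X A B B')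
    {d' : ℕ} (ψ : DSub d d') : OpenTyEq X (A.dsub ψ) (B.dsub ψ) (B'.dsub ψ) := by
  refine ⟨h.1.dsub ψ, fun d'' φ N N' hN => ?_⟩
  rw [Tm.dsub_dsub] at hN ⊢
  rw [Tm.dsub_dsub]
  exact h.2 _ _ _ _ hN

theorem OpenTmEq.dsub {d : ℕ} {A : Tm u d 0} {M M' B : Tm u d 1} (h : OpenTmEq X A M M' B)
    {d' : ℕ} (ψ : DSub d d') : OpenTmEq X (A.dsub ψ) (M.dsub ψ) (M'.dsub ψ) (B.dsub ψ) := by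
  refine ⟨h.1.dsub ψ, fun d'' φ N N' hN => ?_⟩
  rw [Tm.dsub_dsub A] at hN
  rw [Tm.dsub_dsub M, Tm.dsub_dsub M', Tm.dsub_dsub B]
  exact h.2 _ _ _ _ hN

namespace OpenPreTyEq

variable {d : ℕ} {A A' : Tm u d 0} {B B' B'' : Tm u d 1}

theorem symm (hX : IsCTS X) (hA : PreTyEq X A A') (h : OpenPreTyEq X A B B') :
    OpenPreTyEq X A' B' B :=
  ⟨hA.right hX, fun _ ψ _ _ hN =>
    (h.2 _ ψ _ _ ((hN.conv hX ((hA.dsub ψ).symm hX)).symm hX)).symm hX⟩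

theorem trans (hX : IsCTS X) (hA : PreTyEq X A A') (h : OpenPreTyEq X A B B')
    (h' : OpenPreTyEq X A' B' B'') : OpenPreTyEq X A B B'' :=
  ⟨h.1, fun _ ψ _ _ hN => (h.2 _ ψ _ _ hN).trans hX
    (h'.2 _ ψ _ _ ((hN.right hX).conv hX (hA.dsub ψ)))⟩

end OpenPreTyEq

namespace OpenTyEq

variable {d : ℕ} {A A' : Tm u d 0} {B B' B'' : Tm u d 1}

theorem symm (hX : IsCTS X) (hA : PreTyEq X A A') (h : OpenTyEq X A B B') :
    OpenTyEq X A' B' B :=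
  ⟨h.1.symm hX hA, fun _ ψ _ _ hN =>
    (h.2 _ ψ _ _ ((hN.conv hX ((hA.dsub ψ).symm hX)).symm hX)).symm hX⟩

theorem trans (hX : IsCTS X) (hA : PreTyEq X A A') (h : OpenTyEq X A B B')
    (h' : OpenTyEq X A' B' B'') : OpenTyEq X A B B'' :=
  ⟨h.1.trans hX hA h'.1, fun _ ψ _ _ hN => (h.2 _ ψ _ _ hN).trans hX
    (h'.2 _ ψ _ _ ((hN.right hX).conv hX (hA.dsub ψ)))⟩

end OpenTyEq

namespace OpenTmEq

variable {d : ℕ} {A A' : Tm u d 0} {M M' M'' B B' : Tm u d 1}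

theorem symm (hX : IsCTS X) (h : OpenTmEq X A M M' B) : OpenTmEq X A M' M B :=
  ⟨h.1, fun _ ψ _ _ hN => ((h.2 _ ψ _ _ (hN.symm hX)).symm hX).conv hX
    (h.1.2 _ ψ _ _ (hN.symm hX))⟩

theorem trans (hX : IsCTS X) (h : OpenTmEq X A M M' B) (h' : OpenTmEq X A M' M'' B) :
    OpenTmEq X A M M'' B :=
  ⟨h.1, fun _ ψ _ _ hN => (h.2 _ ψ _ _ hN).trans hX
    ((h'.2 _ ψ _ _ (hN.right hX)).conv hX (h.1.2 _ ψ _ _ (hN.symm hX)))⟩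

/-- Arguments are converted from `A'` to `A`, results from `B` to `B'`. -/
theorem conv (hX : IsCTS X) (hA : PreTyEq X A A') (hB : OpenPreTyEq X A B B')
    (h : OpenTmEq X A M M' B) : OpenTmEq X A' M M' B' :=
  ⟨(hB.symm hX hA).trans hX (hA.symm hX) hB,
    fun _ ψ _ _ hN =>
      have hN := hN.conv hX ((hA.dsub ψ).symm hX)
      (h.2 _ ψ _ _ hN).conv hX (hB.2 _ ψ _ _ (hN.left hX))⟩

end OpenTmEq

/-! ## Monotonicity of the judgments -/

theorem PreTyEq.mono (hXY : X.Approx Y) {d : ℕ} {A B : Tm u d 0} (h : PreTyEq X A B) :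
    PreTyEq Y A B := Cube.mono hXY.1.1 h

theorem PreTyEq.of_approx (hX : IsCTS X) (hXY : X.Approx Y) {d : ℕ} {A B : Tm u d 0}
    (hA : PreTyEq X A A) (h : PreTyEq Y A B) : PreTyEq X A B :=
  Cube.of_approx hX.E_vper hXY.1 hA h

/-- Every value of an instance of `A` is a canonical type of `X`, and on those `X` and `Y` have the
same elements. -/
theorem PreTyEq.tyFam_eq_of_approx (hX : IsCTS X) (hXY : X.Approx Y) {d : ℕ} {A : Tm u d 0}
    (hA : PreTyEq X A A) : tyFam X A = tyFam Y A := by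
  funext d' ψ V W
  refine propext (exists_congr fun A₀ => and_congr_right fun hA₀ => hXY.2 _ _ ?_ _ _)
  exact ((hA.gcube hX).rel ψ).rel hA₀ hA₀

/-- Being an equivalence, this also transports hypotheses from `Y` to `X`; all monotonicity
statements below depend on that. -/
theorem PreTyEq.tmEq_iff (hX : IsCTS X) (hY : IsCTS Y) (hXY : X.Approx Y) {d : ℕ}
    {A M N : Tm u d 0} (hA : PreTyEq X A A) : TmEq X M N A ↔ TmEq Y M N A := by
  rw [CubicalTT.tmEq_iff hX, CubicalTT.tmEq_iff hY, hA.tyFam_eq_of_approx hX hXY]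
  exact and_congr_left fun _ => iff_of_true hA (hA.mono hXY)

theorem TmEq.mono (hX : IsCTS X) (hY : IsCTS Y) (hXY : X.Approx Y) {d : ℕ} {A M N : Tm u d 0}
    (h : TmEq X M N A) : TmEq Y M N A := (h.1.tmEq_iff hX hY hXY).1 h

theorem PreTyEq.cubical_iff (hX : IsCTS X) (hY : IsCTS Y) (hXY : X.Approx Y) {d : ℕ}
    {A : Tm u d 0} (hA : PreTyEq X A A) : Cubical X A ↔ Cubical Y A := by
  refine forall_congr' fun d' => forall_congr' fun ψ => forall_congr' fun A₀ =>
    forall_congr' fun hA₀ => forall_congr' fun M => forall_congr' fun N => ?_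
  rw [hXY.2 _ _ (((hA.gcube hX).rel ψ).rel hA₀ hA₀), (hA.dsub ψ).tmEq_iff hX hY hXY]

theorem TyEq.mono (hX : IsCTS X) (hY : IsCTS Y) (hXY : X.Approx Y) {d : ℕ} {A B : Tm u d 0}
    (h : TyEq X A B) : TyEq Y A B :=
  ⟨h.1.mono hXY, ((h.1.left hX).cubical_iff hX hY hXY).1 h.2.1,
    ((h.1.right hX).cubical_iff hX hY hXY).1 h.2.2.1,
    h.2.2.2.congr fun ψ _ _ => ((h.1.left hX).dsub ψ).tmEq_iff hX hY hXY⟩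

/-- The Kan conditions for `A`, `B` speak only of elements of instances of `A`, which are the same
in `X` and `Y`. Thus it suffices that the left side is a pretype of `X`. -/
theorem TyEq.of_approx (hX : IsCTS X) (hY : IsCTS Y) (hXY : X.Approx Y) {d : ℕ} {A B : Tm u d 0}
    (hA : PreTyEq X A A) (h : TyEq Y A B) : TyEq X A B :=
  have hAB := PreTyEq.of_approx hX hXY hA h.1
  ⟨hAB, (hA.cubical_iff hX hY hXY).2 h.2.1, ((hAB.right hX).cubical_iff hX hY hXY).2 h.2.2.1,
    h.2.2.2.congr fun ψ _ _ => ((hA.dsub ψ).tmEq_iff hX hY hXY).symm⟩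

theorem OpenPreTyEq.mono (hX : IsCTS X) (hY : IsCTS Y) (hXY : X.Approx Y) {d : ℕ} {A : Tm u d 0}
    {B B' : Tm u d 1} (h : OpenPreTyEq X A B B') : OpenPreTyEq Y A B B' :=
  ⟨h.1.mono hXY, fun _ ψ _ _ hN =>
    -- The argument equality is given in `Y` and has to go back to `X`; inclusion `X ⊆ Y` alone
    -- would not do this.
    (h.2 _ ψ _ _ (((h.1.dsub ψ).tmEq_iff hX hY hXY).2 hN)).mono hXY⟩

theorem OpenTyEq.mono (hX : IsCTS X) (hY : IsCTS Y) (hXY : X.Approx Y) {d : ℕ} {A : Tm u d 0}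
    {B B' : Tm u d 1} (h : OpenTyEq X A B B') : OpenTyEq Y A B B' :=
  ⟨h.1.mono hX hY hXY, fun _ ψ _ _ hN =>
    (h.2 _ ψ _ _ (((h.1.1.dsub ψ).tmEq_iff hX hY hXY).2 hN)).mono hX hY hXY⟩

theorem OpenPreTyEq.of_approx (hX : IsCTS X) (hY : IsCTS Y) (hXY : X.Approx Y) {d : ℕ}
    {A : Tm u d 0} {B B' : Tm u d 1} (hB : OpenPreTyEq X A B B) (h : OpenPreTyEq Y A B B') :
    OpenPreTyEq X A B B' :=
  ⟨hB.1, fun _ ψ _ _ hN => .of_approx hX hXY (hB.2 _ ψ _ _ (hN.left hX))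
    (h.2 _ ψ _ _ (hN.mono hX hY hXY))⟩

theorem OpenTyEq.of_approx (hX : IsCTS X) (hY : IsCTS Y) (hXY : X.Approx Y) {d : ℕ}
    {A : Tm u d 0} {B B' : Tm u d 1} (hB : OpenPreTyEq X A B B) (h : OpenTyEq Y A B B') :
    OpenTyEq X A B B' :=
  ⟨hB.of_approx hX hY hXY h.1, fun _ ψ _ _ hN => .of_approx hX hY hXY
    (hB.2 _ ψ _ _ (hN.left hX)) (h.2 _ ψ _ _ (hN.mono hX hY hXY))⟩

theorem OpenPreTyEq.openTmEq_iff (hX : IsCTS X) (hY : IsCTS Y) (hXY : X.Approx Y) {d : ℕ}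
    {A : Tm u d 0} {B M M' : Tm u d 1} (hB : OpenPreTyEq X A B B) :
    OpenTmEq X A M M' B ↔ OpenTmEq Y A M M' B := by
  refine and_congr (iff_of_true hB (hB.mono hX hY hXY)) (forall_congr' fun d' =>
    forall_congr' fun ψ => forall_congr' fun N => forall_congr' fun N' => ?_)
  rw [← (hB.1.dsub ψ).tmEq_iff hX hY hXY]
  exact forall_congr' fun hN => (hB.2 _ ψ _ _ (hN.left hX)).tmEq_iff hX hY hXY

theorem OpenTmEq.mono (hX : IsCTS X) (hY : IsCTS Y) (hXY : X.Approx Y) {d : ℕ}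
    {A : Tm u d 0} {B M M' : Tm u d 1} (h : OpenTmEq X A M M' B) : OpenTmEq Y A M M' B :=
  (h.1.openTmEq_iff hX hY hXY).1 h

theorem OpenPreTyEq.subst {d : ℕ} {A N N' : Tm u d 0} {B B' : Tm u d 1}
    (h : OpenPreTyEq X A B B') (hN : TmEq X N N' A) : PreTyEq X (B.subst N) (B'.subst N') := by
  simpa using h.2 d (DSub.id d) N N' (by simpa using hN)

theorem OpenTmEq.subst {d : ℕ} {A N N' : Tm u d 0} {B M M' : Tm u d 1}
    (h : OpenTmEq X A M M' B) (hN : TmEq X N N' A) :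
    TmEq X (M.subst N) (M'.subst N') (B.subst N) := by
  simpa using h.2 d (DSub.id d) N N' (by simpa using hN)

end CubicalTT

namespace CubicalTT

variable {u : Bool}

/-! ## Orders -/

theorem TmRel.Approx.refl (R : TmRel u) : R.Approx R := ⟨fun _ _ _ h => h, fun _ _ _ _ => Iff.rfl⟩

theorem TmRel.Approx.trans {R S T : TmRel u} (h : R.Approx S) (h' : S.Approx T) : R.Approx T :=
  ⟨fun _ _ _ hR => h'.1 _ _ _ (h.1 _ _ _ hR),
    fun _ _ hR _ => (h.2 _ _ hR _).trans (h'.2 _ _ (h.1 _ _ _ hR) _)⟩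

theorem TmRel.Approx.antisymm {R S : TmRel u} (h : R.Approx S) (h' : S.Approx R) : R = S := by
  funext d M N
  exact propext ⟨h.1 _ _ _, h'.1 _ _ _⟩

theorem PreCTS.Approx.refl (X : PreCTS u) : X.Approx X := ⟨.refl _, fun _ _ _ _ _ => Iff.rfl⟩

theorem PreCTS.Approx.trans {X Y Z : PreCTS u} (h : X.Approx Y) (h' : Y.Approx Z) :
    X.Approx Z :=
  ⟨h.1.trans h'.1, fun _ _ hA _ _ => (h.2 _ _ hA _ _).trans (h'.2 _ _ (h.1.1 _ _ _ hA) _ _)⟩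

theorem PreCTS.Approx.antisymm {X Y : PreCTS u} (hX : IsCTS X) (hY : IsCTS Y) (h : X.Approx Y)
    (h' : Y.Approx X) : X = Y := by
  refine PreCTS.ext (h.1.antisymm h'.1) ?_
  funext d A M N
  exact propext ⟨fun hM => (h.2 _ _ (hX.dom hM) _ _).1 hM, fun hM => (h'.2 _ _ (hY.dom hM) _ _).1 hM⟩

/-- The union of a set of relations. -/
def unionRel (S : Set (TmRel u)) : TmRel u := fun d M N => ∃ R ∈ S, R d M N

/-- Any partner of `M` occurs in some `R'`, hence in a common upper bound `T` of `R` and `R'`, and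
there `M` has no partners beyond those in `R`. -/
theorem approx_unionRel {S : Set (TmRel u)} (hS : DirectedOn TmRel.Approx S) {R : TmRel u} (hR : R ∈ S) : R.Approx (unionRel S) := by
  refine ⟨fun d M N h => ⟨R, hR, h⟩, fun d M hM N => ⟨fun h => ⟨R, hR, h⟩, ?_⟩⟩
  rintro ⟨R', hR', h⟩
  obtain ⟨T, _, h₁, h₂⟩ := hS R hR R' hR'
  exact (h₁.2 _ _ hM _).2 (h₂.1 _ _ _ h)

theorem unionRel_approx {S : Set (TmRel u)} {T : TmRel u}
    (hT : ∀ R ∈ S, R.Approx T) : (unionRel S).Approx T := by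
  refine ⟨fun d M N ⟨R, hR, h⟩ => (hT R hR).1 _ _ _ h, fun d M ⟨R, hR, h⟩ N => ⟨?_, fun h' => ?_⟩⟩
  · exact fun ⟨R, hR, h⟩ => (hT R hR).1 _ _ _ h
  · exact ⟨R, hR, ((hT R hR).2 _ _ h _).2 h'⟩

theorem isVPER_unionRel {S : Set (TmRel u)} (hv : ∀ R ∈ S, IsVPER R)
    (hS : DirectedOn TmRel.Approx S) : IsVPER (unionRel S) where
  val := fun ⟨R, hR, h⟩ => (hv R hR).val h
  symm := fun ⟨R, hR, h⟩ => ⟨R, hR, (hv R hR).symm h⟩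
  trans := fun ⟨R, hR, h⟩ ⟨R', hR', h'⟩ => by
    obtain ⟨T, hT, h₁, h₂⟩ := hS R hR R' hR'
    exact ⟨T, hT, (hv T hT).trans (h₁.1 _ _ _ h) (h₂.1 _ _ _ h')⟩

theorem isVPER_bot : IsVPER (fun _ _ _ => False : TmRel u) := ⟨False.elim, id, fun h _ => h⟩

theorem isCPO_vper (u : Bool) : IsCPO (VPER.Approx (u := u)) := by
  refine ⟨{ refl := fun R => .refl _, trans := fun _ _ _ => .trans,
            antisymm := fun _ _ h h' => Subtype.ext (h.antisymm h') },
    ⟨⟨_, isVPER_bot⟩, fun R => ⟨fun _ _ _ => False.elim, fun _ _ => False.elim⟩⟩, ?_⟩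
  intro S _ hS
  have hv : ∀ R ∈ Subtype.val '' S, IsVPER R := by
    rintro _ ⟨R, _, rfl⟩
    exact R.2
  have hS' : DirectedOn TmRel.Approx (Subtype.val '' S) := by
    rintro _ ⟨R, hR, rfl⟩ _ ⟨R', hR', rfl⟩
    obtain ⟨T, hT, h⟩ := hS R hR R' hR'
    exact ⟨_, ⟨T, hT, rfl⟩, h⟩
  refine ⟨⟨unionRel (Subtype.val '' S), isVPER_unionRel hv hS'⟩,
    fun R hR => approx_unionRel hS' ⟨R, hR, rfl⟩, fun T hT => unionRel_approx ?_⟩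
  rintro _ ⟨R, hR, rfl⟩
  exact hT R hR

/-- The union of a set of pairs of relations. -/
def unionCTS (S : Set (PreCTS u)) : PreCTS u where
  E := unionRel (PreCTS.E '' S)
  Φ := fun d A M N => ∃ X ∈ S, X.Φ d A M N

section Union

variable {S : Set (PreCTS u)}

theorem directedOn_image_E (hS : DirectedOn PreCTS.Approx S) :
    DirectedOn TmRel.Approx (PreCTS.E '' S) := by
  rintro _ ⟨X, hX, rfl⟩ _ ⟨Y, hY, rfl⟩
  obtain ⟨Z, hZ, h, h'⟩ := hS X hX Y hY
  exact ⟨_, ⟨Z, hZ, rfl⟩, h.1, h'.1⟩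

theorem isVPER_image_E (hv : ∀ X ∈ S, IsCTS X) : ∀ R ∈ PreCTS.E '' S, IsVPER R := by
  rintro _ ⟨X, hX, rfl⟩
  exact (hv X hX).E_vper

theorem approx_unionCTS (hv : ∀ X ∈ S, IsCTS X) (hS : DirectedOn PreCTS.Approx S) {X : PreCTS u}
    (hX : X ∈ S) : X.Approx (unionCTS S) := by
  refine ⟨approx_unionRel (directedOn_image_E hS) ⟨X, hX, rfl⟩,
    fun d A hA M N => ⟨fun h => ⟨X, hX, h⟩, ?_⟩⟩
  rintro ⟨Y, hY, h⟩
  obtain ⟨Z, hZ, h₁, h₂⟩ := hS X hX Y hY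
  exact (h₁.2 _ _ hA _ _).2 ((h₂.2 _ _ ((hv Y hY).dom h) _ _).1 h)

theorem unionCTS_approx (hv : ∀ X ∈ S, IsCTS X) (hS : DirectedOn PreCTS.Approx S) {Y : PreCTS u}
    (hY : ∀ X ∈ S, X.Approx Y) : (unionCTS S).Approx Y := by
  refine ⟨unionRel_approx ?_, fun d A ⟨R, ⟨X, hX, hR⟩, hA⟩ M N => ?_⟩
  · rintro _ ⟨X, hX, rfl⟩
    exact (hY X hX).1
  · subst hR
    exact ((approx_unionCTS hv hS hX).2 _ _ hA _ _).symm.trans ((hY X hX).2 _ _ hA _ _)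

theorem isCTS_unionCTS (hv : ∀ X ∈ S, IsCTS X) (hS : DirectedOn PreCTS.Approx S) :
    IsCTS (unionCTS S) where
  E_vper := isVPER_unionRel (isVPER_image_E hv) (directedOn_image_E hS)
  dom := fun ⟨X, hX, h⟩ => ⟨_, ⟨X, hX, rfl⟩, (hv X hX).dom h⟩
  val := fun ⟨X, hX, h⟩ => (hv X hX).val h
  symm := fun ⟨X, hX, h⟩ => ⟨X, hX, (hv X hX).symm h⟩
  trans := fun ⟨X, hX, h⟩ h' =>
    have hA := (hv X hX).dom h
    -- Any member that contains the type `A` already has all elements that the union gives to it, so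
    -- both equalities live in `X`.
    ⟨X, hX, (hv X hX).trans h (((approx_unionCTS hv hS hX).2 _ _ hA _ _).2 h')⟩
  resp := fun ⟨R, ⟨X, hX, hR⟩, hAB⟩ M N => by
    subst hR
    have hv' := (hv X hX).E_vper
    have hA := hv'.trans hAB (hv'.symm hAB)
    have hB := hv'.trans (hv'.symm hAB) hAB
    rw [← (approx_unionCTS hv hS hX).2 _ _ hA, ← (approx_unionCTS hv hS hX).2 _ _ hB]
    exact (hv X hX).resp hAB M N

end Union

/-- The empty cubical type system. -/
def botCTS (u : Bool) : PreCTS u := ⟨fun _ _ _ => False, fun _ _ _ _ => False⟩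

theorem isCTS_botCTS (u : Bool) : IsCTS (botCTS u) :=
  ⟨isVPER_bot, False.elim, False.elim, id, fun h _ => h, fun h => h.elim⟩

theorem botCTS_approx (X : PreCTS u) : (botCTS u).Approx X :=
  ⟨⟨fun _ _ _ => False.elim, fun _ _ => False.elim⟩, fun _ _ => False.elim⟩

theorem isCPO_cts (u : Bool) : IsCPO (CTS.Approx (u := u)) := by
  refine ⟨{ refl := fun R => .refl _, trans := fun _ _ _ => .trans,
            antisymm := fun X Y h h' => Subtype.ext (h.antisymm X.2 Y.2 h') },
    ⟨⟨_, isCTS_botCTS u⟩, fun X => botCTS_approx X.1⟩, ?_⟩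
  intro S _ hS
  have hv : ∀ X ∈ Subtype.val '' S, IsCTS X := by
    rintro _ ⟨X, _, rfl⟩
    exact X.2
  have hS' : DirectedOn PreCTS.Approx (Subtype.val '' S) := by
    rintro _ ⟨X, hX, rfl⟩ _ ⟨Y, hY, rfl⟩
    obtain ⟨Z, hZ, h⟩ := hS X hX Y hY
    exact ⟨_, ⟨Z, hZ, rfl⟩, h⟩
  refine ⟨⟨unionCTS (Subtype.val '' S), isCTS_unionCTS hv hS'⟩,
    fun X hX => approx_unionCTS hv hS' ⟨X, hX, rfl⟩, fun Y hY => unionCTS_approx hv hS' ?_⟩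
  rintro _ ⟨X, hX, rfl⟩
  exact hY X hX

/-- A monotone operator that maps its post-fixed points to cubical type systems has a least fixed
point. -/
theorem exists_isCTSLfp {op : PreCTS u → PreCTS u}
    (hop : ∀ X, IsCTS X → X.Approx (op X) → IsCTS (op X)) (hmono : MonoOnCTS op) :
    ∃ X, IsCTSLfp op X := by
  -- Post-fixed points below all fixed points. Being post-fixed makes `op X` a cubical type system;
  -- lying below the fixed points makes the maximal element found a least fixed point.
  let C : Set (PreCTS u) :=
    {X | IsCTS X ∧ X.Approx (op X) ∧ ∀ Y, IsCTS Y → op Y = Y → X.Approx Y}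
  have hop' : ∀ X ∈ C, op X ∈ C := fun X hX =>
    have h := hop X hX.1 hX.2.1
    ⟨h, hmono _ _ hX.1 h hX.2.1, fun Y hY hfix => hfix ▸ hmono _ _ hX.1 hY (hX.2.2 Y hY hfix)⟩
  have hchain : ∀ c : Set C, IsChain (fun X Y : C => X.1.Approx Y.1) c →
      ∃ ub : C, ∀ X ∈ c, X.1.Approx ub.1 := by
    intro c hc
    have hv : ∀ X ∈ Subtype.val '' c, IsCTS X := by
      rintro _ ⟨X, _, rfl⟩
      exact X.2.1
    have hS : DirectedOn PreCTS.Approx (Subtype.val '' c) := by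
      rintro _ ⟨X, hX, rfl⟩ _ ⟨Y, hY, rfl⟩
      -- `IsChain` compares distinct members only. The empty chain needs no separate case, its union
      -- being a bound as well.
      by_cases hXY : X = Y
      · exact ⟨_, ⟨X, hX, rfl⟩, .refl _, hXY ▸ .refl _⟩
      · obtain h | h := hc hX hY hXY
        · exact ⟨_, ⟨Y, hY, rfl⟩, h, .refl _⟩
        · exact ⟨_, ⟨X, hX, rfl⟩, .refl _, h⟩
    have hU := isCTS_unionCTS hv hS
    refine ⟨⟨unionCTS (Subtype.val '' c), hU, unionCTS_approx hv hS ?_, fun Y hY hfix =>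
      unionCTS_approx hv hS ?_⟩, fun X hX => approx_unionCTS hv hS ⟨X, hX, rfl⟩⟩
    · rintro _ ⟨X, hX, rfl⟩
      exact X.2.2.1.trans (hmono _ _ X.2.1 hU (approx_unionCTS hv hS ⟨X, hX, rfl⟩))
    · rintro _ ⟨X, hX, rfl⟩
      exact X.2.2.2 Y hY hfix
  obtain ⟨X, hX⟩ := exists_maximal_of_chains_bounded hchain
    (fun {X Y Z : C} (h : X.1.Approx Y.1) (h' : Y.1.Approx Z.1) => h.trans h')
  refine ⟨X.1, X.2.1, ?_, X.2.2.2⟩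
  -- Since `X ⊑ op X` and `op X` is again in `C`, maximality gives `op X ⊑ X`.
  have hopX := hop' X.1 X.2
  exact (hX ⟨_, hopX⟩ X.2.2.1).antisymm hopX.1 X.2.1 X.2.2.1

/-! ## Least fixed points in the value-PERs -/

/-- If `op` is an operator on `VPER` that is monotone for both inclusion and approximation, then
the least `VPER` closed under it is also its least fixed point for the approximation ordering. -/
theorem isVPERLfp_of_mono {op : TmRel u → TmRel u} (maps : ∀ S, IsVPER S → IsVPER (op S))
    (incl : ∀ S T : TmRel u, S ≤ T → op S ≤ op T)
    (mono : ∀ S T, IsVPER S → IsVPER T → S.Approx T → (op S).Approx (op T)) :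
    IsVPERLfp op (fun d M N => ∀ R ∈ ClosedVPERs op, R d M N) := by
  set B : TmRel u := fun d M N => ∀ R ∈ ClosedVPERs op, R d M N with hB
  have hle : ∀ R ∈ ClosedVPERs op, B ≤ R := fun R hR d M N h => h R hR
  -- The full relation on values is closed, so the intersection defining `B` is not over an empty
  -- family and relates only values.
  have htop : ∃ R, R ∈ ClosedVPERs op := by
    refine ⟨fun d M N => IsVal M ∧ IsVal N,
      ⟨id, And.symm, fun h h' => ⟨h.1, h'.2⟩⟩, fun d M N h => (maps _ ?_).val h⟩
    exact ⟨id, And.symm, fun h h' => ⟨h.1, h'.2⟩⟩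
  have hvper : IsVPER B := by
    refine ⟨fun h => ?_, fun h R hR => hR.1.symm (h R hR),
      fun h h' R hR => hR.1.trans (h R hR) (h' R hR)⟩
    obtain ⟨R, hR⟩ := htop
    exact hR.1.val (h R hR)
  have hclosed : op B ≤ B := fun d M N h R hR => hR.2 d M N (incl _ _ (hle R hR) d M N h)
  have hfix : op B = B :=
    le_antisymm hclosed (hle _ ⟨maps _ hvper, incl _ _ hclosed⟩)
  refine ⟨maps, mono, hvper, hfix, fun S hS hSfix => ?_⟩
  have hBS : B ≤ S := hle S ⟨hS, hSfix.le⟩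
  -- Leastness for inclusion acts as an induction principle: `R` is the part of `B` on which `S`
  -- adds no partners. By construction `R ⊑ S`, and once `R` is closed under `op` it contains `B`,
  -- which is the missing half of `B ⊑ S`.
  let R : TmRel u := fun d M N => B d M N ∧ ∀ O, S d M O → B d M O
  have hRv : IsVPER R :=
    ⟨fun h => hvper.val h.1,
      fun h => ⟨hvper.symm h.1, fun O hO =>
        hvper.trans (hvper.symm h.1) (h.2 O (hS.trans (hBS _ _ _ h.1) hO))⟩,
      fun h h' => ⟨hvper.trans h.1 h'.1, h.2⟩⟩
  have hRS : R.Approx S := by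
    refine ⟨fun d M N h => hBS _ _ _ h.1, fun d M hM N => ⟨fun h => hBS _ _ _ h.1, fun h => ?_⟩⟩
    exact ⟨hM.2 N h, hM.2⟩
  -- From `R ⊑ S` follows `op R ⊑ op S = S`, so an `S`-partner of an element of `op R` is an `op
  -- R`-partner, hence a `B`-partner.
  have hRR : op R ≤ R := fun d M N h => by
    refine ⟨hclosed _ _ _ (incl R B (fun _ _ _ h => h.1) _ _ _ h), fun O hO => ?_⟩
    have hv := maps R hRv
    have h' := ((mono R S hRv hS hRS).2 d M (hv.trans h (hv.symm h)) O).2 (hSfix.symm ▸ hO)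
    exact hclosed _ _ _ (incl R B (fun _ _ _ h => h.1) _ _ _ h')
  have hBR : B ≤ R := hle R ⟨hRv, hRR⟩
  exact ⟨hBS, fun d M hM N => ⟨hBS _ _ _, (hBR _ _ _ hM).2 N⟩⟩

/-! ### The operators for the booleans and the circle -/

namespace HcomPremises

variable {R S : TmRel u} {d k : ℕ} {rs : Fin (k + 1) → Dim d} {r r' : Dim d} {M O Q : Tm u d 0}
  {N P T : Fin (k + 1) → Bool → Tm u (d + 1) 0}

theorem symm (hR : IsVPER R) (h : HcomPremises R rs r r' M O N P) :
    HcomPremises R rs r r' O M P N :=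
  have h := hcomPremises_iff.1 h
  hcomPremises_iff.2 ⟨h.1, h.2.1, h.2.2.symm (cubeFam_isPER hR d) (cubeFam_stable d)⟩

theorem trans (hR : IsVPER R) (h : HcomPremises R rs r r' M O N P)
    (h' : HcomPremises R rs r r' O Q P T) : HcomPremises R rs r r' M Q N T :=
  have h := hcomPremises_iff.1 h
  have h' := hcomPremises_iff.1 h'
  hcomPremises_iff.2 ⟨h.1, h.2.1, h.2.2.trans (cubeFam_isPER hR d) h'.2.2⟩

theorem mono (hRS : R ≤ S) (h : HcomPremises R rs r r' M O N P) :
    HcomPremises S rs r r' M O N P :=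
  have h := hcomPremises_iff.1 h
  hcomPremises_iff.2 ⟨h.1, h.2.1, h.2.2.mono fun _ _ _ _ => Cube.mono hRS⟩

/-- Adjacency and start involve `M`, `N` alone and are taken from `hM`; the two equalities with `O`,
`P` have their left sides in the field of `R`. -/
theorem of_approx (hR : IsVPER R) (hRS : R.Approx S) (hM : HcomPremises R rs r r' M M N N)
    (h : HcomPremises S rs r r' M O N P) : HcomPremises R rs r r' M O N P where
  names := h.names
  ne := h.ne
  cap := hM.cap.of_approx hR hRS h.cap
  adj := hM.adj
  tube i ε d' ψ hψ := (hM.tube i ε d' ψ hψ).of_approx hR hRS (h.tube i ε d' ψ hψ)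
  start := hM.start

end HcomPremises

theorem isVPER_boolOp {R : TmRel u} (hR : IsVPER R) : IsVPER (BoolOp R) where
  val h := by
    cases h with
    | tt => exact ⟨.tt, .tt⟩
    | ff => exact ⟨.ff, .ff⟩
    | hcom h => exact ⟨.hcom_bool _ _ h.names h.ne, .hcom_bool _ _ h.names h.ne⟩
  symm h := by
    cases h with
    | tt => exact .tt
    | ff => exact .ff
    | hcom h => exact .hcom (h.symm hR)
  trans h h' := by
    cases h with
    | tt => exact h'
    | ff => exact h'
    | hcom h => cases h' with
      | hcom h' => exact .hcom (h.trans hR h')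

/-- The relation occurs only positively in the premises, whence inclusion monotonicity. For `⊑`, an
element of `BoolOp S` brings its own premises in `S`, and these pull the premises in `T` back. -/
theorem isVPERLfp_boolRel (u : Bool) : IsVPERLfp BoolOp (BoolRel u) := by
  have incl : ∀ S T : TmRel u, S ≤ T → BoolOp S ≤ BoolOp T := by
    intro S T hST d M N h
    cases h with
    | tt => exact .tt
    | ff => exact .ff
    | hcom h => exact .hcom (h.mono hST)
  refine isVPERLfp_of_mono (fun _ => isVPER_boolOp) incl fun S T hS hT hST =>
    ⟨incl S T hST.1, fun d M hM N => ⟨incl S T hST.1 d M N, fun h => ?_⟩⟩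
  cases h with
  | tt => exact .tt
  | ff => exact .ff
  | hcom h => cases hM with
    | hcom hM => exact .hcom (hM.of_approx hS hST h)

theorem isVPER_circleOp {R : TmRel u} (hR : IsVPER R) : IsVPER (CircleOp R) where
  val h := by
    cases h with
    | base => exact ⟨.base, .base⟩
    | loop x => exact ⟨.loop x, .loop x⟩
    | hcom h => exact ⟨.hcom_circle _ _ h.names h.ne, .hcom_circle _ _ h.names h.ne⟩
  symm h := by
    cases h with
    | base => exact .base
    | loop x => exact .loop x
    | hcom h => exact .hcom (h.symm hR)
  trans h h' := by
    cases h with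
    | base => exact h'
    | loop x => exact h'
    | hcom h => cases h' with
      | hcom h' => exact .hcom (h.trans hR h')

theorem isVPERLfp_circleRel (u : Bool) : IsVPERLfp CircleOp (CircleRel u) := by
  have incl : ∀ S T : TmRel u, S ≤ T → CircleOp S ≤ CircleOp T := by
    intro S T hST d M N h
    cases h with
    | base => exact .base
    | loop x => exact .loop x
    | hcom h => exact .hcom (h.mono hST)
  refine isVPERLfp_of_mono (fun _ => isVPER_circleOp) incl fun S T hS hT hST =>
    ⟨incl S T hST.1, fun d M hM N => ⟨incl S T hST.1 d M N, fun h => ?_⟩⟩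
  cases h with
  | base => exact .base
  | loop x => exact .loop x
  | hcom h => cases hM with
    | hcom hM => exact .hcom (hM.of_approx hS hST h)

end CubicalTT

namespace CubicalTT

variable {u : Bool} {X Y : PreCTS u}

/-! ## The operator `F` -/

namespace FE

variable {d : ℕ} {A B C : Tm u d 0}

theorem val (h : FE X d A B) : IsVal A ∧ IsVal B := by
  cases h with
  | bool => exact ⟨.bool, .bool⟩
  | circle => exact ⟨.circle, .circle⟩
  | pi => exact ⟨.pi _ _, .pi _ _⟩
  | sigma => exact ⟨.sigma _ _, .sigma _ _⟩
  | ident => exact ⟨.ident _ _ _, .ident _ _ _⟩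
  | notb x => exact ⟨.notb x, .notb x⟩

theorem symm (hX : IsCTS X) (h : FE X d A B) : FE X d B A := by
  cases h with
  | bool => exact .bool
  | circle => exact .circle
  | pi hA hB => exact .pi (hA.symm hX) (hB.symm hX hA.1)
  | sigma hA hB => exact .sigma (hA.symm hX) (hB.symm hX hA.1)
  | ident hA h₀ h₁ =>
    -- The endpoints are equal in the faces of the first type and have to be converted to those of
    -- the second.
    exact .ident (hA.symm hX) ((h₀.symm hX).conv hX (hA.1.dsub _))
      ((h₁.symm hX).conv hX (hA.1.dsub _))
  | notb x h => exact .notb x h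

theorem trans (hX : IsCTS X) (h : FE X d A B) (h' : FE X d B C) : FE X d A C := by
  cases h with
  | bool | circle | notb => exact h'
  | pi hA hB => cases h' with
    | pi hA' hB' => exact .pi (hA.trans hX hA') (hB.trans hX hA.1 hB')
  | sigma hA hB => cases h' with
    | sigma hA' hB' => exact .sigma (hA.trans hX hA') (hB.trans hX hA.1 hB')
  | ident hA h₀ h₁ => cases h' with
    | ident hA' h₀' h₁' =>
      exact .ident (hA.trans hX hA') (h₀.trans hX (h₀'.conv hX ((hA.1.dsub _).symm hX)))
        (h₁.trans hX (h₁'.conv hX ((hA.1.dsub _).symm hX)))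

theorem mono (hX : IsCTS X) (hY : IsCTS Y) (hXY : X.Approx Y) (h : FE X d A B) : FE Y d A B := by
  cases h with
  | bool => exact .bool
  | circle => exact .circle
  | pi hA hB => exact .pi (hA.mono hX hY hXY) (hB.mono hX hY hXY)
  | sigma hA hB => exact .sigma (hA.mono hX hY hXY) (hB.mono hX hY hXY)
  | ident hA h₀ h₁ =>
    exact .ident (hA.mono hX hY hXY) (h₀.mono hX hY hXY) (h₁.mono hX hY hXY)
  | notb x h => exact .notb x (h.mono hX hY hXY)

/-- The hypothesis `hA` provides the components of the left type as pretypes of `X`, which is all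
that pulling back the premises in `Y` requires. -/
theorem of_approx (hX : IsCTS X) (hY : IsCTS Y) (hXY : X.Approx Y) (hA : FE X d A A)
    (h : FE Y d A B) : FE X d A B := by
  cases h with
  | bool => exact .bool
  | circle => exact .circle
  | pi hA' hB' => cases hA with
    | pi hA hB =>
      exact .pi (.of_approx hX hY hXY hA.1 hA') (.of_approx hX hY hXY hB.1 hB')
  | sigma hA' hB' => cases hA with
    | sigma hA hB =>
      exact .sigma (.of_approx hX hY hXY hA.1 hA') (.of_approx hX hY hXY hB.1 hB')
  | ident hA' h₀' h₁' => cases hA with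
    | ident hA h₀ h₁ =>
      exact .ident (.of_approx hX hY hXY hA.1 hA') ((h₀.1.tmEq_iff hX hY hXY).2 h₀')
        ((h₁.1.tmEq_iff hX hY hXY).2 h₁')
  | notb x => exact hA

end FE

theorem boolRel_isVPER (u : Bool) : IsVPER (BoolRel u) := (isVPERLfp_boolRel u).vper

theorem circleRel_isVPER (u : Bool) : IsVPER (CircleRel u) := (isVPERLfp_circleRel u).vper

namespace FΦ

variable {d : ℕ} {A B U V W : Tm u d 0}

theorem val (h : FΦ X d A V W) : IsVal V ∧ IsVal W := by
  cases h with
  | bool h => exact (boolRel_isVPER u).val h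
  | circle h => exact (circleRel_isVPER u).val h
  | pi => exact ⟨.lam _, .lam _⟩
  | sigma => exact ⟨.pair _ _, .pair _ _⟩
  | ident => exact ⟨.dlam _, .dlam _⟩
  | notb x => exact ⟨.notel x _, .notel x _⟩

/-- Formation of the type is needed for pairs: the second components are compared in `B[M]` and must
be converted to `B[M']`. -/
theorem symm (hX : IsCTS X) (hA : FE X d A A) (h : FΦ X d A V W) : FΦ X d A W V := by
  cases h with
  | bool h => exact .bool ((boolRel_isVPER u).symm h)
  | circle h => exact .circle ((circleRel_isVPER u).symm h)
  | pi h => exact .pi (h.symm hX)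
  | sigma hM hN => cases hA with
    | sigma hA hB =>
      exact .sigma (hM.symm hX) ((hN.symm hX).conv hX (hB.1.subst hM))
  | ident hM h₀ h₁ =>
    exact .ident (hM.symm hX) (((hM.symm hX).dsub _).trans hX h₀)
      (((hM.symm hX).dsub _).trans hX h₁)
  | notb x h => exact .notb x (h.symm hX)

theorem trans (hX : IsCTS X) (hA : FE X d A A) (h : FΦ X d A U V) (h' : FΦ X d A V W) :
    FΦ X d A U W := by
  cases h with
  | bool h => cases h' with
    | bool h' => exact .bool ((boolRel_isVPER u).trans h h')
  | circle h => cases h' with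
    | circle h' => exact .circle ((circleRel_isVPER u).trans h h')
  | pi h => cases h' with
    | pi h' => exact .pi (h.trans hX h')
  | sigma hM hN => cases h' with
    | sigma hM' hN' => cases hA with
      | sigma hA hB =>
        exact .sigma (hM.trans hX hM')
          (hN.trans hX (hN'.conv hX (hB.1.subst (hM.symm hX))))
  | ident hM h₀ h₁ => cases h' with
    | ident hM' => exact .ident (hM.trans hX hM') h₀ h₁
  | notb x h => cases h' with
    | notb x h' => exact .notb x (h.trans hX h')

theorem conv (hX : IsCTS X) (hAB : FE X d A B) (h : FΦ X d A V W) : FΦ X d B V W := by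
  cases hAB with
  | bool | circle | notb => exact h
  | pi hA hB => cases h with
    | pi h => exact .pi (h.conv hX hA.1 hB.1)
  | sigma hA hB => cases h with
    | sigma hM hN => exact .sigma (hM.conv hX hA.1) (hN.conv hX (hB.1.subst (hM.left hX)))
  | ident hA hP₀ hP₁ => cases h with
    | ident hM h₀ h₁ =>
      exact .ident (hM.conv hX hA.1) ((h₀.trans hX hP₀).conv hX (hA.1.dsub _))
        ((h₁.trans hX hP₁).conv hX (hA.1.dsub _))

theorem mono (hX : IsCTS X) (hY : IsCTS Y) (hXY : X.Approx Y) (h : FΦ X d A V W) :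
    FΦ Y d A V W := by
  cases h with
  | bool h => exact .bool h
  | circle h => exact .circle h
  | pi h => exact .pi (h.mono hX hY hXY)
  | sigma hM hN => exact .sigma (hM.mono hX hY hXY) (hN.mono hX hY hXY)
  | ident hM h₀ h₁ =>
    exact .ident (hM.mono hX hY hXY) (h₀.mono hX hY hXY) (h₁.mono hX hY hXY)
  | notb x h => exact .notb x (h.mono hX hY hXY)

theorem of_approx (hX : IsCTS X) (hY : IsCTS Y) (hXY : X.Approx Y) (hA : FE X d A A)
    (h : FΦ Y d A V W) : FΦ X d A V W := by
  cases h with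
  | bool h => exact .bool h
  | circle h => exact .circle h
  | pi h => cases hA with
    | pi hA hB => exact .pi ((hB.1.openTmEq_iff hX hY hXY).2 h)
  | sigma hM hN => cases hA with
    | sigma hA hB =>
      have hM := (hA.1.tmEq_iff hX hY hXY).2 hM
      exact .sigma hM (((hB.1.subst (hM.left hX)).tmEq_iff hX hY hXY).2 hN)
  | ident hM h₀ h₁ => cases hA with
    | ident hA =>
      exact .ident ((hA.1.tmEq_iff hX hY hXY).2 hM)
        (((hA.1.dsub _).tmEq_iff hX hY hXY).2 h₀) (((hA.1.dsub _).tmEq_iff hX hY hXY).2 h₁)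
  | notb x h => cases hA with
    | notb _ hA => exact .notb x ((hA.1.tmEq_iff hX hY hXY).2 h)

end FΦ

theorem isCTS_fop (hX : IsCTS X) : IsCTS (Fop X) where
  E_vper := ⟨FE.val, FE.symm hX, FE.trans hX⟩
  dom h := h.1
  val h := h.2.val
  symm h := ⟨h.1, h.2.symm hX h.1⟩
  trans h h' := ⟨h.1, h.2.trans hX h.1 h'.2⟩
  resp := fun hAB _ _ =>
    ⟨fun h => ⟨(hAB.symm hX).trans hX hAB, h.2.conv hX hAB⟩,
      fun h => ⟨hAB.trans hX (hAB.symm hX), h.2.conv hX (hAB.symm hX)⟩⟩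

theorem fop_mono : MonoOnCTS (Fop (u := u)) := fun _ _ hX hY hXY =>
  ⟨⟨fun _ _ _ => FE.mono hX hY hXY, fun _ _ hA _ =>
    ⟨FE.mono hX hY hXY, FE.of_approx hX hY hXY hA⟩⟩,
    fun _ _ hA _ _ => ⟨fun h => ⟨h.1.mono hX hY hXY, h.2.mono hX hY hXY⟩,
      fun h => ⟨hA, h.2.of_approx hX hY hXY hA⟩⟩⟩

/-! ## The booleans are a Kan type -/

/-- The tube rule selects the least constant extent. This case distinction therefore decides how a
composition at `bool` evaluates. -/
theorem names_or_first_const {d k : ℕ} (rs : Fin (k + 1) → Dim d) :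
    (∀ i, (rs i).IsName) ∨ ∃ i ε, rs i = .const ε ∧ ∀ j < i, (rs j).IsName := by
  by_cases h : ∀ i, (rs i).IsName
  · exact .inl h
  · obtain ⟨i, hi, hmin⟩ := (wellFounded_lt (α := Fin (k + 1))).has_min {i | ¬(rs i).IsName}
      (not_forall.1 h)
    cases hr : rs i with
    | const ε => exact .inr ⟨i, ε, hr, fun j hj => not_not.1 fun h => hmin j h hj⟩
    | name x => exact absurd ⟨x, hr⟩ hi

section BoolHcom

variable {R : TmRel u} {d k : ℕ} {rs : Fin (k + 1) → Dim d} {r r' : Dim d} {M O : Tm u d 0}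
  {N P : Fin (k + 1) → Bool → Tm u (d + 1) 0}

/-- Under a substitution an earlier extent `j` may become constant and be selected in place of `i`.
Adjacency makes the two faces equal, so head expansion applies. -/
theorem cube_hcom_bool_tube (hR : IsVPER R) (r' : Dim d)
    (h : KanPrem (cubeFam R d) rs r M M N N) {i ε} (hi : rs i = .const ε) :
    Cube R (.hcom k rs .bool r r' M N) ((N i ε).inst r') := by
  refine (cube_iff hR).2 (.expand (hR.fam d) ?_ fun ψ => ?_)
  · have := h.adj_inst r' i i ε ε (DSub.id d) (by rw [hi]; rfl) (by rw [hi]; rfl)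
    rw [Tm.dsub_id] at this
    exact ((cube_iff hR).1 this).left
  · have hiψ : (rs i).dsub ψ = .const ε := by rw [hi]; rfl
    obtain hrs | ⟨j, ε', hj, hlt⟩ := names_or_first_const fun i => (rs i).dsub ψ
    · exact absurd hiψ ((hrs i).ne_const ε)
    · refine ⟨_, .single (.hcom_bool_tube _ _ _ _ _ j ε' hj hlt), (cube_iff hR).1 ?_⟩
      rw [← Tm.inst_dsub]
      exact h.adj_inst r' j i ε' ε ψ hj hiψ

/-- Each instance steps to the cap or to a face at `r`, and the start condition identifies that face
with the cap. -/
theorem cube_hcom_bool_cap (hR : IsVPER R) (h : KanPrem (cubeFam R d) rs r M M N N) :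
    Cube R (.hcom k rs .bool r r M N) M := by
  refine (cube_iff hR).2 (.expand (hR.fam d) ((cube_iff hR).1 h.cap).left fun ψ => ?_)
  obtain hrs | ⟨j, ε, hj, hlt⟩ := names_or_first_const fun i => (rs i).dsub ψ
  · exact ⟨_, .single (.hcom_bool_cap _ _ _ _ _ hrs rfl), (cube_iff hR).1 (h.cap.dsub ψ)⟩
  · refine ⟨_, .single (.hcom_bool_tube _ _ _ _ _ j ε hj hlt), (cube_iff hR).1 ?_⟩
    rw [← Tm.inst_dsub]
    exact h.start j ε _ ψ (sat_singleton.2 hj)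

/-- If neither tube nor cap rule applies, both sides are values and are related because `R` is
closed under `BoolOp`. Otherwise the previous two lemmas reduce to equality of faces or caps. -/
theorem evR_hcom_bool (hR : IsVPER R) (hop : BoolOp R ≤ R)
    (h : KanPrem (cubeFam R d) rs r M O N P) :
    EvR (R d) (.hcom k rs .bool r r' M N) (.hcom k rs .bool r r' O P) := by
  have hJ := cubeFam_isPER hR d
  have hl := h.left hJ (cubeFam_stable d)
  have hr := (h.symm hJ (cubeFam_stable d)).left hJ (cubeFam_stable d)
  obtain hrs | ⟨i, ε, hi, hlt⟩ := names_or_first_const rs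
  · by_cases hrr : r = r'
    · subst hrr
      have := ((cube_hcom_bool_cap hR hl).trans hR h.cap).trans hR
        ((cube_hcom_bool_cap hR hr).symm hR)
      exact ((cube_iff hR).1 this).rel_id
    · exact .of_val (.hcom_bool _ _ hrs hrr) (.hcom_bool _ _ hrs hrr)
        (hop _ _ _ (.hcom (hcomPremises_iff.2 ⟨hrs, hrr, h⟩)))
  · have hNP := h.tube_inst r' i ε (DSub.id d) (by rw [hi]; rfl)
    rw [Tm.dsub_id, Tm.dsub_id] at hNP
    have := ((cube_hcom_bool_tube hR r' hl hi).trans hR hNP).trans hR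
      ((cube_hcom_bool_tube hR r' hr hi).symm hR)
    exact ((cube_iff hR).1 this).rel_id

theorem coh_hcom_bool (hR : IsVPER R) (hop : BoolOp R ≤ R)
    (h : KanPrem (cubeFam R d) rs r M M N N) : Coh (R.fam d) (.hcom k rs .bool r r' M N) := by
  intro d₁ ψ
  have hψ := h.dsub (cubeFam_stable d) ψ
  -- In the first case evaluation leaves the term unchanged, so coherence is just relatedness of its
  -- further instances to themselves. In the second, coherence is part of the equality with `K`.
  have key : IsVal ((Tm.hcom k rs .bool r r' M N).dsub ψ) ∨
      ∃ K, Cube R ((Tm.hcom k rs .bool r r' M N).dsub ψ) K := by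
    obtain hrs | ⟨i, ε, hi, hlt⟩ := names_or_first_const fun i => (rs i).dsub ψ
    · by_cases hrr : r.dsub ψ = r'.dsub ψ
      · refine .inr ⟨M.dsub ψ, ?_⟩
        rw [Tm.dsub, ← hrr]
        exact cube_hcom_bool_cap hR hψ
      · exact .inl (.hcom_bool _ _ hrs hrr)
    · exact .inr ⟨_, cube_hcom_bool_tube hR _ hψ hi⟩
  obtain hv | ⟨K, hK⟩ := key
  · exact ⟨_, hv.eval, fun d₂ ψ₂ => evR_hcom_bool hR hop (hψ.dsub (cubeFam_stable d₁) ψ₂)⟩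
  · have := ((cube_iff hR).1 hK).left _ (DSub.id d₁)
    rwa [Tm.dsub_id] at this

theorem cube_hcom_bool (hR : IsVPER R) (hop : BoolOp R ≤ R)
    (h : KanPrem (cubeFam R d) rs r M O N P) :
    Cube R (.hcom k rs .bool r r' M N) (.hcom k rs .bool r r' O P) := by
  have hJ := cubeFam_isPER hR d
  have hJ' := cubeFam_stable (R := R) d
  exact (cube_iff hR).2 ⟨coh_hcom_bool hR hop (h.left hJ hJ'),
    coh_hcom_bool hR hop ((h.symm hJ hJ').left hJ hJ'),
    fun ψ => evR_hcom_bool hR hop (h.dsub hJ' ψ)⟩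

end BoolHcom

/-- Canonical booleans are equal as booleans. -/
theorem BoolRel.cube {d : ℕ} {V W : Tm u d 0} (h : BoolRel u d V W) : Cube (BoolRel u) V W := by
  have hR := boolRel_isVPER u
  have hfix := (isVPERLfp_boolRel u).fixed
  rw [← hfix] at h
  cases h with
  | tt =>
    exact (cube_iff hR).2 (.of_val (hR.fam d) (fun _ => .tt) (fun _ => .tt) fun _ =>
      hfix ▸ (BoolOp.tt : BoolOp (BoolRel u) _ _ _))
  | ff =>
    exact (cube_iff hR).2 (.of_val (hR.fam d) (fun _ => .ff) (fun _ => .ff) fun _ =>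
      hfix ▸ (BoolOp.ff : BoolOp (BoolRel u) _ _ _))
  | hcom h => exact cube_hcom_bool hR hfix.le (hcomPremises_iff.1 h).2.2

theorem preTyEq_bool (hX : IsCTS X) (hE : ∀ d, X.E d .bool .bool) {d : ℕ} : PreTyEq X (.bool : Tm u d 0) .bool :=
  (cube_iff hX.E_vper).2 (.of_val (hX.E_vper.fam d) (fun _ => .bool) (fun _ => .bool) fun _ => hE _)

/-- Every instance of `bool` is the value `bool`, so its element family does not depend on the
substitution. -/
theorem tmEq_bool_iff (hX : IsCTS X) (hE : ∀ d, X.E d .bool .bool)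
    (hΦ : ∀ d V W, X.Φ d .bool V W ↔ BoolRel u d V W) {d : ℕ} {M N : Tm u d 0} : TmEq X M N .bool ↔ Cube (BoolRel u) M N := by
  have hfam : tyFam X (.bool : Tm u d 0) = (BoolRel u).fam d := by
    funext d' ψ V W
    refine propext ⟨fun ⟨A₀, hA₀, h⟩ => ?_, fun h => ⟨.bool, IsVal.bool.eval, (hΦ _ _ _).2 h⟩⟩
    obtain rfl := IsVal.bool.eq_of_eval hA₀
    exact (hΦ _ _ _).1 h
  rw [tmEq_iff hX, cube_iff (boolRel_isVPER u), hfam]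
  exact and_iff_right (preTyEq_bool hX hE)

theorem tmFam_bool (hX : IsCTS X) (hE : ∀ d, X.E d .bool .bool)
    (hΦ : ∀ d V W, X.Φ d .bool V W ↔ BoolRel u d V W) {d : ℕ} : tmFam X (.bool : Tm u d 0) = cubeFam (BoolRel u) d := by
  funext d' ψ M N
  exact propext (tmEq_bool_iff hX hE hΦ)

theorem cubical_bool (hX : IsCTS X) (hE : ∀ d, X.E d .bool .bool)
    (hΦ : ∀ d V W, X.Φ d .bool V W ↔ BoolRel u d V W) {d : ℕ} : Cubical X (.bool : Tm u d 0) := by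
  intro d' ψ A₀ hA₀ M N h
  obtain rfl := IsVal.bool.eq_of_eval hA₀
  exact (tmEq_bool_iff hX hE hΦ).2 (((hΦ _ _ _).1 h).cube)

/-- Composition at `bool` was treated above for any closed relation; coercion at `bool` steps to its
argument under every substitution. -/
theorem tyEq_bool (hX : IsCTS X) (hE : ∀ d, X.E d .bool .bool)
    (hΦ : ∀ d V W, X.Φ d .bool V W ↔ BoolRel u d V W) {d : ℕ} : TyEq X (.bool : Tm u d 0) .bool := by
  have hR := boolRel_isVPER u
  have hcoe : ∀ {d' : ℕ} (r r' : Dim d') {M : Tm u d' 0}, TmEq X M M .bool →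
      TmEq X (.coe .bool r r' M) M .bool := fun r r' M h =>
    .of_stable hX h fun ψ => .single (.coe_bool _ _ _)
  refine ⟨preTyEq_bool hX hE, cubical_bool hX hE hΦ, cubical_bool hX hE hΦ, .mk' ?_ ?_ ?_ ?_ ?_⟩
  · intro d' ψ k rs r r' M O N P hp
    rw [Tm.dsub, tmFam_bool hX hE hΦ] at hp
    exact (tmEq_bool_iff hX hE hΦ).2 (cube_hcom_bool hR (isVPERLfp_boolRel u).fixed.le hp)
  · intro d' ψ k rs r M N hp
    rw [Tm.dsub, tmFam_bool hX hE hΦ] at hp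
    exact (tmEq_bool_iff hX hE hΦ).2 (cube_hcom_bool_cap hR hp)
  · intro d' ψ k rs r r' M N hp i ε hi
    rw [Tm.dsub, tmFam_bool hX hE hΦ] at hp
    exact (tmEq_bool_iff hX hE hΦ).2 (cube_hcom_bool_tube hR r' hp hi)
  · intro d' ψ r r' M N h
    exact (hcoe r r' (h.left hX)).trans hX (h.trans hX ((hcoe r r' (h.right hX)).symm hX))
  · intro d' ψ r M h
    exact hcoe r r h

end CubicalTT

namespace CubicalTT

variable {u : Bool} {X Y : PreCTS u}

/-! ## Non-dependent function types -/

/-- Inversion for the canonical function types and their canonical elements. -/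
def ArrInv (X : PreCTS u) : Prop :=
  ∀ (d : ℕ) (A B : Tm u d 0), X.E d (.arr A B) (.arr A B) →
    OpenPreTyEq X A B.twk B.twk ∧ ∀ V W, X.Φ d (.arr A B) V W →
      ∃ M M', V = .lam M ∧ W = .lam M' ∧ OpenTmEq X A M M' B.twk

theorem OpenTmEq.subst_twk {d : ℕ} {A B N N' : Tm u d 0} {M M' : Tm u d 1}
    (h : OpenTmEq X A M M' B.twk) (hN : TmEq X N N' A) :
    TmEq X (M.subst N) (M'.subst N') B := by
  simpa using h.subst hN

section Elim

variable {d : ℕ} {A B F F' N N' : Tm u d 0}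

theorem tyFam_arr (hX : IsCTS X) (hinv : ArrInv X) {d' : ℕ} {ψ : DSub d d'} {V W : Tm u d' 0}
    (h : tyFam X (.arr A B) d' ψ V W) : ∃ M M', V = .lam M ∧ W = .lam M' ∧
      OpenTmEq X (A.dsub ψ) M M' (B.dsub ψ).twk := by
  obtain ⟨A₀, hA₀, h⟩ := h
  rw [Tm.arr_dsub] at hA₀
  obtain rfl := (IsVal.pi _ _).eq_of_eval hA₀
  exact (hinv _ _ _ (hX.dom h)).2 _ _ h

theorem TmEq.eval_arr (hX : IsCTS X) (hinv : ArrInv X) (h : TmEq X F F' (.arr A B)) {d' : ℕ}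
    (ψ : DSub d d') : ∃ M M', Eval (F.dsub ψ) (.lam M) ∧ Eval (F'.dsub ψ) (.lam M') ∧
      OpenTmEq X (A.dsub ψ) M M' (B.dsub ψ).twk := by
  obtain ⟨V, W, hV, hW, h⟩ := (h.gcube hX).rel ψ
  obtain ⟨M, M', rfl, rfl, h'⟩ := tyFam_arr hX hinv h
  exact ⟨M, M', hV, hW, h'⟩

/-- Evaluating an instance of a function gives a body equal to, though not necessarily identical
with, the instance of the body of its value. -/
theorem TmEq.coh_arr (hX : IsCTS X) (hinv : ArrInv X) (h : TmEq X F F (.arr A B)) {d₁ : ℕ}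
    {ψ₁ : DSub d d₁} {M : Tm u d₁ 1} (hM : Eval (F.dsub ψ₁) (.lam M)) {d₂ : ℕ}
    (ψ₂ : DSub d₁ d₂) : ∃ M', Eval ((F.dsub ψ₁).dsub ψ₂) (.lam M') ∧
      OpenTmEq X ((A.dsub ψ₁).dsub ψ₂) (M.dsub ψ₂) M' ((B.dsub ψ₁).dsub ψ₂).twk := by
  obtain ⟨M₁, hM₁, h⟩ := (h.gcube hX).left d₁ ψ₁
  obtain rfl := hM.det hM₁
  obtain ⟨V, W, hV, hW, h⟩ := h d₂ ψ₂
  obtain ⟨M₂, M', rfl, rfl, h'⟩ := tyFam_arr hX hinv h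
  obtain ⟨rfl⟩ := (IsVal.lam (M.dsub ψ₂)).eq_of_eval hV
  rw [Tm.dsub_dsub A, Tm.dsub_dsub B]
  exact ⟨M', hW, h'⟩

/-- The application of a function is equal to the instance of the body of its value. -/
theorem TmEq.app_eval (hX : IsCTS X) (hinv : ArrInv X) (hF : TmEq X F F (.arr A B))
    {M : Tm u d 1} (hM : Eval F (.lam M)) (hN : TmEq X N N A) :
    TmEq X (.app F N) (M.subst N) B := by
  rw [← Tm.dsub_id F] at hM
  have key : ∀ {d' : ℕ} (ψ : DSub d d'), ∃ M', Eval (F.dsub ψ) (.lam M') ∧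
      OpenTmEq X (A.dsub ψ) (M.dsub ψ) M' (B.dsub ψ).twk := fun ψ => by
    simpa using hF.coh_arr hX hinv hM ψ
  have hself : OpenTmEq X A M M B.twk := by
    obtain ⟨M', _, h⟩ := key (DSub.id d)
    simpa using h.trans hX (h.symm hX)
  -- The step from the application to the substituted body is not stable under `ψ`, since `Fψ` may
  -- evaluate to another lambda; coherence says that its body `M'` is equal to `Mψ`.
  refine .expand hX (hself.subst_twk hN) fun ψ => ?_
  obtain ⟨M', hM', h⟩ := key ψ
  refine ⟨M'.subst (N.dsub ψ), (Steps.app hM'.1 _).tail (.app_lam _ _), ?_⟩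
  rw [Tm.subst_dsub]
  exact (h.symm hX).subst_twk (hN.dsub ψ)

/-- Application preserves equality. -/
theorem TmEq.app (hX : IsCTS X) (hinv : ArrInv X) (hF : TmEq X F F' (.arr A B))
    (hN : TmEq X N N' A) : TmEq X (.app F N) (.app F' N') B := by
  obtain ⟨M, M', hM, hM', h⟩ := hF.eval_arr hX hinv (DSub.id d)
  rw [Tm.dsub_id] at hM hM' h
  rw [Tm.dsub_id] at h
  exact ((hF.left hX).app_eval hX hinv hM (hN.left hX)).trans hX ((h.subst_twk hN).trans hX
    (((hF.right hX).app_eval hX hinv hM' (hN.right hX)).symm hX))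

theorem TmEq.app_eval_dsub (hX : IsCTS X) (hinv : ArrInv X) (hF : TmEq X F F (.arr A B))
    {M : Tm u d 1} (hM : Eval F (.lam M)) {d' : ℕ} (ψ : DSub d d') {N : Tm u d' 0}
    (hN : TmEq X N N (A.dsub ψ)) :
    TmEq X (.app (F.dsub ψ) N) ((M.dsub ψ).subst N) (B.dsub ψ) := by
  rw [← Tm.dsub_id F] at hM
  obtain ⟨M', hM', h⟩ := hF.coh_arr hX hinv hM ψ
  simp only [Tm.dsub_id] at hM' h
  have hFψ := hF.dsub ψ
  rw [Tm.arr_dsub] at hFψ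
  exact (hFψ.app_eval hX hinv hM' hN).trans hX ((h.symm hX).subst_twk hN)

end Elim

/-! ### Function types of types are types -/

theorem openTyEq_twk {d : ℕ} {A B B' : Tm u d 0} (hA : PreTyEq X A A) (hB : TyEq X B B') :
    OpenTyEq X A B.twk B'.twk := by
  refine ⟨⟨hA, fun d' ψ N N' _ => ?_⟩, fun d' ψ N N' _ => ?_⟩
  · simpa only [Tm.twk_dsub, Tm.twk_subst] using hB.1.dsub ψ
  · simpa only [Tm.twk_dsub, Tm.twk_subst] using hB.dsub ψ

theorem openTmEq_twk {d : ℕ} {A B : Tm u d 0} {M M' : Tm u d 1} (hA : PreTyEq X A A)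
    (hB : TyEq X B B) (h : ∀ (d' : ℕ) (ψ : DSub d d') (N N' : Tm u d' 0),
      TmEq X N N' (A.dsub ψ) → TmEq X ((M.dsub ψ).subst N) ((M'.dsub ψ).subst N') (B.dsub ψ)) :
    OpenTmEq X A M M' B.twk := by
  refine ⟨(openTyEq_twk hA hB).1, fun d' ψ N N' hN => ?_⟩
  rw [Tm.twk_dsub, Tm.twk_subst]
  exact h d' ψ N N' hN

section Arr

variable {d : ℕ} {A A' B B' : Tm u d 0}

theorem preTyEq_arr (hX : IsCTS X) (hpi : HasPi X) (hA : TyEq X A A') (hB : TyEq X B B') :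
    PreTyEq X (.arr A B) (.arr A' B') := by
  refine (cube_iff hX.E_vper).2 (.of_val (hX.E_vper.fam d) (fun _ => .pi _ _) (fun _ => .pi _ _)
    fun ψ => ?_)
  exact (hpi d A A' B.twk B'.twk hA (openTyEq_twk (hA.1.left hX) hB) _ ψ).1

theorem arr_intro (hpi : HasPi X) (hA : TyEq X A A) (hB : TyEq X B B)
    {M M' : Tm u d 1} (h : OpenTmEq X A M M' B.twk) : X.Φ d (.arr A B) (.lam M) (.lam M') := by
  have := (hpi d A A B.twk B.twk hA (openTyEq_twk hA.1 hB) d (DSub.id d)).2.1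
  simp only [Tm.dsub_id] at this
  exact this M M' h

theorem tmEq_lam (hX : IsCTS X) (hpi : HasPi X) (hA : TyEq X A A) (hB : TyEq X B B)
    {M M' : Tm u d 1} (h : OpenTmEq X A M M' B.twk) : TmEq X (.lam M) (.lam M') (.arr A B) := by
  refine (tmEq_iff hX).2 ⟨preTyEq_arr hX hpi hA hB, .of_val (hX.tyFam _) (fun _ => .lam _)
    (fun _ => .lam _) fun ψ => ⟨_, (IsVal.pi _ _).eval, ?_⟩⟩
  have h := h.dsub ψ
  rw [Tm.twk_dsub] at h ⊢
  exact arr_intro hpi (hA.dsub ψ) (hB.dsub ψ) h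

/-- Extensionality. Each function is coherent by itself, so only the lambdas to which they evaluate
are compared, and their bodies on `N` equal the applications. Kan equations in `A → B` thereby
reduce to equations in `B`. -/
theorem tmEq_arr_ext (hX : IsCTS X) (hinv : ArrInv X) (hpi : HasPi X) (hA : TyEq X A A)
    (hB : TyEq X B B) {F F' : Tm u d 0} (hF : TmEq X F F (.arr A B))
    (hF' : TmEq X F' F' (.arr A B)) (h : ∀ (d' : ℕ) (ψ : DSub d d') (N N' : Tm u d' 0),
      TmEq X N N' (A.dsub ψ) → TmEq X (.app (F.dsub ψ) N) (.app (F'.dsub ψ) N') (B.dsub ψ)) :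
    TmEq X F F' (.arr A B) := by
  refine (tmEq_iff hX).2 ⟨hF.1, (hF.gcube hX).left, (hF'.gcube hX).left, fun ψ => ?_⟩
  obtain ⟨M, _, hM, _, _⟩ := hF.eval_arr hX hinv ψ
  obtain ⟨M', _, hM', _, _⟩ := hF'.eval_arr hX hinv ψ
  refine ⟨_, _, hM, hM', _, (IsVal.pi _ _).eval, ?_⟩
  rw [Tm.twk_dsub]
  have hFψ := hF.dsub ψ
  have hF'ψ := hF'.dsub ψ
  rw [Tm.arr_dsub] at hFψ hF'ψ
  refine arr_intro hpi (hA.dsub ψ) (hB.dsub ψ)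
    (openTmEq_twk (hA.1.dsub ψ) (hB.dsub ψ) fun d' φ N N' hN => ?_)
  refine ((hFψ.app_eval_dsub hX hinv hM φ (hN.left hX)).symm hX).trans hX
    (TmEq.trans hX ?_ (hF'ψ.app_eval_dsub hX hinv hM' φ (hN.right hX)))
  -- The bodies are open, so they are tested after a further `φ`; extensionality is invoked at the
  -- composite.
  have := h d' (ψ.comp φ) N N'
  simp only [← Tm.dsub_dsub] at this
  exact this hN

theorem cubical_arr (hX : IsCTS X) (hinv : ArrInv X) (hpi : HasPi X) (hA : TyEq X A A)
    (hB : TyEq X B B) : Cubical X (.arr A B) := by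
  intro d' ψ A₀ hA₀ V W h
  rw [Tm.arr_dsub] at hA₀ ⊢
  obtain rfl := (IsVal.pi _ _).eq_of_eval hA₀
  obtain ⟨M, M', rfl, rfl, h'⟩ := (hinv _ _ _ (hX.dom h)).2 _ _ h
  exact tmEq_lam hX hpi (hA.dsub ψ) (hB.dsub ψ) h'

/-! ### Composition in function types -/

variable {k : ℕ} {rs : Fin (k + 1) → Dim d} {r : Dim d} {M O : Tm u d 0}
  {N P : Fin (k + 1) → Bool → Tm u (d + 1) 0}

/-- The body of the function to which a composition in `A → B` evaluates. -/
def hcomArrBody (B : Tm u d 0) (rs : Fin (k + 1) → Dim d) (r r' : Dim d) (M : Tm u d 0)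
    (N : Fin (k + 1) → Bool → Tm u (d + 1) 0) : Tm u d 1 :=
  .hcom k rs B.twk r r' (.app M.twk (.var 0)) (fun i ε => .app (N i ε).twk (.var 0))

theorem hcomArrBody_subst (r' : Dim d) (Q : Tm u d 0) :
    (hcomArrBody B rs r r' M N).subst Q =
      .hcom k rs B r r' (.app M Q) (fun i ε => .app (N i ε) Q.dwk) := by
  simp only [hcomArrBody, Tm.subst, Tm.tsub, Tm.twk_tsub_subDLift]
  simp only [Tm.twk_tsub_cases]
  rfl

theorem hcomArrBody_dsub (r' : Dim d) {d' : ℕ} (ψ : DSub d d') :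
    (hcomArrBody B rs r r' M N).dsub ψ = hcomArrBody (B.dsub ψ) (fun i => (rs i).dsub ψ)
      (r.dsub ψ) (r'.dsub ψ) (M.dsub ψ) (fun i ε => (N i ε).dsub ψ.lift) := by
  simp only [hcomArrBody, Tm.dsub, Tm.twk_dsub]

theorem step_hcom_arr (r' : Dim d) {d' : ℕ} (ψ : DSub d d') :
    Step ((Tm.hcom k rs (.arr A B) r r' M N).dsub ψ)
      ((Tm.lam (hcomArrBody B rs r r' M N)).dsub ψ) := by
  rw [Tm.dsub, Tm.dsub, hcomArrBody_dsub, Tm.arr_dsub]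
  exact .hcom_pi _ _ _ _ _ _ _

/-- Applying cap and tubes to an argument that is constant in the tube direction turns a composition
problem in `A → B` into one in `B`. -/
theorem KanPrem.app (hX : IsCTS X) (hinv : ArrInv X)
    (h : KanPrem (tmFam X (.arr A B)) rs r M O N P) {Q Q' : Tm u d 0} (hQ : TmEq X Q Q' A) :
    KanPrem (tmFam X B) rs r (.app M Q) (.app O Q') (fun i ε => .app (N i ε) Q.dwk)
      (fun i ε => .app (P i ε) Q'.dwk) := by
  have key : ∀ {d' : ℕ} {ψ : DSub d d'} {F F' Q Q' : Tm u d' 0},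
      tmFam X (.arr A B) d' ψ F F' → TmEq X Q Q' (A.dsub ψ) →
      tmFam X B d' ψ (.app F Q) (.app F' Q') := by
    intro d' ψ F F' Q Q' hF hQ
    rw [tmFam, Tm.arr_dsub] at hF
    exact hF.app hX hinv hQ
  refine ⟨key h.cap (by simpa using hQ), fun i j ε ε' d' ψ hψ => ?_, fun i ε d' ψ hψ => ?_,
    fun i ε d' ψ hψ => ?_⟩
  · refine key (h.adj i j ε ε' d' ψ hψ) ?_
    rw [Tm.dwk, Tm.dsub_dsub]
    exact (hQ.left hX).dsub _
  · refine key (h.tube i ε d' ψ hψ) ?_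
    rw [Tm.dwk, Tm.dwk, Tm.dsub_dsub, Tm.dsub_dsub]
    exact hQ.dsub _
  · refine key (h.start i ε d' ψ hψ) ?_
    rw [← Tm.inst, Tm.dwk_inst]
    exact (hQ.left hX).dsub ψ

theorem openTmEq_hcomArrBody (hX : IsCTS X) (hinv : ArrInv X) (hA : TyEq X A A)
    (hB : TyEq X B B') (r' : Dim d) (h : KanPrem (tmFam X (.arr A B)) rs r M O N P) :
    OpenTmEq X A (hcomArrBody B rs r r' M N) (hcomArrBody B' rs r r' O P) B.twk := by
  refine openTmEq_twk hA.1 (hB.left hX) fun d' ψ Q Q' hQ => ?_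
  rw [hcomArrBody_dsub, hcomArrBody_dsub, hcomArrBody_subst, hcomArrBody_subst]
  have h := h.dsub (tmFam_stable _) ψ
  rw [tmFam_res, Tm.arr_dsub] at h
  exact hB.2.2.2.hcom ψ _ (h.app hX hinv hQ)

/-- The body does not mention the domain, so `A'` is arbitrary and the lemma serves both sides of
the equality of compositions. -/
theorem tmEq_hcom_arr_lam (hX : IsCTS X) (hpi : HasPi X) (hA : TyEq X A A)
    (hB : TyEq X B B) (A' : Tm u d 0) (r' : Dim d)
    (h : OpenTmEq X A (hcomArrBody B' rs r r' M N) (hcomArrBody B' rs r r' M N) B.twk) :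
    TmEq X (.hcom k rs (.arr A' B') r r' M N) (.lam (hcomArrBody B' rs r r' M N)) (.arr A B) :=
  .of_stable hX (tmEq_lam hX hpi hA hB h) fun ψ => .single (step_hcom_arr r' ψ)

theorem tmEq_hcom_arr (hX : IsCTS X) (hinv : ArrInv X) (hpi : HasPi X) (hA : TyEq X A A')
    (hB : TyEq X B B') (r' : Dim d) (h : KanPrem (tmFam X (.arr A B)) rs r M O N P) :
    TmEq X (.hcom k rs (.arr A B) r r' M N) (.hcom k rs (.arr A' B') r r' O P) (.arr A B) := by
  have hA := hA.left hX
  have hb := openTmEq_hcomArrBody hX hinv hA hB r' h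
  have hl := tmEq_lam hX hpi hA (hB.left hX) hb
  exact (tmEq_hcom_arr_lam hX hpi hA (hB.left hX) A r' (hb.trans hX (hb.symm hX))).trans hX
    (hl.trans hX ((tmEq_hcom_arr_lam hX hpi hA (hB.left hX) A' r'
      ((hb.symm hX).trans hX hb)).symm hX))

/-- Unfolding the composition and applying the resulting lambda are both steps stable under
substitution. -/
theorem tmEq_app_hcom_arr (hX : IsCTS X) (hinv : ArrInv X) (hB : TyEq X B B) (r' : Dim d)
    (h : KanPrem (tmFam X (.arr A B)) rs r M M N N) {Q : Tm u d 0} (hQ : TmEq X Q Q A) :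
    TmEq X (.app (.hcom k rs (.arr A B) r r' M N) Q)
      (.hcom k rs B r r' (.app M Q) (fun i ε => .app (N i ε) Q.dwk)) B := by
  rw [← hcomArrBody_subst]
  refine .of_stable hX ?_ fun ψ => ?_
  · rw [hcomArrBody_subst]
    have := hB.2.2.2.hcom (DSub.id d) r' (by simpa only [Tm.dsub_id] using h.app hX hinv hQ)
    simpa only [Tm.dsub_id] using this
  · rw [Tm.subst_dsub]
    exact .tail (.single (.app_fun _ (step_hcom_arr r' ψ))) (.app_lam _ _)

/-! ### Coercion in function types -/

end Arr

section CoeArr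

variable {d : ℕ} {A A' B B' : Tm u (d + 1) 0} {r : Dim d} {M O : Tm u d 0}

/-- The body of the function to which a coercion in `A → B` evaluates. -/
def coeArrBody (A B : Tm u (d + 1) 0) (r r' : Dim d) (M : Tm u d 0) : Tm u d 1 :=
  .coe B.twk r r' (.app M.twk (.coe A.twk r' r (.var 0)))

theorem coeArrBody_subst (r' : Dim d) (Q : Tm u d 0) :
    (coeArrBody A B r r' M).subst Q = .coe B r r' (.app M (.coe A r' r Q)) := by
  simp only [coeArrBody, Tm.subst, Tm.tsub, Tm.twk_tsub_subDLift]
  simp only [Tm.twk_tsub_cases]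
  rfl

theorem coeArrBody_dsub (r' : Dim d) {d' : ℕ} (ψ : DSub d d') :
    (coeArrBody A B r r' M).dsub ψ =
      coeArrBody (A.dsub ψ.lift) (B.dsub ψ.lift) (r.dsub ψ) (r'.dsub ψ) (M.dsub ψ) := by
  simp only [coeArrBody, Tm.dsub, Tm.twk_dsub]

theorem step_coe_arr (r' : Dim d) {d' : ℕ} (ψ : DSub d d') :
    Step ((Tm.coe (.arr A B) r r' M).dsub ψ) ((Tm.lam (coeArrBody A B r r' M)).dsub ψ) := by
  rw [Tm.dsub, Tm.dsub, coeArrBody_dsub, Tm.arr_dsub]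
  have := Step.coe_pi (A.dsub ψ.lift) (B.dsub ψ.lift).twk (r.dsub ψ) (r'.dsub ψ) (M.dsub ψ)
  rwa [Tm.twk_tsub_closed] at this

/-- The argument is carried back from `r'` to `r` along `A`, the function applied there, and the
result carried forward along `B`. -/
theorem tmEq_coe_app_coe (hX : IsCTS X) (hinv : ArrInv X) (hA : TyEq X A A') (hB : TyEq X B B')
    (r' : Dim d) (h : TmEq X M O ((Tm.arr A B).inst r)) {d' : ℕ} (ψ : DSub d d')
    {Q Q' : Tm u d' 0} (hQ : TmEq X Q Q' ((A.inst r').dsub ψ)) :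
    TmEq X (((coeArrBody A B r r' M).dsub ψ).subst Q) (((coeArrBody A' B' r r' O).dsub ψ).subst Q')
      ((B.inst r').dsub ψ) := by
  rw [coeArrBody_dsub, coeArrBody_dsub, coeArrBody_subst, coeArrBody_subst, Tm.inst_dsub]
  rw [Tm.inst_dsub] at hQ
  have hM := h.dsub ψ
  rw [Tm.inst_dsub, Tm.arr_dsub, Tm.inst, Tm.arr_dsub] at hM
  exact hB.2.2.2.coe_eq _ ψ.lift _ _ _ _ (hM.app hX hinv (hA.2.2.2.coe_eq _ ψ.lift _ _ _ _ hQ))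

theorem openTmEq_coeArrBody (hX : IsCTS X) (hinv : ArrInv X) (hA : TyEq X A A')
    (hB : TyEq X B B') (r' : Dim d) (h : TmEq X M O ((Tm.arr A B).inst r)) :
    OpenTmEq X (A.inst r') (coeArrBody A B r r' M) (coeArrBody A' B' r r' O) (B.inst r').twk :=
  openTmEq_twk ((hA.1.left hX).dsub _) ((hB.left hX).dsub _) fun _ ψ _ _ hQ =>
    tmEq_coe_app_coe hX hinv hA hB r' h ψ hQ

theorem tmEq_coe_arr (hX : IsCTS X) (hinv : ArrInv X) (hpi : HasPi X) (hA : TyEq X A A')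
    (hB : TyEq X B B') (r' : Dim d) (h : TmEq X M O ((Tm.arr A B).inst r)) :
    TmEq X (.coe (.arr A B) r r' M) (.coe (.arr A' B') r r' O) ((Tm.arr A B).inst r') := by
  have hl := tmEq_lam hX hpi ((hA.left hX).dsub (DSub.inst r')) ((hB.left hX).dsub (DSub.inst r'))
    (openTmEq_coeArrBody hX hinv hA hB r' h)
  rw [Tm.inst, Tm.arr_dsub]
  have h₁ : TmEq X (.coe (.arr A B) r r' M) _ _ :=
    .of_stable hX (hl.left hX) fun ψ => .single (step_coe_arr r' ψ)
  have h₂ : TmEq X (.coe (.arr A' B') r r' O) _ _ :=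
    .of_stable hX (hl.right hX) fun ψ => .single (step_coe_arr r' ψ)
  exact h₁.trans hX (hl.trans hX (h₂.symm hX))

theorem tmEq_app_coe_arr (hX : IsCTS X) (hinv : ArrInv X) (hA : TyEq X A A) (hB : TyEq X B B)
    (r' : Dim d) (h : TmEq X M M ((Tm.arr A B).inst r)) {Q : Tm u d 0}
    (hQ : TmEq X Q Q (A.inst r')) :
    TmEq X (.app (.coe (.arr A B) r r' M) Q) (.coe B r r' (.app M (.coe A r' r Q)))
      (B.inst r') := by
  rw [← coeArrBody_subst]
  refine .of_stable hX ?_ fun ψ => ?_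
  · simpa using tmEq_coe_app_coe hX hinv hA hB r' h (DSub.id d) (by simpa using hQ)
  · rw [Tm.subst_dsub]
    exact .tail (.single (.app_fun _ (step_coe_arr r' ψ))) (.app_lam _ _)

end CoeArr

/-- Function types of types are types. -/
theorem tyEq_arr (hX : IsCTS X) (hinv : ArrInv X) (hpi : HasPi X) {d : ℕ} {A A' B B' : Tm u d 0}
    (hA : TyEq X A A') (hB : TyEq X B B') : TyEq X (.arr A B) (.arr A' B') := by
  refine ⟨preTyEq_arr hX hpi hA hB, cubical_arr hX hinv hpi (hA.left hX) (hB.left hX),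
    cubical_arr hX hinv hpi (hA.right hX) (hB.right hX), .mk' ?_ ?_ ?_ ?_ ?_⟩
  all_goals intro d' ψ; rw [Tm.arr_dsub]
  · intro k rs r r' M O N P h
    rw [Tm.arr_dsub]
    exact tmEq_hcom_arr hX hinv hpi (hA.dsub ψ) (hB.dsub ψ) r' h
  · intro k rs r M N h
    have hA := (hA.left hX).dsub ψ
    have hB := (hB.left hX).dsub ψ
    have hM : TmEq X M M (.arr (A.dsub ψ) (B.dsub ψ)) := (kanPrem_iff.1 h).1
    refine tmEq_arr_ext hX hinv hpi hA hB (tmEq_hcom_arr hX hinv hpi hA hB r h) hM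
      fun d'' φ Q Q' hQ => ?_
    have hφ := h.dsub (tmFam_stable _) φ
    rw [tmFam_res, Tm.arr_dsub] at hφ
    have hMφ := hM.dsub φ
    rw [Tm.arr_dsub] at hMφ
    rw [Tm.dsub, Tm.arr_dsub]
    refine (tmEq_app_hcom_arr hX hinv (hB.dsub φ) _ hφ (hQ.left hX)).trans hX
      (TmEq.trans hX ?_ (hMφ.app hX hinv hQ))
    -- On an argument, the cap equation in `A → B` is the cap equation in `B` for the applied
    -- problem.
    exact hB.2.2.2.cap φ (hφ.app hX hinv (hQ.left hX))
  · intro k rs r r' M N h i ε hi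
    have hA := (hA.left hX).dsub ψ
    have hB := (hB.left hX).dsub ψ
    have hN : TmEq X ((N i ε).inst r') ((N i ε).inst r') (.arr (A.dsub ψ) (B.dsub ψ)) := by
      have := h.adj_inst r' i i ε ε (DSub.id d') (by rw [hi]; rfl) (by rw [hi]; rfl)
      simpa only [tmFam, Tm.dsub_id] using this
    refine tmEq_arr_ext hX hinv hpi hA hB (tmEq_hcom_arr hX hinv hpi hA hB r' h) hN
      fun d'' φ Q Q' hQ => ?_
    have hφ := h.dsub (tmFam_stable _) φ
    rw [tmFam_res, Tm.arr_dsub] at hφ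
    have hNφ := hN.dsub φ
    rw [Tm.arr_dsub] at hNφ
    rw [Tm.dsub, Tm.arr_dsub]
    refine (tmEq_app_hcom_arr hX hinv (hB.dsub φ) _ hφ (hQ.left hX)).trans hX
      (TmEq.trans hX ?_ (hNφ.app hX hinv hQ))
    have := hB.2.2.2.tube φ (r'.dsub φ) (hφ.app hX hinv (hQ.left hX)) (i := i) (ε := ε)
      (by rw [hi]; rfl)
    -- The argument was weakened into the tube direction, so instantiating that direction leaves it
    -- unchanged.
    rw [Tm.inst, Tm.dsub, ← Tm.inst, ← Tm.inst, Tm.dwk_inst, ← Tm.inst_dsub] at this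
    exact this
  · intro r r' M N h
    rw [Tm.arr_dsub]
    exact tmEq_coe_arr hX hinv hpi (hA.dsub ψ) (hB.dsub ψ) r' h
  · intro r M h
    have hA := (hA.left hX).dsub ψ
    have hB := (hB.left hX).dsub ψ
    have hcoe := tmEq_coe_arr hX hinv hpi hA hB r h
    have h' := h
    rw [Tm.inst, Tm.arr_dsub] at hcoe h' ⊢
    refine tmEq_arr_ext hX hinv hpi (hA.dsub _) (hB.dsub _) hcoe h' fun d'' φ Q Q' hQ => ?_
    have hφ := h.dsub φ
    rw [Tm.inst_dsub, Tm.arr_dsub] at hφ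
    have hφ' := hφ
    rw [Tm.inst, Tm.arr_dsub] at hφ'
    rw [← Tm.inst, Tm.inst_dsub] at hQ ⊢
    rw [Tm.dsub, Tm.arr_dsub]
    -- Both coercions are trivial: the one of the argument in `A` by this, the one of the result in
    -- `B` in the last step.
    have hQ' := (hA.2.2.2.coe_same _ φ.lift _ Q (hQ.left hX)).trans hX hQ
    have happ := hφ'.app hX hinv hQ'
    have hA' := hA.dsub φ.lift
    have hB' := hB.dsub φ.lift
    exact (tmEq_app_coe_arr hX hinv hA' hB' _ hφ (hQ.left hX)).trans hX
      ((hB.2.2.2.coe_same _ φ.lift _ _ (happ.left hX)).trans hX happ)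

end CubicalTT

namespace CubicalTT

variable {u : Bool} {X Y : PreCTS u}

/-! ## The extended operator -/

/-- Substituting for the single variable leaves a closed equation. The pretype condition on the
codomain is dropped, for it is the one on `A` after substitution. -/
theorem leftInv_iff {d : ℕ} {Ξ : Eqns d} {A F G : Tm u d 0} : LeftInv X Ξ A F G ↔
    ∀ (d' : ℕ) (ψ : DSub d d'), Sat Ξ ψ → PreTyEq X (A.dsub ψ) (A.dsub ψ) ∧
      ∀ (d'' : ℕ) (φ : DSub d' d'') (N N' : Tm u d'' 0), TmEq X N N' ((A.dsub ψ).dsub φ) →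
        TmEq X (.app ((G.dsub ψ).dsub φ) (.app ((F.dsub ψ).dsub φ) N)) N'
          ((A.dsub ψ).dsub φ) := by
  refine forall_congr' fun d' => forall_congr' fun ψ => forall_congr' fun _ => ?_
  simp only [OpenTmEq, OpenPreTyEq, Tm.dsub, Tm.twk_dsub, Tm.twk_subst]
  simp only [Tm.subst, Tm.tsub, Tm.twk_tsub_cases, Fin.cases_zero]
  exact and_congr_left fun _ => and_iff_left_of_imp fun h _ φ _ _ _ => h.dsub φ

/-- `G'(F' N) ≐ G(F N) ≐ N'`, converted along `A ≐ A'`. The first equality uses that application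
preserves equality, hence `hinv`. -/
theorem LeftInv.congr (hX : IsCTS X) (hinv : ArrInv X) {d : ℕ} {Ξ : Eqns d}
    {A A' B F F' G G' : Tm u d 0}
    (hA : ∀ (d' : ℕ) (ψ : DSub d d'), Sat Ξ ψ → PreTyEq X (A.dsub ψ) (A'.dsub ψ))
    (hF : TmEqRes X Ξ F F' (.arr A B)) (hG : TmEqRes X Ξ G G' (.arr B A))
    (h : LeftInv X Ξ A F G) : LeftInv X Ξ A' F' G' := by
  rw [leftInv_iff] at h ⊢
  intro d' ψ hψ
  refine ⟨(hA d' ψ hψ).right hX, fun d'' φ N N' hN => ?_⟩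
  have hAφ := (hA d' ψ hψ).dsub φ
  have hN := hN.conv hX (hAφ.symm hX)
  have hFφ := (hF d' ψ hψ).dsub φ
  have hGφ := (hG d' ψ hψ).dsub φ
  rw [Tm.arr_dsub, Tm.arr_dsub] at hFφ hGφ
  exact ((((hGφ.app hX hinv (hFφ.app hX hinv (hN.left hX))).symm hX).trans hX
    ((h d' ψ hψ).2 d'' φ N N' hN))).conv hX hAφ

theorem LeftInv.mono (hX : IsCTS X) (hY : IsCTS Y) (hXY : X.Approx Y) {d : ℕ} {Ξ : Eqns d}
    {A F G : Tm u d 0} (h : LeftInv X Ξ A F G) : LeftInv Y Ξ A F G :=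
  fun d' ψ hψ => (h d' ψ hψ).mono hX hY hXY

theorem TmEqRes.convArr (hX : IsCTS X) {d : ℕ} {Ξ : Eqns d} {A A' M N : Tm u d 0}
    (hA : TyEqRes X Ξ A A') (h : TmEqRes X Ξ M N A) : TmEqRes X Ξ M N A' :=
  fun d' ψ hψ => (h d' ψ hψ).conv hX (hA d' ψ hψ).1

theorem TmEqRes.symm (hX : IsCTS X) {d : ℕ} {Ξ : Eqns d} {A M N : Tm u d 0}
    (h : TmEqRes X Ξ M N A) : TmEqRes X Ξ N M A := fun d' ψ hψ => (h d' ψ hψ).symm hX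

theorem TmEqRes.trans (hX : IsCTS X) {d : ℕ} {Ξ : Eqns d} {A M N O : Tm u d 0}
    (h : TmEqRes X Ξ M N A) (h' : TmEqRes X Ξ N O A) : TmEqRes X Ξ M O A :=
  fun d' ψ hψ => (h d' ψ hψ).trans hX (h' d' ψ hψ)

theorem TmEqRes.mono (hX : IsCTS X) (hY : IsCTS Y) (hXY : X.Approx Y) {d : ℕ} {Ξ : Eqns d}
    {A M N : Tm u d 0} (h : TmEqRes X Ξ M N A) : TmEqRes Y Ξ M N A :=
  fun d' ψ hψ => (h d' ψ hψ).mono hX hY hXY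

theorem TyEqRes.symm (hX : IsCTS X) {d : ℕ} {Ξ : Eqns d} {A B : Tm u d 0}
    (h : TyEqRes X Ξ A B) : TyEqRes X Ξ B A := fun d' ψ hψ => (h d' ψ hψ).symm hX

theorem TyEqRes.trans (hX : IsCTS X) {d : ℕ} {Ξ : Eqns d} {A B C : Tm u d 0}
    (h : TyEqRes X Ξ A B) (h' : TyEqRes X Ξ B C) : TyEqRes X Ξ A C :=
  fun d' ψ hψ => (h d' ψ hψ).trans hX (h' d' ψ hψ)

theorem TyEqRes.mono (hX : IsCTS X) (hY : IsCTS Y) (hXY : X.Approx Y) {d : ℕ} {Ξ : Eqns d}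
    {A B : Tm u d 0} (h : TyEqRes X Ξ A B) : TyEqRes Y Ξ A B :=
  fun d' ψ hψ => (h d' ψ hψ).mono hX hY hXY

theorem TyEqRes.of_approx (hX : IsCTS X) (hY : IsCTS Y) (hXY : X.Approx Y) {d : ℕ} {Ξ : Eqns d}
    {A B : Tm u d 0} (hA : TyEqRes X Ξ A A) (h : TyEqRes Y Ξ A B) : TyEqRes X Ξ A B :=
  fun d' ψ hψ => .of_approx hX hY hXY (hA d' ψ hψ).1 (h d' ψ hψ)

theorem TmEqRes.of_approx (hX : IsCTS X) (hY : IsCTS Y) (hXY : X.Approx Y) {d : ℕ} {Ξ : Eqns d}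
    {A M N : Tm u d 0} (hA : TyEqRes X Ξ A A) (h : TmEqRes Y Ξ M N A) : TmEqRes X Ξ M N A :=
  fun d' ψ hψ => ((hA d' ψ hψ).1.tmEq_iff hX hY hXY).2 (h d' ψ hψ)

/-! ### The clauses for isomorphism-univalence types -/

namespace IsoE

variable {d : ℕ} {A B C : Tm u d 0}

theorem val (h : IsoE X d A B) : IsVal A ∧ IsVal B := by
  cases h with
  | ia h x => exact ⟨.ia h x _ _ _ _, .ia h x _ _ _ _⟩

/-- The clause states the inverse laws for the unprimed maps only; symmetry has to move them to the
primed ones. This is the one place in the clause where function types must behave as expected. -/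
theorem symm (hX : IsCTS X) (hinv : ArrInv X) (h : IsoE X d A B) : IsoE X d B A := by
  cases h with
  | ia h x hA hB hAB hBA hF hG hGF hFG =>
    exact .ia h x (hA.symm hX) (hB.symm hX) (hAB.symm hX) (hBA.symm hX)
      ((hF.symm hX).convArr hX hAB) ((hG.symm hX).convArr hX hBA)
      (hGF.congr hX hinv (fun _ ψ _ => hA.1.dsub ψ) hF hG)
      (hFG.congr hX hinv (fun _ ψ hψ => (hB _ ψ hψ).1) hG hF)

theorem trans (hX : IsCTS X) (h : IsoE X d A B) (h' : IsoE X d B C) : IsoE X d A C := by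
  cases h with
  | ia h x hA hB hAB hBA hF hG hGF hFG => cases h' with
    | ia _ _ hA' hB' hAB' hBA' hF' hG' _ _ =>
      exact .ia h x (hA.trans hX hA') (hB.trans hX hB') (hAB.trans hX hAB') (hBA.trans hX hBA')
        (hF.trans hX (hF'.convArr hX (hAB.symm hX)))
        (hG.trans hX (hG'.convArr hX (hBA.symm hX))) hGF hFG

theorem mono (hX : IsCTS X) (hY : IsCTS Y) (hXY : X.Approx Y) (h : IsoE X d A B) :
    IsoE Y d A B := by
  cases h with
  | ia h x hA hB hAB hBA hF hG hGF hFG =>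
    exact .ia h x (hA.mono hX hY hXY) (hB.mono hX hY hXY) (hAB.mono hX hY hXY)
      (hBA.mono hX hY hXY) (hF.mono hX hY hXY) (hG.mono hX hY hXY) (hGF.mono hX hY hXY)
      (hFG.mono hX hY hXY)

/-- The inverse laws mention the left data only, so they come from `hA`; the other premises are
pulled back along the types that `hA` contains. -/
theorem of_approx (hX : IsCTS X) (hY : IsCTS Y) (hXY : X.Approx Y) (hA : IsoE X d A A)
    (h : IsoE Y d A B) : IsoE X d A B := by
  cases h with
  | ia h x hA' hB' hAB' hBA' hF' hG' => cases hA with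
    | ia _ _ hA hB hAB hBA hF hG hGF hFG =>
      exact .ia h x (.of_approx hX hY hXY hA.1 hA') (.of_approx hX hY hXY hB hB')
        (.of_approx hX hY hXY hAB hAB') (.of_approx hX hY hXY hBA hBA')
        (.of_approx hX hY hXY hAB hF') (.of_approx hX hY hXY hBA hG') hGF hFG

theorem not_FE (h : IsoE X d A B) : ¬ FE Y d B C := by
  cases h
  exact nofun

theorem not_FE' (h : IsoE X d A B) : ¬ FE Y d C A := by
  cases h
  exact nofun

theorem not_FΦ {V W : Tm u d 0} (h : IsoE X d A B) : ¬ FΦ Y d A V W := by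
  cases h
  exact nofun

end IsoE

namespace IsoΦ

variable {d : ℕ} {A B U V W : Tm u d 0}

theorem val (h : IsoΦ X d A V W) : IsVal V ∧ IsVal W := by
  cases h with
  | ia h x => exact ⟨.iain h x _ _, .iain h x _ _⟩

theorem symm (hX : IsCTS X) (h : IsoΦ X d A V W) : IsoΦ X d A W V := by
  cases h with
  | ia h x hM h₁ h₂ => exact .ia h x (hM.symm hX) h₂ h₁

theorem trans (hX : IsCTS X) (h : IsoΦ X d A U V) (h' : IsoΦ X d A V W) : IsoΦ X d A U W := by
  cases h with
  | ia h x hM h₁ h₂ => cases h' with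
    | ia _ _ hM' h₁' h₂' => exact .ia h x (hM.trans hX hM') h₁ h₂'

/-- The map recorded in an element is compared with the one in the type, so it is carried along `F'
≐ F` and then converted. -/
theorem conv (hX : IsCTS X) (hAB : IsoE X d A B) (h : IsoΦ X d A V W) : IsoΦ X d B V W := by
  cases hAB with
  | ia h' x hA hB hAB hBA hF hG hGF hFG => cases h with
    | ia _ _ hM h₁ h₂ =>
      exact .ia h' x (hM.conv hX hA.1) (((hF.symm hX).trans hX h₁).convArr hX hAB)
        (((hF.symm hX).trans hX h₂).convArr hX hAB)

theorem mono (hX : IsCTS X) (hY : IsCTS Y) (hXY : X.Approx Y) (h : IsoΦ X d A V W) :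
    IsoΦ Y d A V W := by
  cases h with
  | ia h x hM h₁ h₂ =>
    exact .ia h x (hM.mono hX hY hXY) (h₁.mono hX hY hXY) (h₂.mono hX hY hXY)

theorem of_approx (hX : IsCTS X) (hY : IsCTS Y) (hXY : X.Approx Y) (hA : IsoE X d A A)
    (h : IsoΦ Y d A V W) : IsoΦ X d A V W := by
  cases h with
  | ia h x hM h₁ h₂ => cases hA with
    | ia _ _ hA hB hAB =>
      exact .ia h x ((hA.1.tmEq_iff hX hY hXY).2 hM) (.of_approx hX hY hXY hAB h₁)
        (.of_approx hX hY hXY hAB h₂)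

theorem not_FE (h : IsoΦ X d A V W) : ¬ FE Y d A B := by
  cases h
  exact nofun

end IsoΦ

/-- A function type of `X` is one of `FopIso X` with the same elements, and there only the `pi`
clauses can have produced the type and its elements. -/
theorem ArrInv.of_approx_fopIso (h : X.Approx (FopIso X)) : ArrInv X := by
  intro d A B hE
  have hE' : FE X d (.pi A B.twk) (.pi A B.twk) ∨ IsoE X d (.pi A B.twk) (.pi A B.twk) :=
    h.1.1 _ _ _ hE
  obtain hE' | hE' := hE'
  · cases hE' with
    | pi hA hB =>
      refine ⟨hB.1, fun V W hV => ?_⟩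
      have hV' : FΦ X d (.pi A B.twk) V W ∨ IsoΦ X d (.pi A B.twk) V W :=
        ((h.2 _ _ hE _ _).1 hV).2
      obtain hV' | hV' := hV'
      · cases hV' with
        | pi hM => exact ⟨_, _, rfl, rfl, hM⟩
      · cases hV'
  · cases hE'

/-- The approximation hypothesis enters only through `ArrInv`. For the rest, canonical types of the
two groups of clauses have different heads, so each law concerns one group at a time. -/
theorem isCTS_fopIso (hX : IsCTS X) (h : X.Approx (FopIso X)) : IsCTS (FopIso X) := by
  have hinv := ArrInv.of_approx_fopIso h
  have hv : IsVPER (FopIso X).E :=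
    { val := fun h => h.elim FE.val IsoE.val
      symm := fun h => h.imp (FE.symm hX) (IsoE.symm hX hinv)
      trans := by
        rintro d A B C (h | h) (h' | h')
        · exact .inl (h.trans hX h')
        · exact absurd h h'.not_FE'
        · exact absurd h' h.not_FE
        · exact .inr (h.trans hX h') }
  have conv : ∀ {d : ℕ} {A B M N : Tm u d 0}, (FopIso X).E d A B → (FopIso X).Φ d A M N →
      (FopIso X).Φ d B M N := by
    rintro d A B M N hAB ⟨_, hM⟩
    refine ⟨hv.trans (hv.symm hAB) hAB, ?_⟩
    obtain hAB | hAB := hAB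
    · exact .inl ((hM.resolve_right fun h => h.not_FE hAB).conv hX hAB)
    · exact .inr ((hM.resolve_left hAB.not_FΦ).conv hX hAB)
  refine ⟨hv, fun h => h.1, fun h => h.2.elim FΦ.val IsoΦ.val, ?_, ?_,
    fun hAB _ _ => ⟨conv hAB, conv (hv.symm hAB)⟩⟩
  · rintro d A M N ⟨hA, hM⟩
    refine ⟨hA, ?_⟩
    obtain hA | hA := hA
    · exact .inl ((hM.resolve_right fun h => h.not_FE hA).symm hX hA)
    · exact .inr ((hM.resolve_left hA.not_FΦ).symm hX)
  · rintro d A M N O ⟨hA, hM⟩ ⟨_, hN⟩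
    refine ⟨hA, ?_⟩
    obtain hA | hA := hA
    · exact .inl ((hM.resolve_right fun h => h.not_FE hA).trans hX hA
        (hN.resolve_right fun h => h.not_FE hA))
    · exact .inr ((hM.resolve_left hA.not_FΦ).trans hX (hN.resolve_left hA.not_FΦ))

theorem fopIso_mono : MonoOnCTS (FopIso (u := u)) := by
  intro X Y hX hY hXY
  have mono : ∀ {d : ℕ} {A B : Tm u d 0}, (FopIso X).E d A B → (FopIso Y).E d A B :=
    fun h => h.imp (FE.mono hX hY hXY) (IsoE.mono hX hY hXY)
  refine ⟨⟨fun _ _ _ => mono, fun d A hA B => ⟨mono, fun h => ?_⟩⟩,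
    fun d A hA V W => ⟨fun h => ⟨mono h.1, h.2.imp (FΦ.mono hX hY hXY) (IsoΦ.mono hX hY hXY)⟩,
      fun h => ⟨hA, ?_⟩⟩⟩
  · obtain hA | hA := hA
    · exact .inl (.of_approx hX hY hXY hA (h.resolve_right fun h => h.not_FE' hA))
    · exact .inr (.of_approx hX hY hXY hA (h.resolve_left hA.not_FE))
  · obtain hA | hA := hA
    · exact .inl (.of_approx hX hY hXY hA (h.2.resolve_right fun h => h.not_FE hA))
    · exact .inr (.of_approx hX hY hXY hA (h.2.resolve_left hA.not_FΦ))

/-! ## Fixed points have the types -/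

/-- A cubical type system that contains the types of `F`, with the elements prescribed by `F`, has
all these types. -/
theorem hasTypes_of_FE (hX : IsCTS X) (hE : ∀ d A B, FE X d A B → X.E d A B)
    (hΦ : ∀ d A, FE X d A A → ∀ V W, X.Φ d A V W ↔ FΦ X d A V W) : HasTypes X := by
  have hdiag : ∀ {d : ℕ} {A B : Tm u d 0}, FE X d A B → FE X d A A :=
    fun h => h.trans hX (h.symm hX)
  have hbool : ∀ d V W, X.Φ d .bool V W ↔ BoolRel u d V W := fun d V W =>
    (hΦ d _ .bool V W).trans ⟨fun h => by cases h; assumption, .bool⟩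
  have hcircle : ∀ d V W, X.Φ d .circle V W ↔ CircleRel u d V W := fun d V W =>
    (hΦ d _ .circle V W).trans ⟨fun h => by cases h; assumption, .circle⟩
  constructor
  · refine ⟨fun d => hE _ _ _ .bool, ?_⟩
    have : (fun d V W => X.Φ d .bool V W) = BoolRel u := by
      funext d V W
      exact propext (hbool d V W)
    rw [this]
    exact ⟨⟨boolRel_isVPER u, (isVPERLfp_boolRel u).fixed.le⟩, fun R hR d V W h => h R hR⟩
  · refine ⟨fun d => hE _ _ _ .circle, ?_⟩
    have : (fun d V W => X.Φ d .circle V W) = CircleRel u := by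
      funext d V W
      exact propext (hcircle d V W)
    rw [this]
    exact ⟨⟨circleRel_isVPER u, (isVPERLfp_circleRel u).fixed.le⟩, fun R hR d V W h => h R hR⟩
  · intro d A A' B B' hA hB d' ψ
    have h := FE.pi (hA.dsub ψ) (hB.dsub ψ)
    have hΦ' := hΦ _ _ (hdiag h)
    refine ⟨hE _ _ _ h, fun M M' hM => (hΦ' _ _).2 (.pi hM), fun R hR V W hV => ?_⟩
    cases (hΦ' V W).1 hV with
    | pi hM => exact hR _ _ hM
  · intro d A A' B B' hA hB d' ψ
    have h := FE.sigma (hA.dsub ψ) (hB.dsub ψ)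
    have hΦ' := hΦ _ _ (hdiag h)
    refine ⟨hE _ _ _ h, fun M M' N N' hM hN => (hΦ' _ _).2 (.sigma hM hN),
      fun R hR V W hV => ?_⟩
    cases (hΦ' V W).1 hV with
    | sigma hM hN => exact hR _ _ _ _ hM hN
  · intro d A A' P₀ P₀' P₁ P₁' hA h₀ h₁ d' ψ
    have h₀ := h₀.dsub ψ
    have h₁ := h₁.dsub ψ
    rw [Tm.inst_dsub] at h₀ h₁
    have h := FE.ident (hA.dsub ψ.lift) h₀ h₁
    have hΦ' := hΦ _ _ (hdiag h)
    refine ⟨hE _ _ _ h, fun M M' hM h₀ h₁ => (hΦ' _ _).2 (.ident hM h₀ h₁),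
      fun R hR V W hV => ?_⟩
    cases (hΦ' V W).1 hV with
    | ident hM h₀ h₁ => exact hR _ _ hM h₀ h₁
  · intro d x
    -- The clause for `not_x` presupposes that `bool` is a type, which is where its Kan structure is
    -- used.
    have h := FE.notb x (tyEq_bool hX (fun d => hE _ _ _ .bool) hbool (d := d))
    have hΦ' := hΦ _ _ h
    refine ⟨hE _ _ _ h, fun M M' hM => (hΦ' _ _).2 (.notb x hM), fun R hR V W hV => ?_⟩
    cases (hΦ' V W).1 hV with
    | notb _ hM => exact hR _ _ hM

theorem hasTypes_of_fop (hX : IsCTS X) (hfix : Fop X = X) : HasTypes X := by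
  have hE : ∀ d A B, FE X d A B ↔ X.E d A B := fun d A B => by
    conv_rhs => rw [← hfix]
    exact Iff.rfl
  refine hasTypes_of_FE hX (fun d A B => (hE d A B).1) fun d A hA V W => ?_
  conv_lhs => rw [← hfix]
  exact and_iff_right hA

theorem hasTypes_of_fopIso (hX : IsCTS X) (hfix : FopIso X = X) : HasTypes X := by
  have hE : ∀ d A B, (FE X d A B ∨ IsoE X d A B) ↔ X.E d A B := fun d A B => by
    conv_rhs => rw [← hfix]
    exact Iff.rfl
  refine hasTypes_of_FE hX (fun d A B h => (hE d A B).1 (.inl h)) fun d A hA V W => ?_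
  conv_lhs => rw [← hfix]
  exact ⟨fun h => h.2.resolve_right fun h => h.not_FE hA, fun h => ⟨.inl hA, .inl h⟩⟩

/-- The clause additionally demands that `A → B` and `B → A` be types under the restriction. These
premises are supplied by `tyEq_arr`. -/
theorem IsoEq.isoE (hX : IsCTS X) (hinv : ArrInv X) (hpi : HasPi X) (hu : u = true) {d : ℕ}
    {r : Dim d} {A B F G A' B' F' G' : Tm u d 0} (h : IsoEq X r A B F G A' B' F' G') {d' : ℕ}
    (ψ : DSub d d') {x : Fin d'} (hx : r.dsub ψ = .name x) :
    IsoE X d' (.ia hu (.name x) (A.dsub ψ) (B.dsub ψ) (F.dsub ψ) (G.dsub ψ))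
      (.ia hu (.name x) (A'.dsub ψ) (B'.dsub ψ) (F'.dsub ψ) (G'.dsub ψ)) := by
  -- As `rψ = x`, a substitution with `x = 1` after `ψ` is one with `r = 1`; all restricted premises
  -- are pulled back this way.
  have hsat : ∀ {d'' : ℕ} {φ : DSub d' d''}, Sat [(.name x, .const true)] φ →
      Sat [(r, .const true)] (ψ.comp φ) := fun hφ => by
    rw [sat_singleton] at hφ ⊢
    rwa [← Dim.dsub_dsub, hx]
  have hA := h.dom.dsub ψ
  have hB : TyEqRes X [(.name x, .const true)] (B.dsub ψ) (B'.dsub ψ) := fun d'' φ hφ => by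
    simpa only [Tm.dsub_dsub] using h.cod _ _ (hsat hφ)
  have htm : ∀ {M N C : Tm u d 0}, TmEqRes X [(r, .const true)] M N C →
      TmEqRes X [(.name x, .const true)] (M.dsub ψ) (N.dsub ψ) (C.dsub ψ) :=
    fun h d'' φ hφ => by
      simpa only [Tm.dsub_dsub] using h _ _ (hsat hφ)
  have hleft : ∀ {C M N : Tm u d 0}, LeftInv X [(r, .const true)] C M N →
      LeftInv X [(.name x, .const true)] (C.dsub ψ) (M.dsub ψ) (N.dsub ψ) :=
    fun h => leftInv_iff.2 fun d'' φ hφ => by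
      simpa only [Tm.dsub_dsub] using leftInv_iff.1 h _ _ (hsat hφ)
  refine .ia hu x hA hB (fun d'' φ hφ => ?_) (fun d'' φ hφ => ?_) ?_ ?_ (hleft h.left_inv)
    (hleft h.right_inv)
  · rw [Tm.arr_dsub, Tm.arr_dsub]
    exact tyEq_arr hX hinv hpi (hA.dsub φ) (hB _ φ hφ)
  · rw [Tm.arr_dsub, Tm.arr_dsub]
    exact tyEq_arr hX hinv hpi (hB _ φ hφ) (hA.dsub φ)
  · have := htm h.fwd
    rwa [Tm.arr_dsub] at this
  · have := htm h.bwd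
    rwa [Tm.arr_dsub] at this

theorem hasIso_of_fopIso (hX : IsCTS X) (hfix : FopIso X = X) : HasIso X := by
  intro hu d r A B F G A' B' F' G' h d' ψ x hx
  -- A fixed point is in particular post-fixed.
  have hinv : ArrInv X := .of_approx_fopIso (hfix.symm ▸ .refl X)
  have hE := h.isoE hX hinv (hasTypes_of_fopIso hX hfix).pi hu ψ hx
  have hE' := hE.trans hX (hE.symm hX hinv)
  have hΦ : ∀ V W, X.Φ d' (.ia hu (.name x) (A.dsub ψ) (B.dsub ψ) (F.dsub ψ) (G.dsub ψ)) V W ↔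
      IsoΦ X d' (.ia hu (.name x) (A.dsub ψ) (B.dsub ψ) (F.dsub ψ) (G.dsub ψ)) V W := by
    intro V W
    conv_lhs => rw [← hfix]
    exact ⟨fun h => h.2.resolve_left hE'.not_FΦ, fun h => ⟨.inr hE', .inr h⟩⟩
  refine ⟨?_, fun M M' F₁ F₂ hM h₁ h₂ => (hΦ _ _).2 (.ia hu x hM h₁ h₂), fun R hR V W hV => ?_⟩
  · rw [← hfix]
    exact .inr hE
  · cases (hΦ V W).1 hV with
    | ia _ _ hM h₁ h₂ => exact hR _ _ _ _ hM h₁ h₂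

end CubicalTT

theorem mainTheorem3 :
    (∀ u : Bool,
      CubicalTT.IsCPO (CubicalTT.VPER.Approx (u := u)) ∧
      CubicalTT.IsCPO (CubicalTT.CTS.Approx (u := u)) ∧
      CubicalTT.IsVPERLfp CubicalTT.BoolOp (CubicalTT.BoolRel u) ∧
      CubicalTT.IsVPERLfp CubicalTT.CircleOp (CubicalTT.CircleRel u) ∧
      (∀ X : CubicalTT.PreCTS u, CubicalTT.IsCTS X → CubicalTT.IsCTS (CubicalTT.Fop X)) ∧
      CubicalTT.MonoOnCTS (CubicalTT.Fop (u := u)) ∧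
      (∃ X : CubicalTT.PreCTS u, CubicalTT.IsCTSLfp CubicalTT.Fop X) ∧
      (∀ X : CubicalTT.PreCTS u, CubicalTT.IsCTS X → CubicalTT.Fop X = X →
        CubicalTT.HasTypes X)) ∧
    ((∀ X : CubicalTT.PreCTS true, CubicalTT.IsCTS X → X.Approx (CubicalTT.FopIso X) →
        CubicalTT.IsCTS (CubicalTT.FopIso X)) ∧
      CubicalTT.MonoOnCTS (CubicalTT.FopIso (u := true)) ∧
      (∃ X : CubicalTT.PreCTS true, CubicalTT.IsCTSLfp CubicalTT.FopIso X) ∧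
      (∀ X : CubicalTT.PreCTS true, CubicalTT.IsCTS X → CubicalTT.FopIso X = X →
        CubicalTT.HasTypes X ∧ CubicalTT.HasIso X)) := by
  refine ⟨fun u => ⟨CubicalTT.isCPO_vper u, CubicalTT.isCPO_cts u, CubicalTT.isVPERLfp_boolRel u,
    CubicalTT.isVPERLfp_circleRel u, fun _ => CubicalTT.isCTS_fop, CubicalTT.fop_mono,
    CubicalTT.exists_isCTSLfp (fun _ hX _ => CubicalTT.isCTS_fop hX) CubicalTT.fop_mono,
    fun _ => CubicalTT.hasTypes_of_fop⟩, fun _ => CubicalTT.isCTS_fopIso, CubicalTT.fopIso_mono,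
    CubicalTT.exists_isCTSLfp (fun _ => CubicalTT.isCTS_fopIso) CubicalTT.fopIso_mono,
    fun _ hX hfix => ⟨CubicalTT.hasTypes_of_fopIso hX hfix, CubicalTT.hasIso_of_fopIso hX hfix⟩⟩
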